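/- Let $a,b,c$ be nonzero real numbers and $\epsilon_0,d,m,w>0$. Consider the system for $\psi=u+iv$ (complex valued) and $\varphi$ (real valued), functions of $(x,y,t)\in\mathbb R^3$: \[ i\psi_t+a\psi_{xx}+\epsilon_0\psi_{yy}=(b-wm)|\psi|^2\psi-w\,\psi\,\{m\partial_t+(mc-d)\partial_y\}\varphi, \] \[ \varphi_{xx}+(1-mc^2)\varphi_{yy}-m\varphi_{tt}-2mc\,\varphi_{yt}=\{m\partial_t+(mc-d)\partial_y\}|\psi|^2 . \] A Lie point symmetry is a smooth vector field on the space $\mathbb R^6$ of the variables $(x,y,t,u,v,\varphi)$ whose second prolongation annihilates the system at all second order jets that satisfy it. Put \[ X_1=\partial_t,\quad X_2=\partial_x,\quad X_3=\partial_y,\quad X_4=-v\partial_u+u\partial_v+\tfrac1{mw}\partial_\varphi, \] \[ X_5=t(-v\partial_u+u\partial_v)+\tfrac{t}{mw}\partial_\varphi,\quad X_6=t^2(-v\partial_u+u\partial_v)+\big(\tfrac{t^2}{mw}+\tfrac{x^2}{w}\big)\partial_\varphi . \] Then the Lie point symmetries form an infinite-dimensional real Lie algebra under the commutator of vector fields.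 It is described as follows, where $\zeta=my-(mc-d)t$. (A) If $m<d^2$, put $\alpha_0=\sqrt{m(d^2-m)}$, $P_A(F)=F(\alpha_0x-\zeta)\,\partial_\varphi$ and $Q_A(G)=G(\alpha_0x+\zeta)\,\partial_\varphi$. The symmetries are exactly the fields $\sum_{i=1}^6 k_iX_i+P_A(F)+Q_A(G)$ with $k_i\in\mathbb R$ and $F,G\in C^\infty(\mathbb R)$. Such a field vanishes only if all $k_i=0$ and $F=-G$ is constant. Moreover $[X_1,P_A(F)]=(mc-d)P_A(F')$, $[X_1,Q_A(G)]=(d-mc)Q_A(G')$, $[X_2,P_A(F)]=\alpha_0P_A(F')$, $[X_2,Q_A(G)]=\alpha_0Q_A(G')$, $[X_3,P_A(F)]=-mP_A(F')$, $[X_3,Q_A(G)]=mQ_A(G')$, $[X_2,X_6]=\frac1{w\alpha_0}\big(P_A(s)+Q_A(s)\big)$, where $s$ denotes the identity function. (B) If $m>d^2$, put $\sigma=\zeta/\sqrt{m(m-d^2)}$ and $P_B(H)=H(x,\sigma)\,\partial_\varphi$. The symmetries are exactly the fields $\sum_{i=1}^6k_iX_i+P_B(H)$ with $k_i\in\mathbb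 R$ and $H$ harmonic on $\mathbb R^2$; the $k_i$ and $H$ are unique. Moreover $[X_1,P_B(H)]=\frac{d-mc}{\sqrt{m(m-d^2)}}P_B(H_\sigma)$, $[X_2,P_B(H)]=P_B(H_x)$, $[X_3,P_B(H)]=\sqrt{\frac m{m-d^2}}\,P_B(H_\sigma)$, $[X_2,X_6]=P_B(2x/w)$. (C) If $m=d^2$, put $P_C(R)=x\,R(dy-(cd-1)t)\,\partial_\varphi$ and $Q_C(S)=S(dy-(cd-1)t)\,\partial_\varphi$. The symmetries are exactly the fields $\sum_{i=1}^6k_iX_i+P_C(R)+Q_C(S)$ with $k_i\in\mathbb R$ and $R,S\in C^\infty(\mathbb R)$; the $k_i$, $R$ and $S$ are unique. Moreover $[X_1,P_C(R)]=(1-cd)P_C(R')$, $[X_2,P_C(R)]=Q_C(R)$, $[X_3,P_C(R)]=d\,P_C(R')$, $[X_1,Q_C(S)]=(1-cd)Q_C(S')$, $[X_3,Q_C(S)]=d\,Q_C(S')$, $[X_2,X_6]=P_C(2/w)$. In all cases $[X_1,X_5]=X_4$ and $[X_1,X_6]=2X_5$, and all commutators between generators that are not listed, and do not follow from the listed ones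 by antisymmetry, are zero. -/

import Mathlib

open scoped ContDiff

namespace BRZR

noncomputable section

/-! Independent variables: `x, y, t` are numbered `0, 1, 2`.
Dependent variables: `u, v, φ` are numbered `0, 1, 2`, where `ψ = u + i v`. -/

/-- The space of independent and dependent variables `((x, y, t), (u, v, φ))`. -/
abbrev Jet0 := (Fin 3 → ℝ) × (Fin 3 → ℝ)

/-- First order jets; `z.2 α i` is the coordinate `∂ᵢ u^α`. -/
abbrev Jet1 := Jet0 × (Fin 3 → Fin 3 → ℝ)

/-- Second order jets; `z.2 α i j` is the coordinate `∂ⱼ ∂ᵢ u^α`. Genuine jets are those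
satisfying `IsSymm`. -/
abbrev Jet2 := Jet1 × (Fin 3 → Fin 3 → Fin 3 → ℝ)

/-- Equality of mixed second derivatives. -/
def IsSymm (z : Jet2) : Prop := ∀ α i j, z.2 α i j = z.2 α j i

/-- Total derivative `Dᵢ f = ∂f/∂xᵢ + ∑ u^α_i ∂f/∂u^α` of a function on `Jet0`. -/
def D0 (i : Fin 3) (f : Jet0 → ℝ) (z : Jet1) : ℝ :=
  fderiv ℝ f z.1 (Pi.single i 1, fun α => z.2 α i)

/-- Total derivative
`Dᵢ g = ∂g/∂xᵢ + ∑ u^α_i ∂g/∂u^α + ∑ u^α_{ki} ∂g/∂u^α_k` of a function on `Jet1`. -/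
def D1 (i : Fin 3) (g : Jet1 → ℝ) (z : Jet2) : ℝ :=
  fderiv ℝ g z.1 ((Pi.single i 1, fun α => z.1.2 α i), fun α k => z.2 α k i)

/-- The coefficient of `∂/∂u^α_i` in the prolongation of the vector field
`V = ∑ ξ^k ∂_{x_k} + ∑ η^α ∂_{u^α}`: it is `Dᵢ η^α - ∑ u^α_k Dᵢ ξ^k`. -/
def pr1 (V : Jet0 → Jet0) (α i : Fin 3) (z : Jet1) : ℝ :=
  D0 i (fun q => (V q).2 α) z - ∑ k, z.2 α k * D0 i (fun q => (V q).1 k) z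

/-- The coefficient of `∂/∂u^α_{ij}` in the second prolongation of `V`: it is
`Dⱼ η^α_i - ∑ u^α_{ik} Dⱼ ξ^k`, where `η^α_i` is the coefficient of `∂/∂u^α_i`. -/
def pr2 (V : Jet0 → Jet0) (α i j : Fin 3) (z : Jet2) : ℝ :=
  D1 j (pr1 V α i) z - ∑ k, z.2 α i k * D0 j (fun q => (V q).1 k) z.1

/-- The second prolongation of `V`, a vector field on the second order jets. -/
def prolong (V : Jet0 → Jet0) (z : Jet2) : Jet2 :=
  ((V z.1.1, fun α i => pr1 V α i z.1), fun α i j => pr2 V α i j z)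

/-- The real constants of the system. -/
structure Params where
  a : ℝ
  b : ℝ
  c : ℝ
  ε₀ : ℝ
  d : ℝ
  m : ℝ
  w : ℝ

/-- `ψ = u + i v`. -/
def psi (q : Jet0) : ℂ := ⟨q.2 0, q.2 1⟩

/-- `∂ᵢ ψ`. -/
def psi1 (i : Fin 3) (z : Jet2) : ℂ := ⟨z.1.2 0 i, z.1.2 1 i⟩

/-- `∂ⱼ ∂ᵢ ψ`. -/
def psi2 (i j : Fin 3) (z : Jet2) : ℂ := ⟨z.2 0 i j, z.2 1 i j⟩

/-- `m ∂_t + (m c - d) ∂_y`, applied to a function with gradient `g`. -/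
def dirDeriv (p : Params) (g : Fin 3 → ℝ) : ℝ := p.m * g 2 + (p.m * p.c - p.d) * g 1

/-- Left minus right hand side of
`i ψ_t + a ψ_xx + ε₀ ψ_yy = (b - w m) |ψ|² ψ - w ψ {m ∂_t + (m c - d) ∂_y} φ`. -/
def eqA (p : Params) (z : Jet2) : ℂ :=
  (Complex.I * psi1 2 z + p.a * psi2 0 0 z + p.ε₀ * psi2 1 1 z)
    - ((p.b - p.w * p.m : ℝ) * (Complex.normSq (psi z.1.1) : ℝ) * psi z.1.1
      - p.w * psi z.1.1 * (dirDeriv p (fun i => z.1.2 2 i) : ℝ))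

/-- Left minus right hand side of
`φ_xx + (1 - m c²) φ_yy - m φ_tt - 2 m c φ_yt = {m ∂_t + (m c - d) ∂_y} |ψ|²`. -/
def eqB (p : Params) (z : Jet2) : ℝ :=
  (z.2 2 0 0 + (1 - p.m * p.c ^ 2) * z.2 2 1 1 - p.m * z.2 2 2 2
      - 2 * p.m * p.c * z.2 2 1 2)
    - dirDeriv p (fun i => D0 i (fun q => Complex.normSq (psi q)) z.1)

/-- `V` is an infinitesimal Lie point symmetry of the system: it is a smooth vector field on the
space of independent and dependent variables whose second prolongation annihilates both equations
at all second order jets that satisfy them. -/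
def IsLieSymmetry (p : Params) (V : Jet0 → Jet0) : Prop :=
  ContDiff ℝ ∞ V ∧ ∀ z : Jet2, IsSymm z → eqA p z = 0 → eqB p z = 0 →
    fderiv ℝ (eqA p) z (prolong V z) = 0 ∧ fderiv ℝ (eqB p) z (prolong V z) = 0

theorem D0_add (i : Fin 3) {f g : Jet0 → ℝ} (hf : Differentiable ℝ f) (hg : Differentiable ℝ g)
    (z : Jet1) : D0 i (fun q => f q + g q) z = D0 i f z + D0 i g z := by
  unfold D0
  rw [fderiv_fun_add (hf _) (hg _)]
  rfl

theorem D0_const_mul (i : Fin 3) {f : Jet0 → ℝ} (hf : Differentiable ℝ f) (r : ℝ)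
    (z : Jet1) : D0 i (fun q => r * f q) z = r * D0 i f z := by
  unfold D0
  rw [fderiv_const_mul (hf _)]
  rfl

theorem contDiff_D0 (i : Fin 3) {f : Jet0 → ℝ} (hf : ContDiff ℝ ∞ f) :
    ContDiff ℝ ∞ (D0 i f) := by
  unfold D0
  have h1 : ContDiff ℝ ∞ (fun z : Jet1 => fderiv ℝ f z.1) :=
    (hf.fderiv_right (m := ∞) (by simp)).comp contDiff_fst
  refine h1.clm_apply (contDiff_const.prodMk ?_)
  fun_prop

theorem contDiff_pr1 {V : Jet0 → Jet0} (hV : ContDiff ℝ ∞ V) (α i : Fin 3) :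
    ContDiff ℝ ∞ (pr1 V α i) := by
  unfold pr1
  refine (contDiff_D0 i (by fun_prop)).sub (ContDiff.sum fun k _ => ?_)
  refine ContDiff.mul (by fun_prop) (contDiff_D0 i (by fun_prop))

theorem prolong_add {V W : Jet0 → Jet0} (hV : ContDiff ℝ ∞ V) (hW : ContDiff ℝ ∞ W)
    (z : Jet2) : prolong (V + W) z = prolong V z + prolong W z := by
  have dV := hV.differentiable (by simp)
  have dW := hW.differentiable (by simp)
  have h1 : ∀ i k z, D0 i (fun q => ((V + W) q).1 k) z
      = D0 i (fun q => (V q).1 k) z + D0 i (fun q => (W q).1 k) z := fun i k z =>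
    D0_add i (f := fun q => (V q).1 k) (g := fun q => (W q).1 k)
      (by fun_prop) (by fun_prop) z
  have h2 : ∀ i k z, D0 i (fun q => ((V + W) q).2 k) z
      = D0 i (fun q => (V q).2 k) z + D0 i (fun q => (W q).2 k) z := fun i k z =>
    D0_add i (f := fun q => (V q).2 k) (g := fun q => (W q).2 k)
      (by fun_prop) (by fun_prop) z
  have h3 : ∀ α i, pr1 (V + W) α i = fun z => pr1 V α i z + pr1 W α i z := by
    intro α i
    funext z
    simp only [pr1, h1, h2, mul_add, Finset.sum_add_distrib]
    ring
  have h4 : ∀ α i j, pr2 (V + W) α i j z = pr2 V α i j z + pr2 W α i j z := by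
    intro α i j
    simp only [pr2, h1, h3, D1, mul_add, Finset.sum_add_distrib]
    rw [fderiv_fun_add ((contDiff_pr1 hV α i).differentiable (by simp) _)
      ((contDiff_pr1 hW α i).differentiable (by simp) _)]
    simp only [add_apply]
    ring
  refine Prod.ext (Prod.ext rfl ?_) ?_
  · funext α i
    exact congrFun (h3 α i) z.1
  · funext α i j
    exact h4 α i j

theorem prolong_smul {V : Jet0 → Jet0} (hV : ContDiff ℝ ∞ V) (r : ℝ)
    (z : Jet2) : prolong (r • V) z = r • prolong V z := by
  have dV := hV.differentiable (by simp)
  have h1 : ∀ i k z, D0 i (fun q => ((r • V) q).1 k) z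
      = r * D0 i (fun q => (V q).1 k) z := fun i k z =>
    D0_const_mul i (f := fun q => (V q).1 k) (by fun_prop) r z
  have h2 : ∀ i k z, D0 i (fun q => ((r • V) q).2 k) z
      = r * D0 i (fun q => (V q).2 k) z := fun i k z =>
    D0_const_mul i (f := fun q => (V q).2 k) (by fun_prop) r z
  have h3 : ∀ α i, pr1 (r • V) α i = fun z => r * pr1 V α i z := by
    intro α i
    funext z
    simp only [pr1, h1, h2, mul_sub, Finset.mul_sum]
    congr 1
    exact Finset.sum_congr rfl fun k _ => by ring
  have h4 : ∀ α i j, pr2 (r • V) α i j z = r * pr2 V α i j z := by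
    intro α i j
    simp only [pr2, h1, h3, D1, mul_sub, Finset.mul_sum]
    rw [fderiv_const_mul ((contDiff_pr1 hV α i).differentiable (by simp) _)]
    congr 1
    exact Finset.sum_congr rfl fun k _ => by ring
  refine Prod.ext (Prod.ext rfl ?_) ?_
  · funext α i
    exact congrFun (h3 α i) z.1
  · funext α i j
    exact h4 α i j

/-- The real vector space of infinitesimal Lie point symmetries of the system. -/
def symmetryAlgebra (p : Params) : Submodule ℝ (Jet0 → Jet0) where
  carrier := {V | IsLieSymmetry p V}
  zero_mem' := by
    refine ⟨contDiff_const, fun z _ _ _ => ?_⟩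
    have h : prolong (0 : Jet0 → Jet0) z = 0 := by
      have := prolong_smul (V := 0) contDiff_const 0 z
      simpa using this
    simp [h]
  add_mem' := by
    rintro V W ⟨hV, hV'⟩ ⟨hW, hW'⟩
    refine ⟨hV.add hW, fun z hz hA hB => ?_⟩
    simp [prolong_add hV hW, hV' z hz hA hB, hW' z hz hA hB]
  smul_mem' := by
    rintro r V ⟨hV, hV'⟩
    refine ⟨contDiff_const.smul hV, fun z hz hA hB => ?_⟩
    simp [prolong_smul hV, hV' z hz hA hB]

/-- The vector field `h ∂_φ`. -/
def vert (h : Jet0 → ℝ) (q : Jet0) : Jet0 := (0, ![0, 0, h q])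

/-- The vector field `χ(t) (-v ∂_u + u ∂_v)`. -/
def rot (χ : ℝ → ℝ) (q : Jet0) : Jet0 := (0, ![-(χ (q.1 2) * q.2 1), χ (q.1 2) * q.2 0, 0])

/-- `∂_t`. -/
def X₁ : Jet0 → Jet0 := fun _ => (Pi.single 2 1, 0)

/-- `∂_x`. -/
def X₂ : Jet0 → Jet0 := fun _ => (Pi.single 0 1, 0)

/-- `∂_y`. -/
def X₃ : Jet0 → Jet0 := fun _ => (Pi.single 1 1, 0)

/-- `-v ∂_u + u ∂_v + 1/(m w) ∂_φ`. -/
def X₄ (p : Params) : Jet0 → Jet0 :=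
  rot (fun _ => 1) + vert (fun _ => 1 / (p.m * p.w))

/-- `t (-v ∂_u + u ∂_v) + t/(m w) ∂_φ`. -/
def X₅ (p : Params) : Jet0 → Jet0 :=
  rot (fun t => t) + vert (fun q => q.1 2 / (p.m * p.w))

/-- `t² (-v ∂_u + u ∂_v) + (t²/(m w) + x²/w) ∂_φ`. -/
def X₆ (p : Params) : Jet0 → Jet0 :=
  rot (fun t => t ^ 2) + vert (fun q => q.1 2 ^ 2 / (p.m * p.w) + q.1 0 ^ 2 / p.w)

/-- The six generators `X₁, …, X₆`, numbered from `0` to `5`. -/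
def X (p : Params) : Fin 6 → Jet0 → Jet0 := ![X₁, X₂, X₃, X₄ p, X₅ p, X₆ p]

/-- `F(√(m (d² - m)) x - m y + (m c - d) t) ∂_φ`. -/
def PA (p : Params) (F : ℝ → ℝ) : Jet0 → Jet0 := vert fun q =>
  F (√(p.m * (p.d ^ 2 - p.m)) * q.1 0 - p.m * q.1 1 + (p.m * p.c - p.d) * q.1 2)

/-- `G(√(m (d² - m)) x + m y - (m c - d) t) ∂_φ`. -/
def QA (p : Params) (G : ℝ → ℝ) : Jet0 → Jet0 := vert fun q =>
  G (√(p.m * (p.d ^ 2 - p.m)) * q.1 0 + p.m * q.1 1 - (p.m * p.c - p.d) * q.1 2)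

/-- `H(x, σ) ∂_φ` with `σ = (m y - (m c - d) t) / √(m (m - d²))`; the plane of the variables
`(x, σ)` is identified with `ℂ`. -/
def PB (p : Params) (H : ℂ → ℝ) : Jet0 → Jet0 := vert fun q =>
  H ⟨q.1 0, (p.m * q.1 1 - (p.m * p.c - p.d) * q.1 2) / √(p.m * (p.m - p.d ^ 2))⟩

/-- `H` is a harmonic function on the whole plane. -/
def IsHarmonic (H : ℂ → ℝ) : Prop := InnerProductSpace.HarmonicOnNhd H Set.univ

/-- The partial derivative `H_x`. -/
def derivX (H : ℂ → ℝ) (z : ℂ) : ℝ := deriv (fun s : ℝ => H ⟨s, z.im⟩) z.re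

/-- The partial derivative `H_σ`. -/
def derivσ (H : ℂ → ℝ) (z : ℂ) : ℝ := deriv (fun s : ℝ => H ⟨z.re, s⟩) z.im

/-- `x R(d y - (c d - 1) t) ∂_φ`. -/
def PC (p : Params) (R : ℝ → ℝ) : Jet0 → Jet0 := vert fun q =>
  q.1 0 * R (p.d * q.1 1 - (p.c * p.d - 1) * q.1 2)

/-- `S(d y - (c d - 1) t) ∂_φ`. -/
def QC (p : Params) (S : ℝ → ℝ) : Jet0 → Jet0 := vert fun q =>
  S (p.d * q.1 1 - (p.c * p.d - 1) * q.1 2)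

end

end BRZR

/-
On the solution manifold all first derivatives are free, and so are the second derivatives up to the
two equations. In the invariance condition, the terms linear in the free second derivatives force
the base components of a symmetry to depend on `(x, y, t)` only and to preserve both principal
symbols up to a factor; the coefficients of `ψ_t`, `φ_x`, `φ_t` and `ψ_x` then make the base
components constant and the fibre components equal to `i θ(t) ψ` and `h(x, y, t)`. What is left is
`θ' = w (m ∂_t + (m c - d) ∂_y) h` together with the wave equation for `h`. Since `h - θ / (m w)` is
constant along the transport direction, the wave equation makes `θ''` constant: `θ` is a quadratic
polynomial, which accounts for `X₄`, `X₅`, `X₆`, and the rest of `h` is a function `K(x, ζ)` with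
`K_xx + m (m - d²) K_ζζ = 0`. The sign of `m - d²` decides the type of this equation: d'Alembert's
formula solves it for `m < d²`, it is Laplace's equation up to scaling for `m > d²`, and it is
`K_xx = 0` for `m = d²`.
-/

namespace BRZR

open VectorField

noncomputable section

section Calculus

variable {E F G : Type*} [NormedAddCommGroup E] [NormedSpace ℝ E] [NormedAddCommGroup F]
  [NormedSpace ℝ F] [NormedAddCommGroup G] [NormedSpace ℝ G]

/-- The second derivative of `f` as a bilinear map: `hess f q v w` is the derivative in the
direction `v` of the derivative of `f` in the direction `w`. -/
abbrev hess (f : E → F) (q : E) : E →L[ℝ] E →L[ℝ] F := fderiv ℝ (fderiv ℝ f) q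

theorem contDiff_two_of_contDiff_infty {f : E → F} (hf : ContDiff ℝ ∞ f) : ContDiff ℝ 2 f :=
  hf.of_le (WithTop.coe_le_coe.2 le_top)

theorem differentiable_fderiv {f : E → F} (hf : ContDiff ℝ 2 f) : Differentiable ℝ (fderiv ℝ f) :=
  (hf.fderiv_right (m := 1) (by norm_num)).differentiable one_ne_zero

theorem hess_comm {f : E → F} (hf : ContDiff ℝ 2 f) (q v w : E) :
    hess f q v w = hess f q w v :=
  (hf.contDiffAt.isSymmSndFDerivAt (by simp)).eq v w

theorem fderiv_fderiv_apply {f : E → F} (hf : ContDiff ℝ 2 f) (q v w : E) :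
    fderiv ℝ (fun q => fderiv ℝ f q w) q v = hess f q v w := by
  simp [fderiv_clm_apply (differentiable_fderiv hf q) (differentiableAt_const w)]

theorem hess_eq_zero_of_fderiv_apply_eq_zero {f : E → F} (hf : ContDiff ℝ 2 f) {w : E}
    (h : ∀ q, fderiv ℝ f q w = 0) (q v : E) : hess f q v w = 0 := by
  simp [← fderiv_fderiv_apply hf, h]

theorem hess_add {f g : E → F} (hf : ContDiff ℝ 2 f) (hg : ContDiff ℝ 2 g) (q : E) :
    hess (f + g) q = hess f q + hess g q := by
  have h : fderiv ℝ (f + g) = fderiv ℝ f + fderiv ℝ g := funext fun x =>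
    fderiv_add (hf.differentiable two_ne_zero x) (hg.differentiable two_ne_zero x)
  rw [hess, h, fderiv_add (differentiable_fderiv hf q) (differentiable_fderiv hg q)]

theorem fderiv_comp_clm {g : F → G} (hg : Differentiable ℝ g) (L : E →L[ℝ] F) (x : E) :
    fderiv ℝ (fun x => g (L x)) x = fderiv ℝ g (L x) ∘L L :=
  ((hg (L x)).hasFDerivAt.comp x L.hasFDerivAt).fderiv

theorem fderiv_clm_comp {f : E → F} (hf : Differentiable ℝ f) (L : F →L[ℝ] G) (x : E) :
    fderiv ℝ (fun x => L (f x)) x = L ∘L fderiv ℝ f x :=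
  (L.hasFDerivAt.comp x (hf x).hasFDerivAt).fderiv

theorem hess_comp_clm {g : F → G} (hg : ContDiff ℝ 2 g) (L : E →L[ℝ] F) (x v w : E) :
    hess (fun x => g (L x)) x v w = hess g (L x) (L v) (L w) := by
  have hgL : ContDiff ℝ 2 (fun x => g (L x)) := hg.comp L.contDiff
  have h : (fun x => fderiv ℝ (fun x => g (L x)) x w) = fun x => fderiv ℝ g (L x) (L w) :=
    funext fun x => by rw [fderiv_comp_clm (hg.differentiable two_ne_zero)]; rfl
  rw [← fderiv_fderiv_apply hgL, h, fderiv_comp_clm (g := fun y => fderiv ℝ g y (L w))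
    ((differentiable_fderiv hg).clm_apply (differentiable_const _)),
    ContinuousLinearMap.comp_apply, fderiv_fderiv_apply hg]

theorem hess_clm_comp {f : E → F} (hf : ContDiff ℝ 2 f) (L : F →L[ℝ] G) (x v w : E) :
    hess (fun x => L (f x)) x v w = L (hess f x v w) := by
  have hLf : ContDiff ℝ 2 (fun x => L (f x)) := L.contDiff.comp hf
  have h : (fun x => fderiv ℝ (fun x => L (f x)) x w) = fun x => L (fderiv ℝ f x w) :=
    funext fun x => by rw [fderiv_clm_comp (hf.differentiable two_ne_zero)]; rfl
  rw [← fderiv_fderiv_apply hLf, h, fderiv_clm_comp (f := fun y => fderiv ℝ f y w)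
    ((differentiable_fderiv hf).clm_apply (differentiable_const _)),
    ContinuousLinearMap.comp_apply, fderiv_fderiv_apply hf]

theorem clm_hess_eq_zero_of_clm_fderiv_eq_zero {f : E → F} (hf : ContDiff ℝ 2 f) (L : F →L[ℝ] G)
    {w : E} (h : ∀ q, L (fderiv ℝ f q w) = 0) (q v : E) : L (hess f q v w) = 0 := by
  rw [← hess_clm_comp hf]
  refine hess_eq_zero_of_fderiv_apply_eq_zero (f := fun q => L (f q)) (L.contDiff.comp hf)
    (fun q => ?_) q v
  rw [fderiv_clm_comp (hf.differentiable two_ne_zero)]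
  exact h q

theorem hasDerivAt_comp_add_smul {f : E → F} (hf : Differentiable ℝ f) (q v : E) (s : ℝ) :
    HasDerivAt (fun s : ℝ => f (q + s • v)) (fderiv ℝ f (q + s • v) v) s := by
  have hl : HasDerivAt (fun s : ℝ => q + s • v) v s := by
    simpa using ((hasDerivAt_id s).smul_const v).const_add q
  exact (hf (q + s • v)).hasFDerivAt.comp_hasDerivAt s hl

theorem apply_add_of_fderiv_eq_zero {f : E → F} (hf : Differentiable ℝ f) {w : E}
    (h : ∀ q, fderiv ℝ f q w = 0) (q : E) : f (q + w) = f q := by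
  have hd (s : ℝ) : HasDerivAt (fun s : ℝ => f (q + s • w)) 0 s := by
    simpa only [h] using hasDerivAt_comp_add_smul hf q w s
  simpa using is_const_of_deriv_eq_zero (fun s => (hd s).differentiableAt) (fun s => (hd s).deriv)
    1 0

theorem clm_fderiv_apply_add_of_hess_eq_zero {f : E → F} (hf : ContDiff ℝ 2 f) (L : F →L[ℝ] G)
    {v w : E} (h : ∀ q, L (hess f q v w) = 0) (q : E) :
    L (fderiv ℝ f (q + v) w) = L (fderiv ℝ f q w) := by
  have hd : Differentiable ℝ fun q => fderiv ℝ f q w :=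
    (differentiable_fderiv hf).clm_apply (differentiable_const w)
  refine apply_add_of_fderiv_eq_zero (f := fun q => L (fderiv ℝ f q w))
    (L.differentiable.comp hd) (fun q => ?_) q
  rw [fderiv_clm_comp hd, ContinuousLinearMap.comp_apply, fderiv_fderiv_apply hf, h]

theorem fderiv_apply_of_cubic {f : E → F} (hf : Differentiable ℝ f) {z v : E} {c k l : F}
    (h : ∀ s : ℝ, f (z + s • v) = f z + s • c + s ^ 2 • k + s ^ 3 • l) : fderiv ℝ f z v = c := by
  have hpoly : HasDerivAt (fun s : ℝ => f z + s • c + s ^ 2 • k + s ^ 3 • l) c 0 := by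
    have h1 := ((hasDerivAt_id (0 : ℝ)).smul_const c).const_add (f z)
    have h2 := (hasDerivAt_pow 2 (0 : ℝ)).smul_const k
    have h3 := (hasDerivAt_pow 3 (0 : ℝ)).smul_const l
    simpa using (h1.fun_add h2).fun_add h3
  rw [← (hf z).lineDeriv_eq_fderiv, lineDeriv, funext h, hpoly.deriv]

theorem fderiv_comp_functional {g : ℝ → ℝ} (hg : Differentiable ℝ g) (L : E →L[ℝ] ℝ) (x v : E) :
    fderiv ℝ (fun x => g (L x)) x v = deriv g (L x) * L v := by
  rw [fderiv_comp_clm hg, ContinuousLinearMap.comp_apply, fderiv_eq_smul_deriv, smul_eq_mul,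
    mul_comm]

theorem differentiable_deriv {g : ℝ → ℝ} (hg : ContDiff ℝ 2 g) : Differentiable ℝ (deriv g) :=
  ((contDiff_succ_iff_deriv (n := 1)).1 hg).2.2.differentiable one_ne_zero

theorem hess_comp_functional {g : ℝ → ℝ} (hg : ContDiff ℝ 2 g) (L : E →L[ℝ] ℝ) (x v w : E) :
    hess (fun x => g (L x)) x v w = deriv (deriv g) (L x) * L v * L w := by
  have hg' : (fun x => fderiv ℝ (fun x => g (L x)) x w) = fun x => deriv g (L x) * L w :=
    funext fun x => fderiv_comp_functional (hg.differentiable two_ne_zero) L x w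
  rw [← fderiv_fderiv_apply (f := fun x => g (L x)) (hg.comp L.contDiff), hg', fderiv_mul_const
    (c := fun x => deriv g (L x)) ((differentiable_deriv hg).comp L.differentiable x), smul_apply,
    fderiv_comp_functional (differentiable_deriv hg), smul_eq_mul, mul_comm]

theorem hess_add_of_fderiv_eq_zero {f : E → ℝ} (hf : Differentiable ℝ f) {l : E}
    (h : ∀ x, fderiv ℝ f x l = 0) (x : E) : hess f (x + l) = hess f x := by
  have hshift : (fun x => f (x + l)) = f := funext (apply_add_of_fderiv_eq_zero hf h)
  have hshift' : (fun x => fderiv ℝ f (x + l)) = fderiv ℝ f := funext fun x => by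
    rw [← fderiv_comp_add_right, hshift]
  rw [hess, ← fderiv_comp_add_right, hshift']

theorem eq_add_sub_of_deriv_eq {f g : ℝ → ℝ} (hf : Differentiable ℝ f) (hg : Differentiable ℝ g)
    (h : deriv f = deriv g) (t : ℝ) : f t = f 0 + (g t - g 0) := by
  have hconst := is_const_of_deriv_eq_zero (hf.sub hg)
    (fun x => by rw [deriv_sub (hf x) (hg x), h, sub_self]) t 0
  simp only [Pi.sub_apply] at hconst
  linarith

theorem deriv_quadratic (r₀ r₁ r₂ t : ℝ) :
    deriv (fun t => r₀ + r₁ * t + r₂ * t ^ 2) t = r₁ + 2 * r₂ * t := by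
  have h := (((hasDerivAt_id' t).const_mul r₁).const_add r₀).fun_add
    ((hasDerivAt_pow 2 t).const_mul r₂)
  rw [h.deriv]
  simp only [mul_one, Nat.cast_ofNat, Nat.add_one_sub_one, pow_one, add_right_inj]
  ring

theorem eq_quadratic_of_deriv_deriv_eq {f : ℝ → ℝ} (hf : ContDiff ℝ 2 f) {r : ℝ}
    (h : ∀ t, deriv (deriv f) t = r) (t : ℝ) :
    f t = f 0 + deriv f 0 * t + r / 2 * t ^ 2 := by
  have hf' (t : ℝ) : deriv f t = deriv f 0 + r * t := by
    simpa using eq_add_sub_of_deriv_eq (differentiable_deriv hf) (g := fun t => r * t)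
      (by fun_prop) (by ext t; simp [h]) t
  refine (eq_add_sub_of_deriv_eq (hf.differentiable two_ne_zero)
    (g := fun t => f 0 + deriv f 0 * t + r / 2 * t ^ 2) (by fun_prop) ?_ t).trans (by ring)
  ext t
  rw [deriv_quadratic, hf']
  ring

theorem apply_add_of_hess_eq_zero {f : E → ℝ} (hf : ContDiff ℝ 2 f) {v w : E}
    (h : ∀ x, hess f x v w = 0) :
    f (v + w) = f v + f w - f 0 := by
  have hd := hf.differentiable two_ne_zero
  have hshift : Differentiable ℝ fun x => f (x + v) := hd.comp (differentiable_id.add_const v)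
  have hconst := apply_add_of_fderiv_eq_zero (w := w) (hshift.sub hd) (fun x => ?_) 0
  · simp only [Pi.sub_apply, zero_add, add_comm w v] at hconst
    linarith
  · rw [fderiv_sub (hshift x) (hd x), fderiv_comp_add_right, sub_apply, sub_eq_zero]
    exact clm_fderiv_apply_add_of_hess_eq_zero hf (.id ℝ ℝ) h x

theorem apply_add_smul_of_hess_eq_zero {f : E → ℝ} (hf : ContDiff ℝ 2 f) {v : E}
    (h : ∀ x, hess f x v v = 0) (x : E) (s : ℝ) :
    f (x + s • v) = f x + s * fderiv ℝ f x v := by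
  have hderiv : deriv (fun s : ℝ => f (x + s • v)) = fun s => fderiv ℝ f (x + s • v) v :=
    funext fun s => (hasDerivAt_comp_add_smul (hf.differentiable two_ne_zero) x v s).deriv
  have hderiv₂ (s : ℝ) : deriv (deriv fun s : ℝ => f (x + s • v)) s = 0 := by
    rw [hderiv, (hasDerivAt_comp_add_smul (f := fun y => fderiv ℝ f y v)
      ((differentiable_fderiv hf).clm_apply (differentiable_const v)) x v s).deriv,
      fderiv_fderiv_apply hf, h]
  have := eq_quadratic_of_deriv_deriv_eq (f := fun s : ℝ => f (x + s • v)) (by fun_prop) hderiv₂ s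
  simpa [hderiv, mul_comm] using this

theorem fderiv_aeval (P : Polynomial ℝ) (z v : ℂ) :
    fderiv ℝ (fun z : ℂ => Polynomial.aeval z P) z v
      = Polynomial.aeval z (Polynomial.derivative P) * v := by
  rw [(P.hasDerivAt_aeval z).complexToReal_fderiv.fderiv]
  simp

theorem contDiff_aeval (P : Polynomial ℝ) : ContDiff ℝ ∞ fun z : ℂ => Polynomial.aeval z P :=
  (P.contDiff_aeval (𝕜 := ℂ) ∞).restrict_scalars ℝ

theorem hess_aeval (P : Polynomial ℝ) (z v w : ℂ) :
    hess (fun z : ℂ => Polynomial.aeval z P) z v w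
      = Polynomial.aeval z (Polynomial.derivative (Polynomial.derivative P)) * v * w := by
  rw [← fderiv_fderiv_apply (contDiff_two_of_contDiff_infty (contDiff_aeval P))]
  simp only [fderiv_aeval]
  rw [fderiv_mul_const ((contDiff_aeval _).differentiable (by simp) z), smul_apply, fderiv_aeval,
    smul_eq_mul]
  ring

end Calculus

/-- The values of the dependent variables, given as `(ψ, φ)` instead of `(u, v, φ)`. -/
def depEquiv : (ℂ × ℝ) ≃L[ℝ] (Fin 3 → ℝ) :=
  LinearEquiv.toContinuousLinearEquiv
    { toFun := fun r => ![r.1.re, r.1.im, r.2]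
      invFun := fun r => (⟨r 0, r 1⟩, r 2)
      left_inv := fun _ => rfl
      right_inv := fun r => by ext i; fin_cases i <;> rfl
      map_add' := fun r s => by ext i; fin_cases i <;> rfl
      map_smul' := fun r s => by ext i; fin_cases i <;> simp }

theorem depEquiv_apply (r : ℂ × ℝ) : depEquiv r = ![r.1.re, r.1.im, r.2] := rfl

/-- The coordinate vector fields `∂_x, ∂_y, ∂_t`. -/
def horizontal (i : Fin 3) : Jet0 := (Pi.single i 1, 0)

/-- The vertical vectors, i.e. those along the dependent variables `(ψ, φ)`. -/
def vertical : ℂ × ℝ →L[ℝ] Jet0 :=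
  ContinuousLinearMap.inr ℝ (Fin 3 → ℝ) (Fin 3 → ℝ) ∘L depEquiv

theorem vertical_apply (r : ℂ × ℝ) : vertical r = (0, depEquiv r) := rfl

theorem vertical_mk (z : ℂ) (g : ℝ) : vertical (z, g) = vertical (z, 0) + vertical (0, g) := by
  simp [← map_add]

theorem eq_horizontal_add_vertical (v : Jet0) : v = v.1 0 • horizontal 0 + v.1 1 • horizontal 1
    + v.1 2 • horizontal 2 + vertical (depEquiv.symm v.2) := by
  refine Prod.ext (funext fun k => ?_) (by simp [horizontal, vertical_apply])
  fin_cases k <;> simp [horizontal, vertical_apply]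

/-- The value of `∂/∂xᵢ + ∑ u^α_i ∂/∂u^α` at a point where the first derivatives of the dependent
variables `(ψ, φ)` are `r`. -/
def totalDir (r : Fin 3 → ℂ × ℝ) (i : Fin 3) : Jet0 := horizontal i + vertical (r i)

/-- The second order jet at `q` with first derivatives `r` and second derivatives `s` of the
dependent variables `(ψ, φ)`. -/
def jet (q : Jet0) (r : Fin 3 → ℂ × ℝ) (s : Fin 3 → Fin 3 → ℂ × ℝ) : Jet2 :=
  ((q, fun α i => depEquiv (r i) α), fun α i j => depEquiv (s i j) α)

theorem exists_eq_jet (z : Jet2) : ∃ q r s, z = jet q r s :=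
  ⟨z.1.1, fun i => depEquiv.symm fun α => z.1.2 α i,
    fun i j => depEquiv.symm fun α => z.2 α i j, by
      simp only [jet, ContinuousLinearEquiv.apply_symm_apply]⟩

theorem isSymm_jet {q : Jet0} {r : Fin 3 → ℂ × ℝ} {s : Fin 3 → Fin 3 → ℂ × ℝ} :
    IsSymm (jet q r s) ↔ ∀ i j, s i j = s j i := by
  refine ⟨fun h i j => depEquiv.injective (funext fun α => h α i j), fun h α i j => ?_⟩
  simp only [jet, h i j]

/-- The components of a vector field along the independent variables. -/
def ξ (V : Jet0 → Jet0) (q : Jet0) : Fin 3 → ℝ := (V q).1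

/-- The components of a vector field along the dependent variables `(ψ, φ)`. -/
def η (V : Jet0 → Jet0) (q : Jet0) : ℂ × ℝ := depEquiv.symm (V q).2

theorem contDiff_ξ {V : Jet0 → Jet0} (hV : ContDiff ℝ ∞ V) : ContDiff ℝ ∞ (ξ V) := hV.fst

theorem contDiff_η {V : Jet0 → Jet0} (hV : ContDiff ℝ ∞ V) : ContDiff ℝ ∞ (η V) :=
  depEquiv.symm.contDiff.comp hV.snd

/-- The prolongation of `V` to the first derivatives of `(ψ, φ)`. -/
def prolong1 (V : Jet0 → Jet0) (q : Jet0) (r : Fin 3 → ℂ × ℝ) (i : Fin 3) : ℂ × ℝ :=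
  fderiv ℝ (η V) q (totalDir r i) - ∑ k, fderiv ℝ (ξ V) q (totalDir r i) k • r k

/-- The part of the prolongation of `V` to the second derivatives of `(ψ, φ)` that is linear in
the second derivatives `s`. -/
def prolong2Principal (V : Jet0 → Jet0) (q : Jet0) (r : Fin 3 → ℂ × ℝ)
    (s : Fin 3 → Fin 3 → ℂ × ℝ) (i j : Fin 3) : ℂ × ℝ :=
  fderiv ℝ (η V) q (vertical (s i j)) - ∑ k, fderiv ℝ (ξ V) q (vertical (s i j)) k • r k
    - ∑ k, fderiv ℝ (ξ V) q (totalDir r i) k • s k j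
    - ∑ k, fderiv ℝ (ξ V) q (totalDir r j) k • s i k

/-- The prolongation of `V` to the second derivatives of `(ψ, φ)`. -/
def prolong2 (V : Jet0 → Jet0) (q : Jet0) (r : Fin 3 → ℂ × ℝ) (s : Fin 3 → Fin 3 → ℂ × ℝ)
    (i j : Fin 3) : ℂ × ℝ :=
  hess (η V) q (totalDir r j) (totalDir r i)
    - ∑ k, hess (ξ V) q (totalDir r j) (totalDir r i) k • r k + prolong2Principal V q r s i j

theorem prolong2_add (V : Jet0 → Jet0) (q : Jet0) (r : Fin 3 → ℂ × ℝ)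
    (s δ : Fin 3 → Fin 3 → ℂ × ℝ) (i j : Fin 3) :
    prolong2 V q r (s + δ) i j = prolong2 V q r s i j + prolong2Principal V q r δ i j := by
  simp only [prolong2, prolong2Principal, Pi.add_apply, map_add, add_smul, smul_add,
    Finset.sum_add_distrib]
  abel

theorem D0_jet (f : Jet0 → ℝ) (q : Jet0) (r : Fin 3 → ℂ × ℝ) (s : Fin 3 → Fin 3 → ℂ × ℝ)
    (i : Fin 3) : D0 i f (jet q r s).1 = fderiv ℝ f q (totalDir r i) := by
  simp [D0, jet, totalDir, horizontal, vertical_apply]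

theorem D1_D0_jet {f : Jet0 → ℝ} (hf : ContDiff ℝ 2 f) (q : Jet0) (r : Fin 3 → ℂ × ℝ)
    (s : Fin 3 → Fin 3 → ℂ × ℝ) (i j : Fin 3) : D1 j (D0 i f) (jet q r s)
      = hess f q (totalDir r j) (totalDir r i) + fderiv ℝ f q (vertical (s i j)) := by
  let dir : Jet1 →L[ℝ] Fin 3 → ℝ := .pi fun α => .proj i ∘L .proj α ∘L .snd ℝ Jet0 _
  have key : HasFDerivAt (D0 i f) _ (jet q r s).1 :=
    ((differentiable_fderiv hf _).hasFDerivAt.comp _ hasFDerivAt_fst).clm_apply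
      ((hasFDerivAt_const (Pi.single i 1) _).prodMk dir.hasFDerivAt)
  rw [D1, key.fderiv, add_comm]
  simp [dir, jet, totalDir, horizontal, vertical_apply]

theorem apply_snd_eq_depEquiv_η (V : Jet0 → Jet0) (α : Fin 3) (q : Jet0) :
    (V q).2 α = ((.proj α : (Fin 3 → ℝ) →L[ℝ] ℝ) ∘L depEquiv) (η V q) := by
  simp [η]

section Prolongation

variable {V : Jet0 → Jet0} (hV : ContDiff ℝ ∞ V)

include hV

theorem fderiv_ξ_apply (k : Fin 3) (q v : Jet0) :
    fderiv ℝ (fun q => (V q).1 k) q v = fderiv ℝ (ξ V) q v k :=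
  DFunLike.congr_fun (fderiv_clm_comp ((contDiff_ξ hV).differentiable (by simp))
    (.proj k : (Fin 3 → ℝ) →L[ℝ] ℝ) q) v

theorem fderiv_η_apply (α : Fin 3) (q v : Jet0) :
    fderiv ℝ (fun q => (V q).2 α) q v = depEquiv (fderiv ℝ (η V) q v) α := by
  simp only [apply_snd_eq_depEquiv_η, fderiv_clm_comp ((contDiff_η hV).differentiable (by simp))]
  rfl

theorem hess_ξ_apply (k : Fin 3) (q v w : Jet0) :
    hess (fun q => (V q).1 k) q v w = hess (ξ V) q v w k :=
  hess_clm_comp (contDiff_two_of_contDiff_infty (contDiff_ξ hV))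
    (.proj k : (Fin 3 → ℝ) →L[ℝ] ℝ) q v w

theorem hess_η_apply (α : Fin 3) (q v w : Jet0) :
    hess (fun q => (V q).2 α) q v w = depEquiv (hess (η V) q v w) α := by
  simp only [apply_snd_eq_depEquiv_η]
  exact hess_clm_comp (contDiff_two_of_contDiff_infty (contDiff_η hV)) _ q v w

variable (q : Jet0) (r : Fin 3 → ℂ × ℝ) (s : Fin 3 → Fin 3 → ℂ × ℝ)

theorem pr1_jet (α i : Fin 3) :
    pr1 V α i (jet q r s).1 = depEquiv (prolong1 V q r i) α := by
  simp only [pr1, prolong1, D0_jet, fderiv_ξ_apply hV, fderiv_η_apply hV, map_sub, map_sum,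
    map_smul, Pi.sub_apply, Finset.sum_apply, Pi.smul_apply, smul_eq_mul]
  simp only [jet, mul_comm]

theorem D1_pr1 (α i j : Fin 3) (z : Jet2) :
    D1 j (pr1 V α i) z = D1 j (D0 i fun q => (V q).2 α) z
      - ∑ k, (z.2 α k j * D0 i (fun q => (V q).1 k) z.1
        + z.1.2 α k * D1 j (D0 i fun q => (V q).1 k) z) := by
  have hη : Differentiable ℝ (D0 i fun q => (V q).2 α) :=
    (contDiff_D0 i (by fun_prop)).differentiable (by simp)
  have hξ (k : Fin 3) : Differentiable ℝ (D0 i fun q => (V q).1 k) :=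
    (contDiff_D0 i (by fun_prop)).differentiable (by simp)
  let coord (k : Fin 3) : Jet1 →L[ℝ] ℝ := .proj k ∘L .proj α ∘L .snd ℝ Jet0 (Fin 3 → Fin 3 → ℝ)
  have key : HasFDerivAt (pr1 V α i) _ z.1 := (hη z.1).hasFDerivAt.sub
    (HasFDerivAt.fun_sum fun k _ => (coord k).hasFDerivAt.mul (hξ k z.1).hasFDerivAt)
  rw [D1, key.fderiv]
  simp [D1, coord, mul_comm, add_comm]

theorem pr2_jet (α i j : Fin 3) :
    pr2 V α i j (jet q r s) = depEquiv (prolong2 V q r s i j) α := by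
  have hξ (k : Fin 3) : ContDiff ℝ 2 fun q => (V q).1 k :=
    contDiff_two_of_contDiff_infty (by fun_prop)
  have hη : ContDiff ℝ 2 fun q => (V q).2 α := contDiff_two_of_contDiff_infty (by fun_prop)
  simp only [pr2, D1_pr1 hV, D1_D0_jet (hξ _), D1_D0_jet hη, D0_jet, hess_ξ_apply hV,
    hess_η_apply hV, fderiv_ξ_apply hV, fderiv_η_apply hV, prolong2, prolong2Principal, map_sub,
    map_add, map_sum, map_smul, Pi.sub_apply, Pi.add_apply, Finset.sum_apply, Pi.smul_apply,
    smul_eq_mul, Finset.sum_add_distrib]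
  simp only [jet, mul_comm, mul_add, Finset.sum_add_distrib]
  ring

theorem prolong_jet :
    prolong V (jet q r s) = jet (V q) (prolong1 V q r) (prolong2 V q r s) := by
  simp only [prolong, pr1_jet hV, pr2_jet hV]
  rfl

end Prolongation

section Linearization

open Complex ComplexConjugate

/-- `φ_xx + (1 - m c²) φ_yy - m φ_tt - 2 m c φ_yt` for a function `φ` with second derivatives
`f`. -/
def waveOp (p : Params) (f : Fin 3 → Fin 3 → ℝ) : ℝ :=
  f 0 0 + (1 - p.m * p.c ^ 2) * f 1 1 - p.m * f 2 2 - 2 * p.m * p.c * f 1 2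

/-- `a ψ_xx + ε₀ ψ_yy` for a function `ψ` with second derivatives `f`. -/
def schrodingerOp (p : Params) (f : Fin 3 → Fin 3 → ℂ) : ℂ := p.a * f 0 0 + p.ε₀ * f 1 1

/-- The right hand side `(b - w m) |ψ|² ψ - w ψ g` of the first equation, where `g` stands for
`{m ∂_t + (m c - d) ∂_y} φ`. -/
def nonlinearity (p : Params) (ψ : ℂ) (g : ℝ) : ℂ :=
  (p.b - p.w * p.m) * normSq ψ * ψ - p.w * ψ * g

/-- The derivative of `nonlinearity p` at `(ψ, g)` in the direction `(ψ', g')`. -/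
def nonlinearityDeriv (p : Params) (ψ : ℂ) (g : ℝ) (ψ' : ℂ) (g' : ℝ) : ℂ :=
  (p.b - p.w * p.m) * (2 * (ψ * conj ψ').re * ψ + normSq ψ * ψ') - p.w * ψ' * g - p.w * ψ * g'

variable (p : Params) (q q' : Jet0) (r r' : Fin 3 → ℂ × ℝ) (s s' : Fin 3 → Fin 3 → ℂ × ℝ)

theorem eqA_jet : eqA p (jet q r s) = I * (r 2).1 + schrodingerOp p (fun i j => (s i j).1)
    - nonlinearity p (psi q) (dirDeriv p fun i => (r i).2) := by
  simp [eqA, psi1, psi2, jet, schrodingerOp, nonlinearity, depEquiv_apply, ← add_assoc]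

omit p in
theorem psi_add_smul (τ : ℝ) : psi (q + τ • q') = psi q + τ * psi q' := by
  apply Complex.ext <;> simp [psi]

theorem contDiff_normSq_psi : ContDiff ℝ ∞ fun q => normSq (psi q) := by
  simp only [normSq_apply, psi]
  fun_prop

theorem normSq_add_ofReal_mul (τ : ℝ) (ψ ψ' : ℂ) : normSq (ψ + τ * ψ')
    = normSq ψ + τ * (2 * (ψ * conj ψ').re) + τ ^ 2 * normSq ψ' := by
  rw [normSq_add, normSq_mul, normSq_ofReal, map_mul, conj_ofReal, mul_left_comm, re_ofReal_mul]
  ring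

theorem fderiv_normSq_psi : fderiv ℝ (fun q => normSq (psi q)) q q'
    = 2 * (psi q * conj (psi q')).re := by
  refine fderiv_apply_of_cubic (k := normSq (psi q')) (l := 0)
    (contDiff_normSq_psi.differentiable (by simp)) fun τ => ?_
  simp only [psi_add_smul, normSq_add_ofReal_mul, smul_eq_mul, mul_zero, add_zero]

theorem psi_totalDir (i : Fin 3) : psi (totalDir r i) = (r i).1 := by
  simp [psi, totalDir, horizontal, vertical_apply, depEquiv_apply]

theorem eqB_jet : eqB p (jet q r s) = waveOp p (fun i j => (s i j).2)
    - dirDeriv p fun i => 2 * (psi q * conj (r i).1).re := by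
  simp only [eqB, D0_jet, fderiv_normSq_psi, psi_totalDir]
  rfl

theorem jet_add_smul (τ : ℝ) :
    jet q r s + τ • jet q' r' s' = jet (q + τ • q') (r + τ • r') (s + τ • s') := by
  refine Prod.ext (Prod.ext rfl ?_) ?_ <;>
  simp only [jet, Prod.snd_add, Prod.fst_add, Prod.smul_fst, Prod.smul_snd, Pi.add_apply,
    Pi.smul_apply, map_add, map_smul] <;>
  rfl

theorem differentiable_eqA : Differentiable ℝ (eqA p) := by
  have hpsi : Differentiable ℝ psi := by
    change Differentiable ℝ fun q : Jet0 => (depEquiv.symm q.2).1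
    fun_prop
  have hpsi1 (i : Fin 3) : Differentiable ℝ (psi1 i) := by
    change Differentiable ℝ fun z : Jet2 => (depEquiv.symm fun α => z.1.2 α i).1
    fun_prop
  have hpsi2 (i j : Fin 3) : Differentiable ℝ (psi2 i j) := by
    change Differentiable ℝ fun z : Jet2 => (depEquiv.symm fun α => z.2 α i j).1
    fun_prop
  have hpsi0 : Differentiable ℝ fun z : Jet2 => psi z.1.1 := by fun_prop
  have hnormSq : Differentiable ℝ fun z : Jet2 => (normSq (psi z.1.1) : ℂ) :=
    ofRealCLM.differentiable.comp
      ((contDiff_normSq_psi.differentiable (by simp)).comp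
        (differentiable_fst.comp differentiable_fst))
  have hdirDeriv : Differentiable ℝ fun z : Jet2 => dirDeriv p fun i => z.1.2 2 i := by
    unfold dirDeriv
    fun_prop
  unfold eqA
  fun_prop

theorem fderiv_eqA_jet : fderiv ℝ (eqA p) (jet q r s) (jet q' r' s') =
    I * (r' 2).1 + schrodingerOp p (fun i j => (s' i j).1)
      - nonlinearityDeriv p (psi q) (dirDeriv p fun i => (r i).2) (psi q')
          (dirDeriv p fun i => (r' i).2) := by
  refine fderiv_apply_of_cubic (k := - ((p.b - p.w * p.m) * (normSq (psi q') * psi q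
      + 2 * (psi q * conj (psi q')).re * psi q') - p.w * psi q' * dirDeriv p fun i => (r' i).2))
    (l := - ((p.b - p.w * p.m) * normSq (psi q') * psi q')) (differentiable_eqA p) fun τ => ?_
  simp only [jet_add_smul, eqA_jet, nonlinearity, nonlinearityDeriv, psi_add_smul, schrodingerOp,
    normSq_add_ofReal_mul, dirDeriv, Pi.add_apply, Pi.smul_apply, Prod.fst_add, Prod.smul_fst,
    Prod.snd_add, Prod.smul_snd, real_smul, smul_eq_mul]
  push_cast
  ring

theorem fderiv_eqB_jet : fderiv ℝ (eqB p) (jet q r s) (jet q' r' s') =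
    waveOp p (fun i j => (s' i j).2)
      - dirDeriv p fun i => 2 * ((psi q' * conj (r i).1).re + (psi q * conj (r' i).1).re) := by
  refine fderiv_apply_of_cubic (k := - dirDeriv p fun i => 2 * (psi q' * conj (r' i).1).re)
    (l := 0) ?_ fun τ => ?_
  · have hD0 (i : Fin 3) : Differentiable ℝ fun z : Jet2 => D0 i (fun q => normSq (psi q)) z.1 :=
      ((contDiff_D0 i contDiff_normSq_psi).differentiable (by simp)).comp differentiable_fst
    unfold eqB dirDeriv
    fun_prop
  · simp only [jet_add_smul, eqB_jet, waveOp, psi_add_smul, dirDeriv, Pi.add_apply, Pi.smul_apply,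
      Prod.fst_add, Prod.smul_fst, Prod.snd_add, Prod.smul_snd, smul_eq_mul, add_re, add_im,
      mul_re, mul_im, conj_re, conj_im, ofReal_re, ofReal_im, real_smul]
    ring

/-- The system holds at the jet `jet q r s`. -/
structure IsSolutionJet : Prop where
  schrodinger : I * (r 2).1 + schrodingerOp p (fun i j => (s i j).1)
    = nonlinearity p (psi q) (dirDeriv p fun i => (r i).2)
  wave : waveOp p (fun i j => (s i j).2) = dirDeriv p fun i => 2 * (psi q * conj (r i).1).re

/-- The second prolongation of `V` annihilates the system at the jet `jet q r s`. -/
structure IsInvariantAt (V : Jet0 → Jet0) : Prop where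
  schrodinger : I * (prolong1 V q r 2).1 + schrodingerOp p (fun i j => (prolong2 V q r s i j).1)
    = nonlinearityDeriv p (psi q) (dirDeriv p fun i => (r i).2) (η V q).1
        (dirDeriv p fun i => (prolong1 V q r i).2)
  wave : waveOp p (fun i j => (prolong2 V q r s i j).2) = dirDeriv p fun i =>
    2 * (((η V q).1 * conj (r i).1).re + (psi q * conj (prolong1 V q r i).1).re)

variable {p} {V : Jet0 → Jet0}

theorem isLieSymmetry_iff (hV : ContDiff ℝ ∞ V) : IsLieSymmetry p V ↔
    ∀ q r s, (∀ i j, s i j = s j i) → IsSolutionJet p q r s → IsInvariantAt p q r s V := by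
  have hsol (q r s) : IsSolutionJet p q r s ↔ eqA p (jet q r s) = 0 ∧ eqB p (jet q r s) = 0 := by
    rw [eqA_jet, eqB_jet, sub_eq_zero, sub_eq_zero]
    exact ⟨fun h => ⟨h.1, h.2⟩, fun h => ⟨h.1, h.2⟩⟩
  have hinv (q r s) : IsInvariantAt p q r s V ↔
      fderiv ℝ (eqA p) (jet q r s) (prolong V (jet q r s)) = 0 ∧
      fderiv ℝ (eqB p) (jet q r s) (prolong V (jet q r s)) = 0 := by
    rw [prolong_jet hV, fderiv_eqA_jet, fderiv_eqB_jet, sub_eq_zero, sub_eq_zero]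
    exact ⟨fun h => ⟨h.1, h.2⟩, fun h => ⟨h.1, h.2⟩⟩
  simp only [hsol, hinv, IsLieSymmetry, hV, true_and, and_imp]
  refine ⟨fun h q r s hs => h _ (isSymm_jet.2 hs), fun h z hz => ?_⟩
  obtain ⟨q, r, s, rfl⟩ := exists_eq_jet z
  exact h q r s (isSymm_jet.1 hz)

end Linearization

section PrincipalPart

open ComplexConjugate

/-- The symmetric `3 × 3` matrix with the given entries on and above the diagonal. -/
def symmMatrix {R : Type*} (xx xy xt yy yt tt : R) : Fin 3 → Fin 3 → R :=
  ![![xx, xy, xt], ![xy, yy, yt], ![xt, yt, tt]]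

theorem symmMatrix_comm {R : Type*} (xx xy xt yy yt tt : R) (i j : Fin 3) :
    symmMatrix xx xy xt yy yt tt i j = symmMatrix xx xy xt yy yt tt j i := by
  fin_cases i <;> fin_cases j <;> rfl

variable {p : Params} {V : Jet0 → Jet0}

theorem exists_isSolutionJet (ha : p.a ≠ 0) (q : Jet0) (r : Fin 3 → ℂ × ℝ) :
    ∃ g : ℝ, IsSolutionJet p q r (symmMatrix ((nonlinearity p (psi q)
      (dirDeriv p fun i => (r i).2) - Complex.I * (r 2).1) / p.a, g) 0 0 0 0 0) := by
  have ha' : (p.a : ℂ) ≠ 0 := mod_cast ha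
  refine ⟨dirDeriv p fun i => 2 * (psi q * conj (r i).1).re, ?_, ?_⟩
  · simp only [schrodingerOp, symmMatrix, Matrix.cons_val, Prod.fst_zero, mul_zero, add_zero,
      mul_div_cancel₀ _ ha', add_sub_cancel]
  · simp [waveOp, symmMatrix]

theorem IsSolutionJet.add {q : Jet0} {r : Fin 3 → ℂ × ℝ} {s δ : Fin 3 → Fin 3 → ℂ × ℝ}
    (hs : IsSolutionJet p q r s) (hA : schrodingerOp p (fun i j => (δ i j).1) = 0)
    (hB : waveOp p (fun i j => (δ i j).2) = 0) : IsSolutionJet p q r (s + δ) := by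
  constructor
  · rw [← hs.schrodinger]
    simp only [schrodingerOp, Pi.add_apply, Prod.fst_add] at hA ⊢
    linear_combination hA
  · rw [← hs.wave]
    simp only [waveOp, Pi.add_apply, Prod.snd_add] at hB ⊢
    linear_combination hB

/-- Compare the invariance condition at two solution jets which differ by `δ`. -/
theorem IsLieSymmetry.principal_eq_zero (hV : IsLieSymmetry p V) (ha : p.a ≠ 0) (q : Jet0)
    (r : Fin 3 → ℂ × ℝ) {δ : Fin 3 → Fin 3 → ℂ × ℝ} (hδ : ∀ i j, δ i j = δ j i)
    (hA : schrodingerOp p (fun i j => (δ i j).1) = 0) (hB : waveOp p (fun i j => (δ i j).2) = 0) :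
    schrodingerOp p (fun i j => (prolong2Principal V q r δ i j).1) = 0 ∧
      waveOp p (fun i j => (prolong2Principal V q r δ i j).2) = 0 := by
  obtain ⟨s, hs, hsol⟩ : ∃ s, (∀ i j, s i j = s j i) ∧ IsSolutionJet p q r s :=
    let ⟨_, h⟩ := exists_isSolutionJet ha q r
    ⟨_, symmMatrix_comm _ _ _ _ _ _, h⟩
  have hinv := (isLieSymmetry_iff hV.1).1 hV q r
  have h0 := hinv s hs hsol
  have h1 := hinv (s + δ) (fun i j => congrArg₂ (· + ·) (hs i j) (hδ i j)) (hsol.add hA hB)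
  constructor
  · have := h1.schrodinger.trans h0.schrodinger.symm
    simp only [prolong2_add, schrodingerOp, Prod.fst_add] at this ⊢
    linear_combination this
  · have := h1.wave.trans h0.wave.symm
    simp only [prolong2_add, waveOp, Prod.snd_add] at this ⊢
    linear_combination this

theorem IsLieSymmetry.principal_symmMatrix_eq_zero (hV : IsLieSymmetry p V) (ha : p.a ≠ 0)
    (q : Jet0) (r : Fin 3 → ℂ × ℝ) {xx xy xt yy yt tt : ℂ × ℝ}
    (hA : p.a * xx.1 + p.ε₀ * yy.1 = 0)
    (hB : xx.2 + (1 - p.m * p.c ^ 2) * yy.2 - p.m * tt.2 - 2 * p.m * p.c * yt.2 = 0) :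
    schrodingerOp p (fun i j =>
        (prolong2Principal V q r (symmMatrix xx xy xt yy yt tt) i j).1) = 0 ∧
      waveOp p (fun i j => (prolong2Principal V q r (symmMatrix xx xy xt yy yt tt) i j).2) = 0 :=
  hV.principal_eq_zero ha q r (symmMatrix_comm _ _ _ _ _ _) hA hB

variable (hV : IsLieSymmetry p V) (ha : p.a ≠ 0)

include hV ha

theorem IsLieSymmetry.fderiv_ξ_totalDir (hε : p.ε₀ ≠ 0) (q : Jet0) (r : Fin 3 → ℂ × ℝ) :
    fderiv ℝ (ξ V) q (totalDir r 0) 2 = 0 ∧ fderiv ℝ (ξ V) q (totalDir r 1) 2 = 0 ∧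
      p.a * fderiv ℝ (ξ V) q (totalDir r 0) 1 + p.ε₀ * fderiv ℝ (ξ V) q (totalDir r 1) 0 = 0 := by
  have key (xy xt yt : ℝ) := congrArg Complex.re (hV.principal_symmMatrix_eq_zero ha q r
    (xx := 0) (xy := (xy, 0)) (xt := (xt, 0)) (yy := 0) (yt := (yt, 0)) (tt := 0)
    (by simp) (by simp)).1
  simp only [schrodingerOp, prolong2Principal, symmMatrix, Fin.sum_univ_three, Matrix.cons_val,
    Prod.fst_sub, Prod.fst_add, Prod.smul_fst, Prod.fst_zero, map_zero, Pi.zero_apply, zero_smul,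
    Complex.real_smul, Complex.add_re, Complex.sub_re, Complex.re_ofReal_mul, Complex.ofReal_re,
    Complex.zero_re] at key
  refine ⟨(mul_eq_zero_iff_left ha).1 ?_, (mul_eq_zero_iff_left hε).1 ?_, ?_⟩
  · linear_combination - key 0 1 0 / 2
  · linear_combination - key 0 0 1 / 2
  · linear_combination - key 1 0 0 / 2

theorem IsLieSymmetry.fderiv_ξ_vertical (hε : p.ε₀ ≠ 0) (q : Jet0) (u : ℂ × ℝ) :
    fderiv ℝ (ξ V) q (vertical u) = 0 := by
  have key (r : Fin 3 → ℂ × ℝ) := hV.fderiv_ξ_totalDir ha hε q r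
  simp only [totalDir, map_add, Pi.add_apply] at key
  obtain ⟨h02, -, h01⟩ := key 0
  obtain ⟨u02, -, u01⟩ := key (Pi.single 0 u)
  have u10 := (key (Pi.single 1 u)).2.2
  simp only [Pi.zero_apply, map_zero, add_zero, Pi.single_eq_same, ne_eq, one_ne_zero,
    not_false_eq_true, Pi.single_eq_of_ne, zero_ne_one] at h02 h01 u02 u01 u10
  ext k
  fin_cases k <;> dsimp
  · exact (mul_eq_zero_iff_left hε).1 (by linear_combination u10 - h01)
  · exact (mul_eq_zero_iff_left ha).1 (by linear_combination u01 - h01)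
  · linear_combination u02 - h02

theorem IsLieSymmetry.fst_fderiv_η_vertical_eq_zero (hm : p.m ≠ 0) (q : Jet0) (g : ℝ) :
    (fderiv ℝ (η V) q (vertical (0, g))).1 = 0 := by
  have hA := (hV.principal_symmMatrix_eq_zero ha q 0 (xx := (0, g)) (xy := 0) (xt := 0)
    (yy := 0) (yt := 0) (tt := (0, g / p.m)) (by simp) (by simp [mul_div_cancel₀ _ hm])).1
  simpa [schrodingerOp, prolong2Principal, symmMatrix, Fin.sum_univ_three, ha] using hA

theorem IsLieSymmetry.snd_fderiv_η_vertical_eq_zero (hm : p.m ≠ 0) (q : Jet0) (z : ℂ) :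
    (fderiv ℝ (η V) q (vertical (z, 0))).2 = 0 := by
  have hB := (hV.principal_symmMatrix_eq_zero ha q 0 (xx := 0) (xy := 0) (xt := 0)
    (yy := 0) (yt := 0) (tt := (z, 0)) (by simp) (by simp)).2
  simpa [waveOp, prolong2Principal, symmMatrix, Fin.sum_univ_three, hm] using hB

theorem IsLieSymmetry.waveOp_eq_zero (q : Jet0) : ∃ μ : ℝ,
    ∀ g : Fin 3 → Fin 3 → ℝ, (∀ i j, g i j = g j i) → waveOp p g = 0 →
      waveOp p (fun i j => g i j * μ - ∑ k, fderiv ℝ (ξ V) q (horizontal i) k * g k j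
        - ∑ k, fderiv ℝ (ξ V) q (horizontal j) k * g i k) = 0 := by
  obtain ⟨μ, hμ⟩ : ∃ μ : ℝ, ∀ g : ℝ, (fderiv ℝ (η V) q (vertical (0, g))).2 = g * μ :=
    ⟨(fderiv ℝ (η V) q (vertical (0, 1))).2, fun g => by
      rw [← smul_eq_mul g, ← Prod.smul_snd, ← map_smul, ← map_smul, Prod.smul_mk, smul_zero,
        smul_eq_mul, mul_one]⟩
  refine ⟨μ, fun g hg hB => ?_⟩
  have := (hV.principal_eq_zero ha q 0 (δ := fun i j => (0, g i j))
    (fun i j => by rw [hg]) (by simp [schrodingerOp]) hB).2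
  simpa [prolong2Principal, totalDir, hμ, Prod.snd_sum] using this

theorem IsLieSymmetry.fderiv_ξ_conformal (hε : p.ε₀ ≠ 0) (hm : p.m ≠ 0) (q : Jet0) : ∃ τ β : ℝ,
    fderiv ℝ (ξ V) q (horizontal 0) = ![τ, -β, 0] ∧
    fderiv ℝ (ξ V) q (horizontal 1) = ![β, τ, 0] ∧
    fderiv ℝ (ξ V) q (horizontal 2) = ![-p.c * β, 0, τ] := by
  obtain ⟨h02, h12, -⟩ := hV.fderiv_ξ_totalDir ha hε q 0
  obtain ⟨μ, hμ⟩ := hV.waveOp_eq_zero ha q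
  have key (xx xy xt yy yt tt : ℝ) := hμ _ (symmMatrix_comm xx xy xt yy yt tt)
  simp only [waveOp, symmMatrix, Matrix.cons_val, Fin.sum_univ_three] at key
  simp only [totalDir, Pi.zero_apply, map_zero, add_zero] at h02 h12
  generalize fderiv ℝ (ξ V) q (horizontal 0) = x at *
  generalize fderiv ℝ (ξ V) q (horizontal 1) = y at *
  generalize fderiv ℝ (ξ V) q (horizontal 2) = t at *
  have ht0 : t 0 = - p.c * y 0 := by
    refine mul_left_cancel₀ hm ?_
    linear_combination (key 0 0 1 0 0 0 (by ring)) / 2 + h02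
  have hx1 : x 1 = - y 0 := by
    linear_combination - (key 0 1 0 0 0 0 (by ring)) / 2 + p.m * p.c * ht0
  have hx0 : x 0 = t 2 := by
    refine mul_left_cancel₀ hm ?_
    linear_combination - (key p.m 0 0 0 0 1 (by ring)) / 2 + p.m * p.c * h12
  have ht1 : t 1 = p.c * (t 2 - y 1) := by
    refine mul_left_cancel₀ hm ?_
    linear_combination (key 0 0 0 0 1 (-2 * p.c) (by ring)) / 2 + (1 + p.m * p.c ^ 2) * h12
  have hy1 : y 1 = t 2 := by
    refine mul_left_cancel₀ hm ?_
    linear_combination - (key 0 0 0 p.m 0 (1 - p.m * p.c ^ 2) (by ring)) / 2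
      + p.m * p.c * (1 - p.m * p.c ^ 2) * h12 + p.m ^ 2 * p.c * ht1
  refine ⟨t 2, y 0, ?_, ?_, ?_⟩
  all_goals
    ext k
    fin_cases k <;> simp [*]

end PrincipalPart

section Determining

open Complex

variable {p : Params} {V : Jet0 → Jet0} (hV : IsLieSymmetry p V) (ha : p.a ≠ 0)
  (hε : p.ε₀ ≠ 0) (hm : p.m ≠ 0) (hd : p.d ≠ 0) (hw : p.w ≠ 0)

include hV ha hε hm

/-- The Schrödinger equation has been used to eliminate `a ψ_xx + ε₀ ψ_yy`. -/
theorem IsLieSymmetry.schrodinger_determining (q : Jet0)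
    (r : Fin 3 → ℂ × ℝ) {S : ℂ}
    (hS : S = nonlinearity p (psi q) (dirDeriv p fun i => (r i).2) - I * (r 2).1) :
    I * (prolong1 V q r 2).1 + schrodingerOp p (fun i j =>
        (hess (η V) q (totalDir r j) (totalDir r i)
          - ∑ k, hess (ξ V) q (totalDir r j) (totalDir r i) k • r k).1)
      + (fderiv ℝ (η V) q (vertical (S, 0))).1 - 2 * fderiv ℝ (ξ V) q (horizontal 0) 0 * S
      = nonlinearityDeriv p (psi q) (dirDeriv p fun i => (r i).2) (η V q).1
          (dirDeriv p fun i => (prolong1 V q r i).2) := by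
  have ha' := ofReal_ne_zero.2 ha
  obtain ⟨g, hs⟩ := exists_isSolutionJet ha q r
  rw [← hS] at hs
  have hη : (fderiv ℝ (η V) q (vertical (S / p.a, g))).1
      = (fderiv ℝ (η V) q (vertical (S, 0))).1 / p.a := by
    have h : ((S / p.a, g) : ℂ × ℝ) = p.a⁻¹ • (S, 0) + (0, g) :=
      Prod.ext (by simp [div_eq_inv_mul]) (by simp)
    rw [h, map_add, map_smul, map_add, map_smul, Prod.fst_add,
      hV.fst_fderiv_η_vertical_eq_zero ha hm, add_zero, Prod.smul_fst, real_smul, ofReal_inv,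
      inv_mul_eq_div]
  have hprincipal : schrodingerOp p (fun i j =>
        (prolong2Principal V q r (symmMatrix (S / p.a, g) 0 0 0 0 0) i j).1)
      = (fderiv ℝ (η V) q (vertical (S, 0))).1 - 2 * fderiv ℝ (ξ V) q (horizontal 0) 0 * S := by
    simp only [schrodingerOp, prolong2Principal, symmMatrix, Fin.sum_univ_three, Matrix.cons_val,
      hV.fderiv_ξ_vertical ha hε, totalDir, map_add, Pi.zero_apply, zero_smul, smul_zero, map_zero,
      add_zero, sub_zero, mul_zero, Prod.fst_sub, Prod.smul_fst, Prod.fst_zero, real_smul, hη]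
    field_simp
    ring
  rw [← ((isLieSymmetry_iff hV.1).1 hV q r _ (symmMatrix_comm _ _ _ _ _ _) hs).schrodinger,
    add_sub_assoc, ← hprincipal]
  simp only [schrodingerOp, prolong2, Prod.fst_add]
  ring

/-- Compare the coefficients of `ψ_t`. -/
theorem IsLieSymmetry.fst_fderiv_η_vertical_I_mul_add (q : Jet0)
    (z : ℂ) : (fderiv ℝ (η V) q (vertical (I * z, 0))).1 =
      I * ((fderiv ℝ (η V) q (vertical (z, 0))).1 + fderiv ℝ (ξ V) q (horizontal 0) 0 * z) := by
  obtain ⟨τ, β, h0, h1, h2⟩ := hV.fderiv_ξ_conformal ha hε hm q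
  have A (z : ℂ) := hV.schrodinger_determining ha hε hm q ![0, 0, (z, 0)] rfl
  have A0 := A 0
  have A1 := A z
  have hS : vertical (nonlinearity p (psi q) 0 - I * z, 0)
      = vertical (nonlinearity p (psi q) 0, 0) - vertical (I * z, 0) := by simp [← map_sub]
  have hξ₀ (v : Jet0) : hess (ξ V) q v (horizontal 0) 2 = 0 :=
    clm_hess_eq_zero_of_clm_fderiv_eq_zero (contDiff_two_of_contDiff_infty (contDiff_ξ hV.1))
      (.proj 2) (fun q => by simpa [totalDir] using (hV.fderiv_ξ_totalDir ha hε q 0).1) q v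
  have hξ₁ (v : Jet0) : hess (ξ V) q v (horizontal 1) 2 = 0 :=
    clm_hess_eq_zero_of_clm_fderiv_eq_zero (contDiff_two_of_contDiff_infty (contDiff_ξ hV.1))
      (.proj 2) (fun q => by simpa [totalDir] using (hV.fderiv_ξ_totalDir ha hε q 0).2.1) q v
  simp only [prolong1, totalDir, schrodingerOp, dirDeriv, h0, h1, h2, hξ₀, hξ₁, hS,
    hV.fderiv_ξ_vertical ha hε, hV.snd_fderiv_η_vertical_eq_zero ha hm, ← Prod.zero_eq_mk,
    Fin.sum_univ_three, Matrix.cons_val, map_zero, map_add, map_sub, add_zero, zero_add, mul_zero,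
    sub_zero, neg_mul, smul_zero, zero_smul, Pi.add_apply, Pi.zero_apply, Prod.smul_mk, real_smul,
    smul_eq_mul, Prod.fst_zero, Prod.snd_zero, Prod.fst_sub, Prod.snd_sub, Prod.fst_add,
    Prod.snd_add] at A0 A1 ⊢
  linear_combination A0 - A1

theorem IsLieSymmetry.fderiv_ξ_horizontal_zero_zero (q : Jet0) :
    fderiv ℝ (ξ V) q (horizontal 0) 0 = 0 := by
  have key := hV.fst_fderiv_η_vertical_I_mul_add ha hε hm q
  have h1 := key (I * 1)
  have h2 : ((I * (I * 1), 0) : ℂ × ℝ) = - (1, 0) := by simp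
  rw [key 1, h2, map_neg, map_neg, Prod.fst_neg] at h1
  exact ofReal_eq_zero.1 (by linear_combination h1 / 2
    + (1 / 2 * (fderiv ℝ (η V) q (vertical (1, 0))).1 + fderiv ℝ (ξ V) q (horizontal 0) 0) * I_sq)

/-- Compare the coefficients of `φ_x`. -/
theorem IsLieSymmetry.fderiv_ξ_horizontal_one_zero_mul_psi
    (hd : p.d ≠ 0) (hw : p.w ≠ 0) (q : Jet0) :
    fderiv ℝ (ξ V) q (horizontal 1) 0 * psi q = 0 := by
  obtain ⟨τ, β, h0, h1, h2⟩ := hV.fderiv_ξ_conformal ha hε hm q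
  have hη (v : Jet0) : (hess (η V) q v (vertical (0, 1))).1 = 0 :=
    clm_hess_eq_zero_of_clm_fderiv_eq_zero (contDiff_two_of_contDiff_infty (contDiff_η hV.1))
      (.fst ℝ ℂ ℝ) (fun q => hV.fst_fderiv_η_vertical_eq_zero ha hm q 1) q v
  have hη' : (hess (η V) q (vertical (0, 1)) (horizontal 0)).1 = 0 := by
    rw [hess_comm (contDiff_two_of_contDiff_infty (contDiff_η hV.1)), hη]
  have A (g : ℝ) := hV.schrodinger_determining ha hε hm q ![(0, g), 0, 0] rfl
  have A0 := A 0
  have A1 := A 1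
  simp only [prolong1, totalDir, schrodingerOp, dirDeriv, nonlinearityDeriv, h0, h1, h2, hη, hη',
    ← Prod.zero_eq_mk, Fin.sum_univ_three, Matrix.cons_val, map_zero, map_add, add_zero,
    mul_zero, mul_one, sub_zero, sub_neg_eq_add, neg_mul, neg_smul, smul_zero, Prod.neg_mk,
    neg_zero, Prod.smul_mk, smul_eq_mul, add_apply, Pi.add_apply, Prod.fst_zero, Prod.snd_zero,
    Prod.fst_sub, Prod.snd_sub, Prod.fst_add, ofReal_add, ofReal_sub, ofReal_mul, ofReal_zero]
    at A0 A1
  have h : (p.w : ℂ) * p.d * (β * psi q) = 0 := by linear_combination A1 - A0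
  simpa [h1, hw, hd] using h

include hd hw

theorem IsLieSymmetry.fderiv_ξ_eq_zero (q : Jet0) : fderiv ℝ (ξ V) q = 0 := by
  have hξ := (contDiff_ξ hV.1).differentiable (by simp)
  have hβ : fderiv ℝ (ξ V) q (horizontal 1) 0 = 0 := by
    set u : ℂ × ℝ := (1 - psi q, 0)
    have hψ : psi (q + vertical u) = 1 := by
      apply Complex.ext <;> simp [psi, vertical_apply, depEquiv_apply, u]
    have hshift : fderiv ℝ (ξ V) (q + vertical u) = fderiv ℝ (ξ V) q := by
      rw [← fderiv_comp_add_right]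
      exact congrArg (fderiv ℝ · q) (funext fun q =>
        apply_add_of_fderiv_eq_zero hξ (fun q => hV.fderiv_ξ_vertical ha hε q u) q)
    simpa [hψ, hshift] using
      hV.fderiv_ξ_horizontal_one_zero_mul_psi ha hε hm hd hw (q + vertical u)
  obtain ⟨τ, β, h0, h1, h2⟩ := hV.fderiv_ξ_conformal ha hε hm q
  have hτ := hV.fderiv_ξ_horizontal_zero_zero ha hε hm q
  rw [h0, Matrix.cons_val_zero] at hτ
  rw [h1, Matrix.cons_val_zero] at hβ
  refine ContinuousLinearMap.ext fun v => ?_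
  rw [eq_horizontal_add_vertical v]
  simp only [map_add, map_smul, h0, h1, h2, hτ, hβ, hV.fderiv_ξ_vertical ha hε, neg_zero, mul_zero]
  ext k
  fin_cases k <;> simp

theorem IsLieSymmetry.ξ_eq (q : Jet0) : ξ V q = ξ V 0 :=
  is_const_of_fderiv_eq_zero ((contDiff_ξ hV.1).differentiable (by simp))
    (hV.fderiv_ξ_eq_zero ha hε hm hd hw) q 0

theorem IsLieSymmetry.schrodinger_determining_η (q : Jet0) (r : Fin 3 → ℂ × ℝ) :
    I * (fderiv ℝ (η V) q (totalDir r 2)).1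
      + schrodingerOp p (fun i j => (hess (η V) q (totalDir r j) (totalDir r i)).1)
      + (fderiv ℝ (η V) q (vertical
          (nonlinearity p (psi q) (dirDeriv p fun i => (r i).2) - I * (r 2).1, 0))).1
      = nonlinearityDeriv p (psi q) (dirDeriv p fun i => (r i).2) (η V q).1
          (dirDeriv p fun i => (fderiv ℝ (η V) q (totalDir r i)).2) := by
  have hξ := hV.fderiv_ξ_eq_zero ha hε hm hd hw
  have hξ' : hess (ξ V) q = 0 := by
    rw [hess, funext hξ]
    exact fderiv_const_apply 0
  simpa [prolong1, hξ, hξ'] using hV.schrodinger_determining ha hε hm q r rfl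

omit hd hw in
theorem IsLieSymmetry.fst_fderiv_η_vertical (q : Jet0) (z : ℂ) :
    (fderiv ℝ (η V) q (vertical (z, 0))).1 = z * (fderiv ℝ (η V) q (vertical (1, 0))).1 := by
  have hI := hV.fst_fderiv_η_vertical_I_mul_add ha hε hm q 1
  rw [hV.fderiv_ξ_horizontal_zero_zero ha hε hm, mul_one, ofReal_zero, zero_mul, add_zero] at hI
  have hz : ((z, 0) : ℂ × ℝ) = z.re • (1, 0) + z.im • (I, 0) := by
    apply Prod.ext <;> simp [re_add_im]
  rw [hz, map_add, map_add, map_smul, map_smul, map_smul, map_smul, Prod.fst_add, Prod.smul_fst,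
    Prod.smul_fst, hI, real_smul, real_smul]
  conv_rhs => rw [← re_add_im z]
  ring

/-- Compare the coefficients of `φ_t`. -/
theorem IsLieSymmetry.fst_η_eq_psi_mul (q : Jet0) :
    (η V q).1 = psi q * ((fderiv ℝ (η V) q (vertical (1, 0))).1
      - (fderiv ℝ (η V) q (vertical (0, 1))).2) := by
  obtain ⟨l, hl⟩ : ∃ l : ℂ, ∀ z, (fderiv ℝ (η V) q (vertical (z, 0))).1 = z * l :=
    ⟨_, hV.fst_fderiv_η_vertical ha hε hm q⟩
  have A (g : ℝ) := hV.schrodinger_determining_η ha hε hm hd hw q ![0, 0, (0, g)]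
  have A0 := A 0
  have A1 := A 1
  simp only [totalDir, schrodingerOp, nonlinearity, nonlinearityDeriv, dirDeriv, hl,
    hV.fst_fderiv_η_vertical_eq_zero ha hm, ← Prod.zero_eq_mk, Matrix.cons_val, map_zero, map_add,
    add_zero, mul_zero, mul_one, sub_zero, Prod.fst_zero, Prod.snd_zero, Prod.fst_add,
    Prod.snd_add, ofReal_zero, ofReal_add, ofReal_sub, ofReal_mul] at A0 A1
  rw [hl, one_mul]
  have h : (p.w : ℂ) * p.m * ((η V q).1 - psi q * (l
      - (fderiv ℝ (η V) q (vertical (0, 1))).2)) = 0 := by linear_combination A1 - A0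
  simpa [hw, hm, sub_eq_zero] using h

/-- Compare the coefficients of `ψ_x` and `ψ_x²`. -/
theorem IsLieSymmetry.hess_η_horizontal_zero (q : Jet0) (z : ℂ) :
    (hess (η V) q (horizontal 0) (vertical (z, 0))).1 = 0 ∧
    (hess (η V) q (vertical (z, 0)) (vertical (z, 0))).1 = 0 := by
  have A (z : ℂ) := hV.schrodinger_determining_η ha hε hm hd hw q ![(z, 0), 0, 0]
  have A0 := A 0
  have A1 := A z
  have A2 := A (-z)
  have hz : vertical (-z, 0) = - vertical (z, 0) := by simp [← map_neg]
  have hcomm := hess_comm (contDiff_two_of_contDiff_infty (contDiff_η hV.1)) q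
    (vertical (z, 0)) (horizontal 0)
  simp only [totalDir, schrodingerOp, dirDeriv, hz, hcomm, ← Prod.zero_eq_mk, Matrix.cons_val,
    map_zero, map_add, map_neg, neg_neg, add_apply, neg_apply, neg_add_rev, Prod.fst_zero,
    Prod.snd_zero, Prod.fst_add, Prod.fst_neg, add_zero, mul_zero, sub_zero] at A0 A1 A2
  have ha' := ofReal_ne_zero.2 ha
  constructor <;> refine (mul_eq_zero_iff_left ha').1 ?_
  · linear_combination (A1 - A2) / 4
  · linear_combination (A1 + A2) / 2 - A0

theorem IsLieSymmetry.hess_η_horizontal_one (q : Jet0) (z : ℂ) :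
    (hess (η V) q (horizontal 1) (vertical (z, 0))).1 = 0 := by
  have A (z : ℂ) := hV.schrodinger_determining_η ha hε hm hd hw q ![0, (z, 0), 0]
  have A1 := A z
  have A2 := A (-z)
  have hz : vertical (-z, 0) = - vertical (z, 0) := by simp [← map_neg]
  have hcomm := hess_comm (contDiff_two_of_contDiff_infty (contDiff_η hV.1)) q
    (vertical (z, 0)) (horizontal 1)
  simp only [totalDir, schrodingerOp, dirDeriv, hz, hcomm,
    hV.snd_fderiv_η_vertical_eq_zero ha hm, Matrix.cons_val, map_zero, map_add, map_neg, neg_neg,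
    neg_zero, add_apply, neg_apply, neg_add_rev, Prod.fst_zero, Prod.snd_zero, Prod.fst_add,
    Prod.snd_add, Prod.fst_neg, Prod.snd_neg, add_zero, mul_zero, sub_zero] at A1 A2
  exact (mul_eq_zero_iff_left (ofReal_ne_zero.2 hε)).1 (by linear_combination (A1 - A2) / 4)

theorem IsLieSymmetry.hess_η_vertical_vertical (q : Jet0) (z z' : ℂ) :
    (hess (η V) q (vertical (z, 0)) (vertical (z', 0))).1 = 0 := by
  have key (z : ℂ) := (hV.hess_η_horizontal_zero ha hε hm hd hw q z).2
  have hadd := key (z + z')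
  have hcomm := hess_comm (contDiff_two_of_contDiff_infty (contDiff_η hV.1)) q
    (vertical (z, 0)) (vertical (z', 0))
  have hz : vertical (z + z', 0) = vertical (z, 0) + vertical (z', 0) := by simp [← map_add]
  simp only [hz, map_add, add_apply, Prod.fst_add, key, ← hcomm] at hadd
  linear_combination hadd / 2

theorem IsLieSymmetry.fst_hess_η_vertical (q : Jet0) {v : Jet0} (hv : v.1 2 = 0) :
    (hess (η V) q v (vertical (1, 0))).1 = 0 := by
  have h0 := (hV.hess_η_horizontal_zero ha hε hm hd hw q 1).1
  have h1 := hV.hess_η_horizontal_one ha hε hm hd hw q 1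
  have hz (z : ℂ) := hV.hess_η_vertical_vertical ha hε hm hd hw q z 1
  have hg (g : ℝ) : (hess (η V) q (vertical (0, g)) (vertical (1, 0))).1 = 0 := by
    rw [hess_comm (contDiff_two_of_contDiff_infty (contDiff_η hV.1))]
    exact clm_hess_eq_zero_of_clm_fderiv_eq_zero
      (contDiff_two_of_contDiff_infty (contDiff_η hV.1)) (.fst ℝ ℂ ℝ)
      (fun q => hV.fst_fderiv_η_vertical_eq_zero ha hm q g) q _
  obtain ⟨⟨z, g⟩, hu⟩ : ∃ u, depEquiv.symm v.2 = u := ⟨_, rfl⟩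
  rw [eq_horizontal_add_vertical v, hv, hu, vertical_mk]
  simp [h0, h1, hz, hg]

theorem IsLieSymmetry.fst_fderiv_η_add (q : Jet0) {v : Jet0} (hv : v.1 2 = 0) :
    (fderiv ℝ (η V) (q + v) (vertical (1, 0))).1 = (fderiv ℝ (η V) q (vertical (1, 0))).1 :=
  clm_fderiv_apply_add_of_hess_eq_zero (contDiff_two_of_contDiff_infty (contDiff_η hV.1))
    (.fst ℝ ℂ ℝ) (fun q => hV.fst_hess_η_vertical ha hε hm hd hw q hv) q

/-- Differentiate `fst_η_eq_psi_mul` along `∂_u`. -/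
theorem IsLieSymmetry.snd_fderiv_η_vertical_zero_one (q : Jet0) :
    (fderiv ℝ (η V) q (vertical (0, 1))).2 = 0 := by
  have hη := contDiff_two_of_contDiff_infty (contDiff_η hV.1)
  have hφ (s : ℝ) (q : Jet0) : (fderiv ℝ (η V) (q + vertical (s, 0)) (vertical (0, 1))).2
      = (fderiv ℝ (η V) q (vertical (0, 1))).2 := by
    refine clm_fderiv_apply_add_of_hess_eq_zero hη (.snd ℝ ℂ ℝ) (fun q => ?_) q
    rw [hess_comm hη]
    exact clm_hess_eq_zero_of_clm_fderiv_eq_zero hη (.snd ℝ ℂ ℝ)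
      (fun q => hV.snd_fderiv_η_vertical_eq_zero ha hm q s) q _
  have key : fderiv ℝ (fun q => ContinuousLinearMap.fst ℝ ℂ ℝ (η V q)) q (vertical (1, 0))
      = (fderiv ℝ (η V) q (vertical (1, 0))).1 - (fderiv ℝ (η V) q (vertical (0, 1))).2 := by
    refine fderiv_apply_of_cubic (k := 0) (l := 0) ?_ fun s => ?_
    · exact (ContinuousLinearMap.differentiable _).comp (hη.differentiable two_ne_zero)
    · have hs : s • vertical (1, 0) = vertical ((s : ℂ), 0) := by simp [← map_smul]
      have hψ : psi (q + vertical ((s : ℂ), 0)) = psi q + s := by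
        apply Complex.ext <;> simp [psi, vertical_apply, depEquiv_apply]
      simp only [ContinuousLinearMap.coe_fst', hs, hV.fst_η_eq_psi_mul ha hε hm hd hw, hψ, hφ,
        hV.fst_fderiv_η_add ha hε hm hd hw _ (v := vertical (s, 0)) rfl, real_smul, smul_zero]
      ring
  rw [fderiv_clm_comp (hη.differentiable two_ne_zero)] at key
  rw [ContinuousLinearMap.comp_apply, ContinuousLinearMap.coe_fst', eq_comm, sub_eq_self] at key
  exact ofReal_eq_zero.1 key

theorem IsLieSymmetry.fst_η_eq (q : Jet0) :
    (η V q).1 = (fderiv ℝ (η V) (Pi.single 2 (q.1 2), 0) (vertical (1, 0))).1 * psi q := by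
  have hq : q = (Pi.single 2 (q.1 2), 0) + (q - (Pi.single 2 (q.1 2), 0)) := by abel
  have h2 : (q - (Pi.single 2 (q.1 2), 0)).1 2 = 0 := by simp
  rw [hV.fst_η_eq_psi_mul ha hε hm hd hw, hV.snd_fderiv_η_vertical_zero_one ha hε hm hd hw,
    ofReal_zero, sub_zero, mul_comm]
  conv_lhs => rw [hq, hV.fst_fderiv_η_add ha hε hm hd hw _ h2, ← hq]

theorem IsLieSymmetry.snd_η_eq (q : Jet0) : (η V q).2 = (η V (q.1, 0)).2 := by
  have hη := (contDiff_η hV.1).differentiable (by simp)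
  obtain ⟨⟨z, g⟩, hu⟩ : ∃ u, depEquiv.symm q.2 = u := ⟨_, rfl⟩
  have hg : ((0, g) : ℂ × ℝ) = g • (0, 1) := by simp
  have hq : q = (q.1, 0) + vertical (depEquiv.symm q.2) := by simp [vertical_apply]
  conv_lhs => rw [hq]
  refine apply_add_of_fderiv_eq_zero (f := fun q => ContinuousLinearMap.snd ℝ ℂ ℝ (η V q))
    ((ContinuousLinearMap.differentiable _).comp hη) (fun q' => ?_) _
  rw [fderiv_clm_comp hη, hu, vertical_mk, hg, map_smul, map_add, map_smul]
  simp [hV.snd_fderiv_η_vertical_eq_zero ha hm,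
    hV.snd_fderiv_η_vertical_zero_one ha hε hm hd hw]

omit hV ha hε hm hd hw

/-- The vector field with components `ξ₀` along `(x, y, t)`, `χ(t) ψ` along `ψ` and `h(x, y, t)`
along `φ`: a translation combined with an infinitesimal change of gauge. -/
def gaugeField (ξ₀ : Fin 3 → ℝ) (χ : ℝ → ℂ) (h : (Fin 3 → ℝ) → ℝ) (q : Jet0) : Jet0 :=
  (ξ₀, depEquiv (χ (q.1 2) * psi q, h q.1))

include ha hε hm hd hw in
theorem IsLieSymmetry.exists_eq_gaugeField (hV : IsLieSymmetry p V) : ∃ ξ₀ χ h,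
    ContDiff ℝ ∞ χ ∧ ContDiff ℝ ∞ h ∧ V = gaugeField ξ₀ χ h := by
  have hη := contDiff_η hV.1
  refine ⟨ξ V 0, fun t => (fderiv ℝ (η V) (Pi.single 2 t, 0) (vertical (1, 0))).1,
    fun x => (η V (x, 0)).2, ?_, by fun_prop, funext fun q => ?_⟩
  · have hsingle : ContDiff ℝ ∞ fun t : ℝ => ((Pi.single 2 t, 0) : Jet0) :=
      (ContinuousLinearMap.single ℝ (fun _ : Fin 3 => ℝ) 2).contDiff.prodMk contDiff_const
    exact (((hη.fderiv_right (m := ∞) (by simp)).comp hsingle).clm_apply contDiff_const).fst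
  · refine Prod.ext (hV.ξ_eq ha hε hm hd hw q) (depEquiv.symm.injective ?_)
    rw [gaugeField, depEquiv.symm_apply_apply, ← hV.fst_η_eq ha hε hm hd hw,
      ← hV.snd_η_eq ha hε hm hd hw]
    rfl

end Determining

section GaugeField

open Complex ComplexConjugate

/-- The direction of the transport operator `m ∂_t + (m c - d) ∂_y`. -/
def flowDir (p : Params) : Fin 3 → ℝ := ![0, p.m * p.c - p.d, p.m]

/-- The value at `x` of `h_xx + (1 - m c²) h_yy - m h_tt - 2 m c h_yt`. -/
def wave (p : Params) (h : (Fin 3 → ℝ) → ℝ) (x : Fin 3 → ℝ) : ℝ :=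
  waveOp p fun i j => hess h x (Pi.single j 1) (Pi.single i 1)

theorem eq_sum_single (v : Fin 3 → ℝ) :
    v = v 0 • Pi.single 0 1 + v 1 • Pi.single 1 1 + v 2 • Pi.single 2 1 := by
  ext i
  fin_cases i <;> simp

theorem dirDeriv_clm_single (p : Params) (L : (Fin 3 → ℝ) →L[ℝ] ℝ) :
    (dirDeriv p fun i => L (Pi.single i 1)) = L (flowDir p) := by
  rw [eq_sum_single (flowDir p)]
  simp [flowDir, dirDeriv, add_comm]

theorem psi_depEquiv (x : Fin 3 → ℝ) (u : ℂ × ℝ) : psi (x, depEquiv u) = u.1 := rfl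

theorem isBoundedLinearMap_psi : IsBoundedLinearMap ℝ psi :=
  ContinuousLinearMap.isBoundedLinearMap
    (.fst ℝ ℂ ℝ ∘L (depEquiv.symm : (Fin 3 → ℝ) →L[ℝ] ℂ × ℝ) ∘L .snd ℝ (Fin 3 → ℝ) (Fin 3 → ℝ))

variable {p : Params} {ξ₀ : Fin 3 → ℝ} {χ : ℝ → ℂ} {h : (Fin 3 → ℝ) → ℝ}

theorem ξ_gaugeField : ξ (gaugeField ξ₀ χ h) = fun _ => ξ₀ := rfl

theorem η_gaugeField : η (gaugeField ξ₀ χ h) = fun q => (χ (q.1 2) * psi q, h q.1) :=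
  funext fun _ => depEquiv.symm_apply_apply _

section

variable (hχ : ContDiff ℝ ∞ χ) (hh : ContDiff ℝ ∞ h)

include hχ

theorem contDiff_mul_psi : ContDiff ℝ ∞ fun q : Jet0 => χ (q.1 2) * psi q := by
  have hpsi := isBoundedLinearMap_psi.contDiff (n := ∞)
  fun_prop

theorem fderiv_apply_time (q v : Jet0) :
    fderiv ℝ (fun q : Jet0 => χ (q.1 2)) q v = v.1 2 * deriv χ (q.1 2) := by
  let time : Jet0 →L[ℝ] ℝ := .proj 2 ∘L .fst ℝ (Fin 3 → ℝ) (Fin 3 → ℝ)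
  have h := DFunLike.congr_fun (fderiv_comp_clm (hχ.differentiable (by simp)) time q) v
  rwa [ContinuousLinearMap.comp_apply, fderiv_eq_smul_deriv, real_smul] at h

theorem fderiv_mul_psi (q v : Jet0) : fderiv ℝ (fun q : Jet0 => χ (q.1 2) * psi q) q v
    = v.1 2 * (deriv χ (q.1 2) * psi q) + χ (q.1 2) * psi v := by
  have htime : DifferentiableAt ℝ (fun q : Jet0 => χ (q.1 2)) q :=
    ContDiff.differentiable (n := ∞) (by fun_prop) (by simp) q
  rw [fderiv_fun_mul htime isBoundedLinearMap_psi.differentiableAt, isBoundedLinearMap_psi.fderiv,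
    add_apply, smul_apply, smul_apply, fderiv_apply_time hχ, smul_eq_mul, smul_eq_mul, add_comm,
    mul_comm (psi q), mul_assoc]
  rfl

include hh

theorem contDiff_gaugeField : ContDiff ℝ ∞ (gaugeField ξ₀ χ h) :=
  contDiff_const.prodMk (depEquiv.contDiff.comp
    ((contDiff_mul_psi hχ).prodMk (hh.comp contDiff_fst)))

theorem fderiv_η_gaugeField (q v : Jet0) : fderiv ℝ (η (gaugeField ξ₀ χ h)) q v =
    (v.1 2 * (deriv χ (q.1 2) * psi q) + χ (q.1 2) * psi v, fderiv ℝ h q.1 v.1) := by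
  have hh₁ : Differentiable ℝ fun q : Jet0 => h q.1 :=
    (hh.comp contDiff_fst).differentiable (by simp)
  rw [η_gaugeField, DifferentiableAt.fderiv_prodMk
    ((contDiff_mul_psi hχ).differentiable (by simp) q) (hh₁ q), ContinuousLinearMap.prod_apply,
    fderiv_mul_psi hχ]
  exact congrArg _ (DFunLike.congr_fun
    (fderiv_comp_clm (hh.differentiable (by simp)) (.fst ℝ _ (Fin 3 → ℝ)) q) v)

theorem prolong1_gaugeField (q : Jet0) (r : Fin 3 → ℂ × ℝ) (i : Fin 3) :
    prolong1 (gaugeField ξ₀ χ h) q r i = ((Pi.single i 1 : Fin 3 → ℝ) 2 * (deriv χ (q.1 2) * psi q)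
      + χ (q.1 2) * (r i).1, fderiv ℝ h q.1 (Pi.single i 1)) := by
  rw [prolong1, fderiv_η_gaugeField hχ hh, psi_totalDir]
  simp [ξ_gaugeField, totalDir, horizontal, vertical_apply]

theorem prolong2_gaugeField (q : Jet0) (r : Fin 3 → ℂ × ℝ) (s : Fin 3 → Fin 3 → ℂ × ℝ)
    (i j : Fin 3) : prolong2 (gaugeField ξ₀ χ h) q r s i j =
      hess (η (gaugeField ξ₀ χ h)) q (totalDir r j) (totalDir r i)
        + (χ (q.1 2) * (s i j).1, 0) := by
  simp [prolong2, prolong2Principal, fderiv_η_gaugeField hχ hh, ξ_gaugeField, hess, vertical_apply,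
    psi_depEquiv, fderiv_fun_const]

theorem fst_hess_η_gaugeField (q : Jet0) {v v' : Jet0} (hv : v.1 2 = 0) (hv' : v'.1 2 = 0) :
    (hess (η (gaugeField ξ₀ χ h)) q v v').1 = 0 := by
  have hη := contDiff_two_of_contDiff_infty (contDiff_η (contDiff_gaugeField (ξ₀ := ξ₀) hχ hh))
  have hχψ : ContDiff ℝ ∞ fun q : Jet0 => χ (q.1 2) * psi q := contDiff_mul_psi hχ
  have hderiv (q : Jet0) :
      fderiv ℝ (fun q : Jet0 => χ (q.1 2) * psi q) q v' = χ (q.1 2) * psi v' := by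
    simp [fderiv_mul_psi hχ, hv']
  refine (hess_clm_comp hη (.fst ℝ ℂ ℝ) q v v').symm.trans ?_
  simp only [η_gaugeField, ContinuousLinearMap.coe_fst']
  rw [← fderiv_fderiv_apply (contDiff_two_of_contDiff_infty hχψ)]
  simp only [hderiv]
  have htime : DifferentiableAt ℝ (fun q : Jet0 => χ (q.1 2)) q :=
    ContDiff.differentiable (n := ∞) (by fun_prop) (by simp) q
  rw [fderiv_mul_const htime, smul_apply, fderiv_apply_time hχ, hv, ofReal_zero, zero_mul,
    smul_zero]

theorem snd_hess_η_gaugeField (q v v' : Jet0) :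
    (hess (η (gaugeField ξ₀ χ h)) q v v').2 = hess h q.1 v.1 v'.1 := by
  have hη := contDiff_two_of_contDiff_infty (contDiff_η (contDiff_gaugeField (ξ₀ := ξ₀) hχ hh))
  refine (hess_clm_comp hη (.snd ℝ ℂ ℝ) q v v').symm.trans ?_
  simp only [η_gaugeField]
  exact hess_comp_clm (contDiff_two_of_contDiff_infty hh) (.fst ℝ _ (Fin 3 → ℝ)) q v v'

theorem schrodingerOp_prolong2_gaugeField (q : Jet0) (r : Fin 3 → ℂ × ℝ)
    (s : Fin 3 → Fin 3 → ℂ × ℝ) :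
    schrodingerOp p (fun i j => (prolong2 (gaugeField ξ₀ χ h) q r s i j).1)
      = χ (q.1 2) * schrodingerOp p fun i j => (s i j).1 := by
  have htotalDir {i : Fin 3} (hi : i ≠ 2) : (totalDir r i).1 2 = 0 := by
    simp [totalDir, horizontal, vertical_apply, hi.symm]
  have h0 := htotalDir (i := 0) (by decide)
  have h1 := htotalDir (i := 1) (by decide)
  simp only [schrodingerOp, prolong2_gaugeField hχ hh, Prod.fst_add,
    fst_hess_η_gaugeField hχ hh q h0 h0, fst_hess_η_gaugeField hχ hh q h1 h1]
  ring

theorem waveOp_prolong2_gaugeField (q : Jet0) (r : Fin 3 → ℂ × ℝ)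
    (s : Fin 3 → Fin 3 → ℂ × ℝ) :
    waveOp p (fun i j => (prolong2 (gaugeField ξ₀ χ h) q r s i j).2) = wave p h q.1 := by
  simp [wave, prolong2_gaugeField hχ hh, snd_hess_η_gaugeField hχ hh, totalDir, horizontal,
    vertical_apply]

theorem isInvariantAt_gaugeField_iff {q : Jet0} {r : Fin 3 → ℂ × ℝ} {s : Fin 3 → Fin 3 → ℂ × ℝ}
    (hs : IsSolutionJet p q r s) : IsInvariantAt p q r s (gaugeField ξ₀ χ h) ↔
      (I * deriv χ (q.1 2) + p.w * fderiv ℝ h q.1 (flowDir p)) * psi q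
          = 2 * (p.b - p.w * p.m) * (χ (q.1 2)).re * normSq (psi q) * psi q ∧
        wave p h q.1 = 2 * p.m * (deriv χ (q.1 2)).re * normSq (psi q)
          + 4 * (χ (q.1 2)).re * dirDeriv p fun i => (psi q * conj (r i).1).re := by
  have hflow : (dirDeriv p fun i => fderiv ℝ h q.1 (Pi.single i 1))
      = fderiv ℝ h q.1 (flowDir p) := dirDeriv_clm_single p _
  have hschrodinger : I * (prolong1 (gaugeField ξ₀ χ h) q r 2).1 + schrodingerOp p
      (fun i j => (prolong2 (gaugeField ξ₀ χ h) q r s i j).1) = I * deriv χ (q.1 2) * psi q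
        + χ (q.1 2) * nonlinearity p (psi q) (dirDeriv p fun i => (r i).2) := by
    rw [← hs.schrodinger, schrodingerOp_prolong2_gaugeField hχ hh, prolong1_gaugeField hχ hh,
      Pi.single_eq_same]
    push_cast
    ring
  have hnonlinearity (g g' : ℝ) : nonlinearityDeriv p (psi q) g (χ (q.1 2) * psi q) g'
      = χ (q.1 2) * nonlinearity p (psi q) g + 2 * (p.b - p.w * p.m) * (χ (q.1 2)).re
        * normSq (psi q) * psi q - p.w * g' * psi q := by
    have hre : (psi q * conj (χ (q.1 2) * psi q)).re = (χ (q.1 2)).re * normSq (psi q) := by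
      simp only [map_mul, mul_re, conj_re, conj_im, mul_im, normSq_apply]
      ring
    rw [nonlinearityDeriv, nonlinearity, hre]
    push_cast
    ring
  have hwave : (dirDeriv p fun i => 2 * ((χ (q.1 2) * psi q * conj (r i).1).re
      + (psi q * conj (prolong1 (gaugeField ξ₀ χ h) q r i).1).re)) =
        2 * p.m * (deriv χ (q.1 2)).re * normSq (psi q)
          + 4 * (χ (q.1 2)).re * dirDeriv p fun i => (psi q * conj (r i).1).re := by
    simp only [dirDeriv, mul_re, conj_re, mul_im, conj_im, mul_neg, sub_neg_eq_add,
      prolong1_gaugeField hχ hh, Pi.single_eq_same, ofReal_one, one_mul, map_add, map_mul, add_re,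
      neg_mul, neg_neg, add_im, ne_eq, Fin.reduceEq, not_false_eq_true, Pi.single_eq_of_ne,
      ofReal_zero, zero_mul, zero_add, normSq_apply]
    ring
  have hη : (η (gaugeField ξ₀ χ h) q).1 = χ (q.1 2) * psi q := by rw [η_gaugeField]
  refine Iff.trans (b := _ ∧ _) ⟨fun h => ⟨h.schrodinger, h.wave⟩, fun h => ⟨h.1, h.2⟩⟩ ?_
  rw [hschrodinger, waveOp_prolong2_gaugeField hχ hh, hη, hnonlinearity, hwave]
  simp only [prolong1_gaugeField hχ hh, hflow]
  refine and_congr_left fun _ => ⟨fun h => ?_, fun h => ?_⟩ <;> linear_combination h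

theorem isLieSymmetry_gaugeField_iff (ha : p.a ≠ 0) (hm : p.m ≠ 0) :
    IsLieSymmetry p (gaugeField ξ₀ χ h) ↔ (∀ t, (χ t).re = 0) ∧
      (∀ x, p.w * fderiv ℝ h x (flowDir p) = (deriv χ (x 2)).im) ∧ ∀ x, wave p h x = 0 := by
  rw [isLieSymmetry_iff (contDiff_gaugeField hχ hh)]
  refine ⟨fun hinv => ?_, fun ⟨hre, hflow, hwave⟩ q r s _ hs => ?_⟩
  · have hinv' (q : Jet0) (r : Fin 3 → ℂ × ℝ) :=
      have ⟨_, hs⟩ := exists_isSolutionJet ha q r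
      (isInvariantAt_gaugeField_iff hχ hh hs).1 (hinv q r _ (symmMatrix_comm _ _ _ _ _ _) hs)
    have hwave (x : Fin 3 → ℝ) : wave p h x = 0 := by
      simpa [psi_depEquiv, dirDeriv] using (hinv' (x, depEquiv (0, 0)) 0).2
    have hre' (x : Fin 3 → ℝ) : (deriv χ (x 2)).re = 0 := by
      simpa [psi_depEquiv, hwave, dirDeriv, hm] using (hinv' (x, depEquiv (1, 0)) 0).2
    have hre (x : Fin 3 → ℝ) : (χ (x 2)).re = 0 := by
      simpa [psi_depEquiv, hwave, hre', dirDeriv, hm] using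
        (hinv' (x, depEquiv (1, 0)) ![0, 0, (1, 0)]).2
    refine ⟨fun t => hre fun _ => t, fun x => ?_, hwave⟩
    have hreal := congrArg re (hinv' (x, depEquiv (1, 0)) 0).1
    simp only [psi_depEquiv, mul_one, add_re, mul_re, I_re, zero_mul, I_im, one_mul, zero_sub,
      ofReal_re, ofReal_im, mul_zero, sub_zero, hre, ofReal_zero, map_one, ofReal_one,
      zero_re] at hreal
    linarith
  · have hre' (t : ℝ) : (deriv χ t).re = 0 := by
      have hd := reCLM.hasFDerivAt.comp_hasDerivAt t (hχ.differentiable (by simp) t).hasDerivAt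
      have hzero : reCLM ∘ χ = fun _ => 0 := funext hre
      rw [hzero] at hd
      exact hd.unique (hasDerivAt_const t 0)
    rw [isInvariantAt_gaugeField_iff hχ hh hs, hre, hre', hwave]
    refine ⟨?_, by simp⟩
    rw [← ofReal_mul, hflow, ← re_add_im (deriv χ _), hre']
    simp [← mul_assoc, mul_right_comm I, I_mul_I]

end

end GaugeField

section InvariantWave

variable {p : Params}

theorem wave_add (p : Params) {f g : (Fin 3 → ℝ) → ℝ} (hf : ContDiff ℝ 2 f)
    (hg : ContDiff ℝ 2 g) (x : Fin 3 → ℝ) : wave p (f + g) x = wave p f x + wave p g x := by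
  simp only [wave, waveOp, hess_add hf hg, add_apply]
  ring

/-- The function `θ(t)/(m w) + κ x²/w`, the `φ`-component that compensates the change of gauge
`ψ ↦ exp(i θ(t)) ψ` when `κ = θ''/2`. -/
def gaugeShift (p : Params) (θ : ℝ → ℝ) (κ : ℝ) (x : Fin 3 → ℝ) : ℝ :=
  θ (x 2) / (p.m * p.w) + κ * x 0 ^ 2 / p.w

theorem contDiff_gaugeShift {θ : ℝ → ℝ} (hθ : ContDiff ℝ ∞ θ) (κ : ℝ) :
    ContDiff ℝ ∞ (gaugeShift p θ κ) := by
  unfold gaugeShift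
  fun_prop

theorem gaugeShift_eq (p : Params) (θ : ℝ → ℝ) (κ : ℝ) : gaugeShift p θ κ =
    (fun x => (fun t => θ t / (p.m * p.w)) (ContinuousLinearMap.proj (R := ℝ) 2 x)) +
      fun x => (fun s => 0 + 0 * s + κ / p.w * s ^ 2) (ContinuousLinearMap.proj (R := ℝ) 0 x) := by
  ext x
  simp only [gaugeShift, Pi.add_apply, ContinuousLinearMap.proj_apply]
  ring

theorem fderiv_gaugeShift {θ : ℝ → ℝ} (hθ : Differentiable ℝ θ) (κ : ℝ) (x v : Fin 3 → ℝ) :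
    fderiv ℝ (gaugeShift p θ κ) x v
      = deriv θ (x 2) / (p.m * p.w) * v 2 + 2 * (κ / p.w) * x 0 * v 0 := by
  rw [gaugeShift_eq, fderiv_add (by simp only [ContinuousLinearMap.proj_apply]; fun_prop)
    (by fun_prop), add_apply, fderiv_comp_functional (hθ.div_const _),
    fderiv_comp_functional (g := fun s => 0 + 0 * s + κ / p.w * s ^ 2) (by fun_prop),
    deriv_div_const, deriv_quadratic, zero_add]
  rfl

theorem hess_gaugeShift {θ : ℝ → ℝ} (hθ : ContDiff ℝ 2 θ) (κ : ℝ) (x v w : Fin 3 → ℝ) :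
    hess (gaugeShift p θ κ) x v w
      = deriv (deriv θ) (x 2) / (p.m * p.w) * v 2 * w 2 + 2 * (κ / p.w) * v 0 * w 0 := by
  rw [gaugeShift_eq, hess_add (by simp only [ContinuousLinearMap.proj_apply]; fun_prop)
    (by fun_prop), add_apply, add_apply, hess_comp_functional (hθ.div_const _),
    hess_comp_functional (g := fun s => 0 + 0 * s + κ / p.w * s ^ 2) (by fun_prop)]
  simp [funext fun t => deriv_div_const (c := θ) (x := t) (p.m * p.w), mul_comm (2 : ℝ)]

theorem mul_fderiv_gaugeShift_flowDir (hm : p.m ≠ 0) (hw : p.w ≠ 0) {θ : ℝ → ℝ}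
    (hθ : Differentiable ℝ θ) (κ : ℝ) (x : Fin 3 → ℝ) :
    p.w * fderiv ℝ (gaugeShift p θ κ) x (flowDir p) = deriv θ (x 2) := by
  rw [fderiv_gaugeShift hθ]
  simp only [flowDir, Matrix.cons_val, Matrix.cons_val_zero, mul_zero, add_zero]
  field_simp

theorem wave_gaugeShift (hm : p.m ≠ 0) {θ : ℝ → ℝ} (hθ : ContDiff ℝ 2 θ) (κ : ℝ)
    (x : Fin 3 → ℝ) :
    wave p (gaugeShift p θ κ) x = (2 * κ - deriv (deriv θ) (x 2)) / p.w := by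
  simp only [wave, waveOp, hess_gaugeShift hθ, ne_eq, Fin.reduceEq, not_false_eq_true,
    Pi.single_eq_of_ne, mul_zero, Pi.single_eq_same, mul_one, zero_add, zero_ne_one, add_zero,
    sub_zero]
  field_simp

/-- A solution of the wave equation `K_xx + (1 - m c²) K_yy - m K_tt - 2 m c K_yt = 0` that is
constant along the transport direction, hence a function of `x` and `m y - (m c - d) t` only. -/
structure IsInvariantWave (p : Params) (K : (Fin 3 → ℝ) → ℝ) : Prop where
  contDiff : ContDiff ℝ ∞ K
  fderiv_flowDir : ∀ x, fderiv ℝ K x (flowDir p) = 0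
  wave : ∀ x, wave p K x = 0

theorem mul_wave_of_fderiv_flowDir {K : (Fin 3 → ℝ) → ℝ} (hK : ContDiff ℝ 2 K)
    (hflow : ∀ x, fderiv ℝ K x (flowDir p) = 0) (x : Fin 3 → ℝ) :
    p.m * wave p K x = p.m * hess K x (Pi.single 0 1) (Pi.single 0 1)
      + (p.m - p.d ^ 2) * hess K x (Pi.single 1 1) (Pi.single 1 1) := by
  have hflow' (v : Fin 3 → ℝ) : (p.m * p.c - p.d) * hess K x v (Pi.single 1 1)
      + p.m * hess K x v (Pi.single 2 1) = 0 := by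
    have h := hess_eq_zero_of_fderiv_apply_eq_zero hK hflow x v
    rw [eq_sum_single (flowDir p)] at h
    simpa [flowDir] using h
  have hcomm := hess_comm hK x (Pi.single 2 1) (Pi.single 1 1)
  simp only [wave, waveOp]
  linear_combination -p.m * hflow' (Pi.single 2 1) + (-p.m * p.c - p.d) * hflow' (Pi.single 1 1)
    - p.m * (p.m * p.c + p.d) * hcomm

theorem isInvariantWave_iff (hm : p.m ≠ 0) {K : (Fin 3 → ℝ) → ℝ} : IsInvariantWave p K ↔
    ContDiff ℝ ∞ K ∧ (∀ x, fderiv ℝ K x (flowDir p) = 0) ∧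
      ∀ x, p.m * hess K x (Pi.single 0 1) (Pi.single 0 1)
        + (p.m - p.d ^ 2) * hess K x (Pi.single 1 1) (Pi.single 1 1) = 0 := by
  refine ⟨fun h => ⟨h.contDiff, h.fderiv_flowDir, fun x => ?_⟩, fun ⟨hK, hflow, hwave⟩ =>
    ⟨hK, hflow, fun x => mul_left_cancel₀ hm ?_⟩⟩
  · rw [← mul_wave_of_fderiv_flowDir (contDiff_two_of_contDiff_infty h.contDiff) h.fderiv_flowDir,
      h.wave, mul_zero]
  · rw [mul_wave_of_fderiv_flowDir (contDiff_two_of_contDiff_infty hK) hflow, hwave, mul_zero]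

/-- Subtracting `θ(t)/(m w)` from `h` makes it constant along the transport direction, while the
wave operator takes the difference to `θ''(t)/w`. As `t` varies along the transport direction, `θ''`
is constant. -/
theorem eq_quadratic_of_flow_of_wave (hm : p.m ≠ 0) (hw : p.w ≠ 0) {θ : ℝ → ℝ}
    {h : (Fin 3 → ℝ) → ℝ} (hθ : ContDiff ℝ ∞ θ) (hh : ContDiff ℝ ∞ h)
    (hflow : ∀ x, p.w * fderiv ℝ h x (flowDir p) = deriv θ (x 2)) (hwave : ∀ x, wave p h x = 0)
    (t : ℝ) : θ t = θ 0 + deriv θ 0 * t + deriv (deriv θ) 0 / 2 * t ^ 2 := by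
  have hθ₂ := contDiff_two_of_contDiff_infty hθ
  have hs := contDiff_gaugeShift (p := p) hθ 0
  set K := h - gaugeShift p θ 0 with hK
  have hK₂ : ContDiff ℝ ∞ K := hh.sub hs
  have hKflow (x : Fin 3 → ℝ) : fderiv ℝ K x (flowDir p) = 0 := by
    refine mul_left_cancel₀ hw ?_
    rw [hK, fderiv_sub (hh.differentiable (by simp) x) (hs.differentiable (by simp) x), sub_apply,
      mul_sub, hflow, mul_fderiv_gaugeShift_flowDir hm hw (hθ.differentiable (by simp)), sub_self,
      mul_zero]
  have hKwave (x : Fin 3 → ℝ) : wave p K x = deriv (deriv θ) (x 2) / p.w := by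
    have hsum := wave_add p (contDiff_two_of_contDiff_infty hK₂)
      (contDiff_two_of_contDiff_infty hs) x
    rw [hK, sub_add_cancel, hwave, wave_gaugeShift hm hθ₂] at hsum
    linear_combination -hsum
  refine eq_quadratic_of_deriv_deriv_eq hθ₂ (fun t => ?_) t
  have hshift : wave p K (0 + (t / p.m) • flowDir p) = wave p K 0 := by
    simp only [wave, hess_add_of_fderiv_eq_zero (hK₂.differentiable (by simp))
      (l := (t / p.m) • flowDir p) fun x => by rw [map_smul, hKflow, smul_zero]]
  rw [hKwave, hKwave, div_left_inj' hw] at hshift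
  simpa [flowDir, hm] using hshift

/-- The coefficient of `-v ∂_u + u ∂_v` in `∑ kᵢ Xᵢ`. -/
def phase (k : Fin 6 → ℝ) (t : ℝ) : ℝ := k 3 + k 4 * t + k 5 * t ^ 2

theorem contDiff_phase (k : Fin 6 → ℝ) : ContDiff ℝ ∞ (phase k) := by
  unfold phase
  fun_prop

theorem deriv_phase (k : Fin 6 → ℝ) (t : ℝ) : deriv (phase k) t = k 4 + 2 * k 5 * t :=
  deriv_quadratic _ _ _ t

theorem deriv_deriv_phase (k : Fin 6 → ℝ) (t : ℝ) : deriv (deriv (phase k)) t = 2 * k 5 := by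
  simp [funext (deriv_phase k)]

theorem wave_gaugeShift_phase (hm : p.m ≠ 0) (k : Fin 6 → ℝ) (x : Fin 3 → ℝ) :
    wave p (gaugeShift p (phase k) (k 5)) x = 0 := by
  rw [wave_gaugeShift hm (contDiff_two_of_contDiff_infty (contDiff_phase k)), deriv_deriv_phase,
    sub_self, zero_div]

theorem sum_X_add_vert (p : Params) (k : Fin 6 → ℝ) (K : (Fin 3 → ℝ) → ℝ) :
    (∑ i, k i • X p i) + vert (fun q => K q.1) = gaugeField ![k 1, k 2, k 0]
      (fun t => phase k t * Complex.I) (gaugeShift p (phase k) (k 5) + K) := by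
  ext q i
  · fin_cases i <;> simp [Fin.sum_univ_six, X, X₁, X₂, X₃, X₄, X₅, X₆, rot, vert, gaugeField]
  · fin_cases i <;>
      simp [Fin.sum_univ_six, X, X₁, X₂, X₃, X₄, X₅, X₆, rot, vert, gaugeField, phase, gaugeShift,
        depEquiv_apply, psi, sq] <;> ring

theorem deriv_im {χ : ℝ → ℂ} (hχ : Differentiable ℝ χ) (t : ℝ) :
    deriv (fun t => (χ t).im) t = (deriv χ t).im :=
  (Complex.imCLM.hasFDerivAt.comp_hasDerivAt t (hχ t).hasDerivAt).deriv

theorem isLieSymmetry_sum_X_add_vert_iff (ha : p.a ≠ 0) (hm : p.m ≠ 0) (hw : p.w ≠ 0)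
    (k : Fin 6 → ℝ) {K : (Fin 3 → ℝ) → ℝ} (hK : ContDiff ℝ ∞ K) :
    IsLieSymmetry p ((∑ i, k i • X p i) + vert fun q => K q.1) ↔ IsInvariantWave p K := by
  have hphase := contDiff_phase k
  have hs := contDiff_gaugeShift (p := p) hphase (k 5)
  have hχ : ContDiff ℝ ∞ fun t => (phase k t * Complex.I : ℂ) :=
    (Complex.ofRealCLM.contDiff.comp hphase).mul contDiff_const
  have him (t : ℝ) : (deriv (fun t => (phase k t * Complex.I : ℂ)) t).im = deriv (phase k) t := by
    rw [← deriv_im (hχ.differentiable (by simp))]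
    simp
  have hflow (x : Fin 3 → ℝ) : p.w * fderiv ℝ (gaugeShift p (phase k) (k 5) + K) x (flowDir p)
      = deriv (phase k) (x 2) + p.w * fderiv ℝ K x (flowDir p) := by
    rw [fderiv_add (hs.differentiable (by simp) x) (hK.differentiable (by simp) x), add_apply,
      mul_add, mul_fderiv_gaugeShift_flowDir hm hw (hphase.differentiable (by simp))]
  rw [sum_X_add_vert, isLieSymmetry_gaugeField_iff (h := _ + _) hχ (hs.add hK) ha hm]
  simp only [him, hflow, wave_add p (contDiff_two_of_contDiff_infty hs)
    (contDiff_two_of_contDiff_infty hK), wave_gaugeShift_phase hm, add_eq_left, zero_add,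
    mul_eq_zero, hw, false_or]
  exact ⟨fun h => ⟨hK, h.2.1, h.2.2⟩, fun h => ⟨by simp, h.fderiv_flowDir, h.wave⟩⟩

theorem mem_symmetryAlgebra_iff (ha : p.a ≠ 0) (hε : p.ε₀ ≠ 0) (hm : p.m ≠ 0) (hd : p.d ≠ 0)
    (hw : p.w ≠ 0) (V : Jet0 → Jet0) : V ∈ symmetryAlgebra p ↔
    ∃ (k : Fin 6 → ℝ) (K : (Fin 3 → ℝ) → ℝ), IsInvariantWave p K ∧
      V = (∑ i, k i • X p i) + vert (fun q => K q.1) := by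
  refine ⟨fun hV => ?_, ?_⟩
  · obtain ⟨ξ₀, χ, h, hχ, hh, rfl⟩ := IsLieSymmetry.exists_eq_gaugeField ha hε hm hd hw hV
    obtain ⟨hre, hflow, hwave⟩ := (isLieSymmetry_gaugeField_iff hχ hh ha hm).1 hV
    simp only [← deriv_im (hχ.differentiable (by simp))] at hflow
    set θ := fun t => (χ t).im
    have hθ : ContDiff ℝ ∞ θ := Complex.imCLM.contDiff.comp hχ
    set k := ![ξ₀ 2, ξ₀ 0, ξ₀ 1, θ 0, deriv θ 0, deriv (deriv θ) 0 / 2] with hk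
    have hphase (t : ℝ) : θ t = phase k t := eq_quadratic_of_flow_of_wave hm hw hθ hh hflow hwave t
    have hχθ (t : ℝ) : phase k t * Complex.I = χ t := by
      rw [← hphase]
      exact Complex.ext (by simp [hre]) (by simp [θ])
    have hKs := hh.sub (contDiff_gaugeShift (p := p) (contDiff_phase k) (k 5))
    have hV' : gaugeField ξ₀ χ h = (∑ i, k i • X p i)
        + vert fun q => (h - gaugeShift p (phase k) (k 5)) q.1 := by
      rw [sum_X_add_vert, add_sub_cancel]
      congr 1
      · ext i
        fin_cases i <;> rfl
      · exact funext fun t => (hχθ t).symm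
    refine ⟨k, _, (isLieSymmetry_sum_X_add_vert_iff ha hm hw k hKs).1 ?_, hV'⟩
    rwa [hV'] at hV
  · rintro ⟨k, K, hK, rfl⟩
    exact (isLieSymmetry_sum_X_add_vert_iff ha hm hw k hK.contDiff).2 hK

end InvariantWave

section Bracket

variable {p : Params}

theorem vert_eq_gaugeField (K : (Fin 3 → ℝ) → ℝ) :
    vert (fun q => K q.1) = gaugeField 0 (fun _ => 0) K := by
  ext q i
  · rfl
  · fin_cases i <;> simp [vert, gaugeField, depEquiv_apply]

theorem vert_add (f g : Jet0 → ℝ) : vert f + vert g = vert (fun q => f q + g q) := by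
  ext q i <;> fin_cases i <;> simp [vert]

theorem smul_vert (r : ℝ) (f : Jet0 → ℝ) : r • vert f = vert (fun q => r * f q) := by
  ext q i <;> fin_cases i <;> simp [vert]

theorem vert_zero : vert (fun _ => 0) = 0 := by
  ext q i <;> fin_cases i <;> simp [vert]

/-- The commutator of the constant vector field `v` with `gaugeField ξ₀ χ h`, for any `ξ₀`. -/
def gaugeDeriv (v : Fin 3 → ℝ) (χ : ℝ → ℂ) (h : (Fin 3 → ℝ) → ℝ) : Jet0 → Jet0 :=
  gaugeField 0 (fun t => v 2 * deriv χ t) fun x => fderiv ℝ h x v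

theorem gaugeDeriv_zero (χ : ℝ → ℂ) (h : (Fin 3 → ℝ) → ℝ) : gaugeDeriv 0 χ h = 0 := by
  ext q i <;> fin_cases i <;> simp [gaugeDeriv, gaugeField, depEquiv_apply]

theorem gaugeDeriv_const_zero (v : Fin 3 → ℝ) (K : (Fin 3 → ℝ) → ℝ) :
    gaugeDeriv v (fun _ => 0) K = vert fun q => fderiv ℝ K q.1 v := by
  simp [gaugeDeriv, vert_eq_gaugeField fun x => fderiv ℝ K x v]

theorem gaugeDeriv_phase (p : Params) (v : Fin 3 → ℝ) (k : Fin 6 → ℝ) :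
    gaugeDeriv v (fun t => phase k t * Complex.I) (gaugeShift p (phase k) (k 5)) =
      v 2 • (k 4 • X₄ p + (2 * k 5) • X₅ p)
        + (v 0 * k 5) • vert fun q => 2 * q.1 0 / p.w := by
  have hphase := (contDiff_phase k).differentiable (by simp)
  have hderiv (t : ℝ) : deriv (fun t => (phase k t * Complex.I : ℂ)) t
      = (k 4 + 2 * k 5 * t : ℝ) * Complex.I := by
    rw [← deriv_phase]
    exact ((hphase t).hasDerivAt.ofReal_comp.mul_const _).deriv
  ext q i
  · simp [gaugeDeriv, gaugeField, X₄, X₅, rot, vert]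
  · simp only [gaugeDeriv, hderiv, fderiv_gaugeShift hphase, deriv_phase]
    fin_cases i <;> simp [gaugeField, depEquiv_apply, psi, X₄, X₅, rot, vert] <;> ring

theorem fderiv_gaugeField {ξ₀ : Fin 3 → ℝ} {χ : ℝ → ℂ} {h : (Fin 3 → ℝ) → ℝ}
    (hχ : ContDiff ℝ ∞ χ) (hh : ContDiff ℝ ∞ h) (q v : Jet0) :
    fderiv ℝ (gaugeField ξ₀ χ h) q v = vertical
      (v.1 2 * (deriv χ (q.1 2) * psi q) + χ (q.1 2) * psi v, fderiv ℝ h q.1 v.1) := by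
  have hη := (contDiff_η (contDiff_gaugeField (ξ₀ := ξ₀) hχ hh)).differentiable (by simp)
  have heq : gaugeField ξ₀ χ h = fun q => (ξ₀, 0) + vertical (η (gaugeField ξ₀ χ h) q) := by
    simp [η_gaugeField, vertical_apply, funext_iff, gaugeField]
  rw [heq, fderiv_const_add, fderiv_clm_comp hη, ContinuousLinearMap.comp_apply,
    fderiv_η_gaugeField hχ hh]

theorem lieBracket_gaugeField {ξ₀ ξ₁ : Fin 3 → ℝ} {χ₀ χ₁ : ℝ → ℂ} {h₀ h₁ : (Fin 3 → ℝ) → ℝ}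
    (hχ₀ : ContDiff ℝ ∞ χ₀) (hh₀ : ContDiff ℝ ∞ h₀) (hχ₁ : ContDiff ℝ ∞ χ₁)
    (hh₁ : ContDiff ℝ ∞ h₁) : lieBracket ℝ (gaugeField ξ₀ χ₀ h₀) (gaugeField ξ₁ χ₁ h₁) =
      gaugeDeriv ξ₀ χ₁ h₁ - gaugeDeriv ξ₁ χ₀ h₀ := by
  ext1 q
  rw [lieBracket, fderiv_gaugeField hχ₀ hh₀, fderiv_gaugeField hχ₁ hh₁, ← map_sub]
  simp only [gaugeField, psi_depEquiv, gaugeDeriv, Pi.sub_apply, vertical_apply, Prod.mk_sub_mk,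
    sub_zero, ← map_sub]
  ring_nf

section Derivative

variable {h : (Fin 3 → ℝ) → ℝ} (hh : ContDiff ℝ ∞ h)

include hh

theorem contDiff_fderiv_apply (v : Fin 3 → ℝ) : ContDiff ℝ ∞ fun x => fderiv ℝ h x v :=
  (hh.fderiv_right (m := ∞) (by simp)).clm_apply contDiff_const

theorem hess_fderiv_apply (u x v w : Fin 3 → ℝ) :
    hess (fun x => fderiv ℝ h x u) x v w = fderiv ℝ (fun x => hess h x v w) x u := by
  have hh₂ := contDiff_two_of_contDiff_infty hh
  have hderiv (v : Fin 3 → ℝ) := contDiff_two_of_contDiff_infty (contDiff_fderiv_apply hh v)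
  have hcomm : (fun x => fderiv ℝ (fun x => fderiv ℝ h x u) x w)
      = fun x => fderiv ℝ (fun x => fderiv ℝ h x w) x u := funext fun x => by
    rw [fderiv_fderiv_apply hh₂, fderiv_fderiv_apply hh₂, hess_comm hh₂]
  simp only [← fderiv_fderiv_apply hh₂ _ v w]
  rw [← fderiv_fderiv_apply (hderiv u), hcomm, fderiv_fderiv_apply (hderiv w),
    fderiv_fderiv_apply (hderiv w), hess_comm (hderiv w)]

theorem wave_fderiv_apply (p : Params) (v x : Fin 3 → ℝ) :
    wave p (fun x => fderiv ℝ h x v) x = fderiv ℝ (wave p h) x v := by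
  have hhess (u w : Fin 3 → ℝ) : HasFDerivAt (fun x => hess h x u w) _ x :=
    ((contDiff_fderiv_apply (contDiff_fderiv_apply hh w) u).differentiable (by simp) x
      |>.congr_of_eventuallyEq (.of_forall fun x =>
        (fderiv_fderiv_apply (contDiff_two_of_contDiff_infty hh) x u w).symm)).hasFDerivAt
  have hwave := (((hhess (Pi.single 0 1) (Pi.single 0 1)).fun_add
    ((hhess (Pi.single 1 1) (Pi.single 1 1)).const_mul (1 - p.m * p.c ^ 2))).fun_sub
    ((hhess (Pi.single 2 1) (Pi.single 2 1)).const_mul p.m)).fun_sub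
    ((hhess (Pi.single 2 1) (Pi.single 1 1)).const_mul (2 * p.m * p.c))
  refine Eq.trans ?_ (DFunLike.congr_fun hwave.fderiv v).symm
  simp [wave, waveOp, hess_fderiv_apply hh]

end Derivative

theorem isLieSymmetry_gaugeDeriv (ha : p.a ≠ 0) (hm : p.m ≠ 0) {ξ₀ : Fin 3 → ℝ} {χ : ℝ → ℂ}
    {h : (Fin 3 → ℝ) → ℝ} (hχ : ContDiff ℝ ∞ χ) (hh : ContDiff ℝ ∞ h)
    (hsymm : IsLieSymmetry p (gaugeField ξ₀ χ h)) (v : Fin 3 → ℝ) :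
    IsLieSymmetry p (gaugeDeriv v χ h) := by
  obtain ⟨hre, hflow, hwave⟩ := (isLieSymmetry_gaugeField_iff hχ hh ha hm).1 hsymm
  have hχ' : ContDiff ℝ ∞ (deriv χ) := ContDiff.iterate_deriv 1 hχ
  refine (isLieSymmetry_gaugeField_iff (contDiff_const.mul hχ') (contDiff_fderiv_apply hh v)
    ha hm).2 ⟨fun t => ?_, fun x => ?_, fun x => ?_⟩
  · have hre' : (deriv χ t).re = deriv (fun t => (χ t).re) t :=
      (Complex.reCLM.hasFDerivAt.comp_hasDerivAt t
        (hχ.differentiable (by simp) t).hasDerivAt).deriv.symm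
    simp [hre', hre]
  · have him : Differentiable ℝ fun t => (deriv χ t).im :=
      Complex.imCLM.differentiable.comp (hχ'.differentiable (by simp))
    have hh₂ := contDiff_two_of_contDiff_infty hh
    have htime := fderiv_comp_functional him (.proj 2 : (Fin 3 → ℝ) →L[ℝ] ℝ) x v
    simp only [ContinuousLinearMap.proj_apply, ← hflow] at htime
    rw [fderiv_const_mul ((contDiff_fderiv_apply hh _).differentiable (by simp) x), smul_apply,
      smul_eq_mul, fderiv_fderiv_apply hh₂, hess_comm hh₂, ← fderiv_fderiv_apply hh₂] at htime
    rw [htime, deriv_im (hχ'.differentiable (by simp)), deriv_const_mul_field]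
    simp [mul_comm]
  · rw [wave_fderiv_apply hh, funext hwave]
    simp

theorem lieBracket_mem_symmetryAlgebra (ha : p.a ≠ 0) (hε : p.ε₀ ≠ 0) (hm : p.m ≠ 0)
    (hd : p.d ≠ 0) (hw : p.w ≠ 0) {V W : Jet0 → Jet0} (hV : V ∈ symmetryAlgebra p)
    (hW : W ∈ symmetryAlgebra p) : lieBracket ℝ V W ∈ symmetryAlgebra p := by
  obtain ⟨ξ₀, χ₀, h₀, hχ₀, hh₀, rfl⟩ := IsLieSymmetry.exists_eq_gaugeField ha hε hm hd hw hV
  obtain ⟨ξ₁, χ₁, h₁, hχ₁, hh₁, rfl⟩ := IsLieSymmetry.exists_eq_gaugeField ha hε hm hd hw hW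
  rw [lieBracket_gaugeField hχ₀ hh₀ hχ₁ hh₁]
  exact sub_mem (isLieSymmetry_gaugeDeriv ha hm hχ₁ hh₁ hW ξ₀)
    (isLieSymmetry_gaugeDeriv ha hm hχ₀ hh₀ hV ξ₁)

/-- The components of `Xᵢ` along `(x, y, t)`. -/
def baseDir : Fin 6 → Fin 3 → ℝ := ![Pi.single 2 1, Pi.single 0 1, Pi.single 1 1, 0, 0, 0]

theorem X_eq_gaugeField (p : Params) (i : Fin 6) : X p i = gaugeField (baseDir i)
    (fun t => phase (Pi.single i 1) t * Complex.I)
    (gaugeShift p (phase (Pi.single i 1)) (Pi.single (M := fun _ => ℝ) i 1 5)) := by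
  have hdir : ![(Pi.single i 1 : Fin 6 → ℝ) 1, (Pi.single i 1 : Fin 6 → ℝ) 2,
      (Pi.single i 1 : Fin 6 → ℝ) 0] = baseDir i := by
    ext j
    fin_cases i <;> fin_cases j <;> simp [baseDir]
  have hsum := sum_X_add_vert p (Pi.single i 1) fun _ => 0
  rw [vert_zero, add_zero, hdir] at hsum
  have hzero (f : (Fin 3 → ℝ) → ℝ) : (f + fun _ => 0) = f := add_zero f
  rw [hzero] at hsum
  simpa [Pi.single_apply] using hsum

theorem contDiff_phase_mul_I (k : Fin 6 → ℝ) : ContDiff ℝ ∞ fun t => (phase k t * Complex.I : ℂ) :=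
  (Complex.ofRealCLM.contDiff.comp (contDiff_phase k)).mul contDiff_const

theorem lieBracket_X (p : Params) (i j : Fin 6) : lieBracket ℝ (X p i) (X p j) =
    gaugeDeriv (baseDir i) (fun t => phase (Pi.single j 1) t * Complex.I)
        (gaugeShift p (phase (Pi.single j 1)) (Pi.single (M := fun _ => ℝ) j 1 5))
      - gaugeDeriv (baseDir j) (fun t => phase (Pi.single i 1) t * Complex.I)
        (gaugeShift p (phase (Pi.single i 1)) (Pi.single (M := fun _ => ℝ) i 1 5)) := by
  rw [X_eq_gaugeField, X_eq_gaugeField]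
  exact lieBracket_gaugeField (contDiff_phase_mul_I _) (contDiff_gaugeShift (contDiff_phase _) _)
    (contDiff_phase_mul_I _) (contDiff_gaugeShift (contDiff_phase _) _)

theorem lieBracket_X₁_X₅ (p : Params) : lieBracket ℝ X₁ (X₅ p) = X₄ p := by
  refine (lieBracket_X p 0 4).trans ?_
  rw [gaugeDeriv_phase, gaugeDeriv_phase]
  simp [baseDir]

theorem lieBracket_X₁_X₆ (p : Params) : lieBracket ℝ X₁ (X₆ p) = (2 : ℝ) • X₅ p := by
  refine (lieBracket_X p 0 5).trans ?_
  rw [gaugeDeriv_phase, gaugeDeriv_phase]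
  simp [baseDir]

theorem lieBracket_X₂_X₆ (p : Params) :
    lieBracket ℝ X₂ (X₆ p) = vert fun q => 2 * q.1 0 / p.w := by
  refine (lieBracket_X p 1 5).trans ?_
  rw [gaugeDeriv_phase, gaugeDeriv_phase]
  simp [baseDir]

theorem lieBracket_X_eq_zero (p : Params) (i j : Fin 6) (hij : i < j) (h₁₅ : (i, j) ≠ (0, 4))
    (h₁₆ : (i, j) ≠ (0, 5)) (h₂₆ : (i, j) ≠ (1, 5)) : lieBracket ℝ (X p i) (X p j) = 0 := by
  rw [lieBracket_X, gaugeDeriv_phase, gaugeDeriv_phase]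
  fin_cases i <;> fin_cases j <;> simp [baseDir] at hij h₁₅ h₁₆ h₂₆ ⊢

theorem lieBracket_X_vert (p : Params) (i : Fin 6) {K : (Fin 3 → ℝ) → ℝ} (hK : ContDiff ℝ ∞ K) :
    lieBracket ℝ (X p i) (vert fun q => K q.1) = vert fun q => fderiv ℝ K q.1 (baseDir i) := by
  rw [X_eq_gaugeField, vert_eq_gaugeField, lieBracket_gaugeField (contDiff_phase_mul_I _)
    (contDiff_gaugeShift (contDiff_phase _) _) contDiff_const hK, gaugeDeriv_zero, sub_zero,
    gaugeDeriv_const_zero]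

theorem lieBracket_X_vert_eq_zero (p : Params) {i : Fin 6} (hi : 3 ≤ i) {K : (Fin 3 → ℝ) → ℝ}
    (hK : ContDiff ℝ ∞ K) : lieBracket ℝ (X p i) (vert fun q => K q.1) = 0 := by
  have hdir : baseDir i = 0 := by
    fin_cases i <;> first | rfl | exact absurd hi (by decide)
  simp [lieBracket_X_vert p i hK, hdir, vert_zero]

theorem lieBracket_vert_vert {K L : (Fin 3 → ℝ) → ℝ} (hK : ContDiff ℝ ∞ K)
    (hL : ContDiff ℝ ∞ L) : lieBracket ℝ (vert fun q => K q.1) (vert fun q => L q.1) = 0 := by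
  rw [vert_eq_gaugeField, vert_eq_gaugeField, lieBracket_gaugeField contDiff_const hK
    contDiff_const hL, gaugeDeriv_zero, gaugeDeriv_zero, sub_zero]

theorem sum_X_add_vert_eq_zero_iff (p : Params) (k : Fin 6 → ℝ) (K : (Fin 3 → ℝ) → ℝ) :
    (∑ i, k i • X p i) + vert (fun q => K q.1) = 0 ↔ k = 0 ∧ K = 0 := by
  refine ⟨fun h => ?_, ?_⟩
  · rw [sum_X_add_vert] at h
    have hbase (i : Fin 3) : ![k 1, k 2, k 0] i = 0 :=
      congrFun (congrArg Prod.fst (congrFun h 0)) i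
    have hdep (x : Fin 3 → ℝ) :
        (phase k (x 2) * Complex.I * 1, (gaugeShift p (phase k) (k 5) + K) x) = 0 :=
      depEquiv.map_eq_zero_iff.1 (congrArg Prod.snd (congrFun h (x, depEquiv (1, 0))))
    have hphase (t : ℝ) : phase k t = 0 := by
      simpa using congrArg Prod.fst (hdep fun _ => t)
    have h₀ := hphase 0
    have h₁ := hphase 1
    have h₂ := hphase (-1)
    simp only [phase] at h₀ h₁ h₂
    have hk : k = 0 := by
      ext i
      fin_cases i
      exacts [hbase 2, hbase 0, hbase 1, (by linarith : k 3 = 0), (by linarith : k 4 = 0),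
        (by linarith : k 5 = 0)]
    refine ⟨hk, funext fun x => ?_⟩
    simpa [hk, gaugeShift, phase] using congrArg Prod.snd (hdep x)
  · rintro ⟨rfl, rfl⟩
    simpa using vert_zero

end Bracket

section Plane

variable {p : Params}

/-- The coordinates `(x, ζ)`, `ζ = m y - (m c - d) t`, on the quotient of the space of the
variables `(x, y, t)` by the transport direction. -/
def planeCoords (p : Params) : (Fin 3 → ℝ) →L[ℝ] ℝ × ℝ :=
  .prod (.proj 0) (p.m • .proj 1 - (p.m * p.c - p.d) • .proj 2)

/-- The section of `planeCoords` with values in the plane `t = 0`. -/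
def planeSection (p : Params) : ℝ × ℝ →L[ℝ] Fin 3 → ℝ :=
  (ContinuousLinearMap.fst ℝ ℝ ℝ).smulRight (Pi.single 0 1)
    + (ContinuousLinearMap.snd ℝ ℝ ℝ).smulRight (p.m⁻¹ • Pi.single 1 1)

theorem planeCoords_apply (p : Params) (x : Fin 3 → ℝ) :
    planeCoords p x = (x 0, p.m * x 1 - (p.m * p.c - p.d) * x 2) := rfl

theorem planeSection_apply (p : Params) (z : ℝ × ℝ) : planeSection p z
    = z.1 • Pi.single 0 1 + z.2 • p.m⁻¹ • Pi.single 1 1 := rfl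

theorem planeCoords_flowDir (p : Params) : planeCoords p (flowDir p) = 0 := by
  simp [planeCoords_apply, flowDir, mul_comm]

theorem planeCoords_planeSection (hm : p.m ≠ 0) (z : ℝ × ℝ) :
    planeCoords p (planeSection p z) = z := by
  simp [planeCoords_apply, planeSection_apply, mul_left_comm, hm]

theorem eq_planeSection_add_flowDir (hm : p.m ≠ 0) (x : Fin 3 → ℝ) :
    x = planeSection p (planeCoords p x) + (x 2 / p.m) • flowDir p := by
  ext i
  fin_cases i <;> simp [planeCoords_apply, planeSection_apply, flowDir, hm]
  field_simp
  ring

/-- The differential operator `∂²/∂x² + κ ∂²/∂ζ²` in the plane. -/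
def planeOp (κ : ℝ) (h : ℝ × ℝ → ℝ) (z : ℝ × ℝ) : ℝ :=
  hess h z (1, 0) (1, 0) + κ * hess h z (0, 1) (0, 1)

/-- A smooth solution of `h_xx + κ h_ζζ = 0` in the plane. -/
def IsPlaneSolution (κ : ℝ) (h : ℝ × ℝ → ℝ) : Prop :=
  ContDiff ℝ ∞ h ∧ ∀ z, planeOp κ h z = 0

theorem isInvariantWave_comp_planeCoords_iff (hm : p.m ≠ 0) {h : ℝ × ℝ → ℝ}
    (hh : ContDiff ℝ ∞ h) : IsInvariantWave p (fun x => h (planeCoords p x)) ↔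
      IsPlaneSolution (p.m * (p.m - p.d ^ 2)) h := by
  have hx : planeCoords p (Pi.single 0 1) = (1, 0) := by simp [planeCoords_apply]
  have hy : planeCoords p (Pi.single 1 1) = p.m • (0, 1) := by simp [planeCoords_apply]
  have hop (z : ℝ × ℝ) : p.m * hess h z (1, 0) (1, 0)
      + (p.m - p.d ^ 2) * (p.m * (p.m * hess h z (0, 1) (0, 1)))
      = p.m * planeOp (p.m * (p.m - p.d ^ 2)) h z := by
    rw [planeOp]
    ring
  have hflow (x : Fin 3 → ℝ) :
      fderiv ℝ (fun x => h (planeCoords p x)) x (flowDir p) = 0 := by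
    rw [fderiv_comp_clm (hh.differentiable (by simp)), ContinuousLinearMap.comp_apply,
      planeCoords_flowDir, map_zero]
  have hcomp : ContDiff ℝ ∞ fun x => h (planeCoords p x) := hh.comp (planeCoords p).contDiff
  simp only [isInvariantWave_iff hm, hcomp, hflow,
    hess_comp_clm (contDiff_two_of_contDiff_infty hh), hx, hy, map_smul, smul_apply, smul_eq_mul,
    hop, mul_eq_zero, hm, false_or, implies_true, true_and, IsPlaneSolution, hh]
  exact ⟨fun hop z => planeCoords_planeSection hm z ▸ hop (planeSection p z), fun hop x => hop _⟩

theorem IsInvariantWave.eq_comp_planeCoords (hm : p.m ≠ 0) {K : (Fin 3 → ℝ) → ℝ}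
    (hK : IsInvariantWave p K) : K = fun x => K (planeSection p (planeCoords p x)) := by
  ext x
  nth_rw 1 [eq_planeSection_add_flowDir hm x]
  exact apply_add_of_fderiv_eq_zero (hK.contDiff.differentiable (by simp))
    (fun x => by rw [map_smul, hK.fderiv_flowDir, smul_zero]) _

/-- The vector field `h(x, ζ) ∂_φ`. -/
def planeVert (p : Params) (h : ℝ × ℝ → ℝ) : Jet0 → Jet0 :=
  vert fun q => h (planeCoords p q.1)

theorem planeVert_add (p : Params) (g h : ℝ × ℝ → ℝ) :
    planeVert p g + planeVert p h = planeVert p (g + h) :=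
  vert_add _ _

theorem smul_planeVert (p : Params) (r : ℝ) (h : ℝ × ℝ → ℝ) :
    r • planeVert p h = planeVert p (r • h) :=
  smul_vert _ _

theorem mem_symmetryAlgebra_iff_planeVert (ha : p.a ≠ 0) (hε : p.ε₀ ≠ 0) (hm : p.m ≠ 0)
    (hd : p.d ≠ 0) (hw : p.w ≠ 0) (V : Jet0 → Jet0) :
    V ∈ symmetryAlgebra p ↔ ∃ (k : Fin 6 → ℝ) (h : ℝ × ℝ → ℝ),
      IsPlaneSolution (p.m * (p.m - p.d ^ 2)) h ∧ V = (∑ i, k i • X p i) + planeVert p h := by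
  rw [mem_symmetryAlgebra_iff ha hε hm hd hw]
  constructor
  · rintro ⟨k, K, hK, rfl⟩
    have hKeq := hK.eq_comp_planeCoords hm
    have hsec : ContDiff ℝ ∞ fun z => K (planeSection p z) :=
      hK.contDiff.comp (planeSection p).contDiff
    refine ⟨k, fun z => K (planeSection p z),
      (isInvariantWave_comp_planeCoords_iff hm hsec).1 (hKeq ▸ hK), ?_⟩
    exact congrArg (fun K => (∑ i, k i • X p i) + vert fun q => K q.1) hKeq
  · rintro ⟨k, h, hh, rfl⟩
    exact ⟨k, _, (isInvariantWave_comp_planeCoords_iff hm hh.1).2 hh, rfl⟩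

theorem sum_X_add_planeVert_eq_zero_iff (hm : p.m ≠ 0) (k : Fin 6 → ℝ) (h : ℝ × ℝ → ℝ) :
    (∑ i, k i • X p i) + planeVert p h = 0 ↔ k = 0 ∧ h = 0 := by
  refine (sum_X_add_vert_eq_zero_iff p k fun x => h (planeCoords p x)).trans
    (and_congr_right fun _ => ⟨fun hK => funext fun z => ?_, ?_⟩)
  · simpa [planeCoords_planeSection hm] using congrFun hK (planeSection p z)
  · rintro rfl
    rfl

theorem lieBracket_X₂_X₆_eq_planeVert (p : Params) :
    lieBracket ℝ X₂ (X₆ p) = planeVert p fun z => 2 * z.1 / p.w :=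
  lieBracket_X₂_X₆ p

section Bracket

variable (p) {g h : ℝ × ℝ → ℝ} (hg : ContDiff ℝ ∞ g) (hh : ContDiff ℝ ∞ h)

include hh

theorem lieBracket_X_planeVert (i : Fin 6) : lieBracket ℝ (X p i) (planeVert p h)
    = planeVert p fun z => fderiv ℝ h z (planeCoords p (baseDir i)) := by
  refine (lieBracket_X_vert p i (K := fun x => h (planeCoords p x))
    (hh.comp (planeCoords p).contDiff)).trans ?_
  simp only [fderiv_comp_clm (hh.differentiable (by simp)), ContinuousLinearMap.comp_apply]
  rfl

theorem lieBracket_X₁_planeVert : lieBracket ℝ X₁ (planeVert p h)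
    = (p.d - p.m * p.c) • planeVert p fun z => fderiv ℝ h z (0, 1) := by
  have hdir : planeCoords p (baseDir 0) = (p.d - p.m * p.c) • (0, 1) := by
    simp [planeCoords_apply, baseDir]
  refine (lieBracket_X_planeVert p hh 0).trans ?_
  simp only [hdir, map_smul, smul_planeVert]
  rfl

theorem lieBracket_X₂_planeVert : lieBracket ℝ X₂ (planeVert p h)
    = planeVert p fun z => fderiv ℝ h z (1, 0) := by
  have hdir : planeCoords p (baseDir 1) = (1, 0) := by simp [planeCoords_apply, baseDir]
  refine (lieBracket_X_planeVert p hh 1).trans ?_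
  simp only [hdir]

theorem lieBracket_X₃_planeVert : lieBracket ℝ X₃ (planeVert p h)
    = p.m • planeVert p fun z => fderiv ℝ h z (0, 1) := by
  have hdir : planeCoords p (baseDir 2) = p.m • (0, 1) := by simp [planeCoords_apply, baseDir]
  refine (lieBracket_X_planeVert p hh 2).trans ?_
  simp only [hdir, map_smul, smul_planeVert]
  rfl

theorem lieBracket_X_planeVert_eq_zero (i : Fin 6) (hi : 3 ≤ i) :
    lieBracket ℝ (X p i) (planeVert p h) = 0 :=
  lieBracket_X_vert_eq_zero p hi (K := fun x => h (planeCoords p x))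
    (hh.comp (planeCoords p).contDiff)

include hg in
theorem lieBracket_planeVert_planeVert :
    lieBracket ℝ (planeVert p g) (planeVert p h) = 0 :=
  lieBracket_vert_vert (K := fun x => g (planeCoords p x)) (L := fun x => h (planeCoords p x))
    (hg.comp (planeCoords p).contDiff) (hh.comp (planeCoords p).contDiff)

end Bracket

section Complex

/-- The real-linear functional `μ x + ζ` with complex values. -/
def complexPhase (μ : ℂ) : ℝ × ℝ →L[ℝ] ℂ :=
  (ContinuousLinearMap.fst ℝ ℝ ℝ).smulRight μ + (ContinuousLinearMap.snd ℝ ℝ ℝ).smulRight 1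

theorem contDiff_re_aeval_complexPhase (μ : ℂ) (P : Polynomial ℝ) :
    ContDiff ℝ ∞ fun z => (Polynomial.aeval (complexPhase μ z) P).re :=
  Complex.reCLM.contDiff.comp ((contDiff_aeval P).comp (complexPhase μ).contDiff)

theorem planeOp_re_aeval_complexPhase {κ : ℝ} {μ : ℂ} (hμ : μ ^ 2 + κ = 0) (P : Polynomial ℝ)
    (z : ℝ × ℝ) : planeOp κ (fun z => (Polynomial.aeval (complexPhase μ z) P).re) z = 0 := by
  have haeval := contDiff_two_of_contDiff_infty (contDiff_aeval P)
  have hhess (v w : ℝ × ℝ) :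
      hess (fun z => (Polynomial.aeval (complexPhase μ z) P).re) z v w
        = (Polynomial.aeval (complexPhase μ z) (Polynomial.derivative (Polynomial.derivative P))
          * complexPhase μ v * complexPhase μ w).re := by
    refine (hess_clm_comp (f := fun z => Polynomial.aeval (complexPhase μ z) P)
      (haeval.comp (complexPhase μ).contDiff) Complex.reCLM z v w).trans ?_
    rw [hess_comp_clm haeval, hess_aeval]
    rfl
  have hx : complexPhase μ (1, 0) = μ := by simp [complexPhase]
  have hζ : complexPhase μ (0, 1) = 1 := by simp [complexPhase]
  rw [planeOp, hhess, hhess, ← Complex.re_ofReal_mul, ← Complex.add_re, hx, hζ,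
    ← Complex.zero_re]
  congr 1
  linear_combination
    Polynomial.aeval (complexPhase μ z) (Polynomial.derivative (Polynomial.derivative P)) * hμ

theorem not_finiteDimensional_symmetryAlgebra (ha : p.a ≠ 0) (hε : p.ε₀ ≠ 0) (hm : p.m ≠ 0)
    (hd : p.d ≠ 0) (hw : p.w ≠ 0) : ¬ FiniteDimensional ℝ (symmetryAlgebra p) := by
  intro hfin
  obtain ⟨μ, hμ⟩ := IsAlgClosed.exists_pow_nat_eq (-(p.m * (p.m - p.d ^ 2) : ℝ) : ℂ) two_pos
  let T : Polynomial ℝ →ₗ[ℝ] (Jet0 → Jet0) :=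
    { toFun := fun P => planeVert p fun z => (Polynomial.aeval (complexPhase μ z) P).re
      map_add' := fun P Q => by
        simp only [planeVert_add, map_add, Complex.add_re]
        rfl
      map_smul' := fun r P => by
        simp only [smul_planeVert, map_smul, RingHom.id_apply, Complex.smul_re]
        rfl }
  have hT (P : Polynomial ℝ) : T P ∈ symmetryAlgebra p :=
    (mem_symmetryAlgebra_iff_planeVert ha hε hm hd hw _).2
      ⟨0, _, ⟨contDiff_re_aeval_complexPhase μ P,
        planeOp_re_aeval_complexPhase (by rw [hμ, neg_add_cancel]) P⟩, by simp [T]⟩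
  have hinj : Function.Injective (T.codRestrict _ hT) := by
    refine (injective_iff_map_eq_zero _).2 fun P hP => Polynomial.funext fun s => ?_
    have hTP : planeVert p (fun z => (Polynomial.aeval (complexPhase μ z) P).re) = 0 :=
      congrArg Subtype.val hP
    have hzero := ((sum_X_add_planeVert_eq_zero_iff hm 0 _).1 (by simpa using hTP)).2
    have hs : complexPhase μ (0, s) = s := by simp [complexPhase]
    have haeval : Polynomial.aeval (s : ℂ) P = (P.eval s : ℝ) := Polynomial.aeval_ofReal P s
    simpa [hs, haeval] using congrFun hzero (0, s)
  exact Polynomial.not_finite (Module.Finite.of_injective _ hinj)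

end Complex

end Plane

section PlaneSolution

/-- The functional `r x + s ζ` on the plane. -/
def linForm (r s : ℝ) : ℝ × ℝ →L[ℝ] ℝ :=
  r • ContinuousLinearMap.fst ℝ ℝ ℝ + s • ContinuousLinearMap.snd ℝ ℝ ℝ

theorem linForm_apply (r s : ℝ) (z : ℝ × ℝ) : linForm r s z = r * z.1 + s * z.2 := rfl

theorem IsPlaneSolution.add {κ : ℝ} {g h : ℝ × ℝ → ℝ} (hg : IsPlaneSolution κ g)
    (hh : IsPlaneSolution κ h) : IsPlaneSolution κ (g + h) := by
  refine ⟨hg.1.add hh.1, fun z => ?_⟩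
  have hadd := hess_add (contDiff_two_of_contDiff_infty hg.1)
    (contDiff_two_of_contDiff_infty hh.1) z
  have hg₀ := hg.2 z
  have hh₀ := hh.2 z
  simp only [planeOp, hadd, add_apply] at hg₀ hh₀ ⊢
  linear_combination hg₀ + hh₀

theorem isPlaneSolution_comp_linForm {κ r s : ℝ} (h : r ^ 2 + κ * s ^ 2 = 0) {F : ℝ → ℝ}
    (hF : ContDiff ℝ ∞ F) : IsPlaneSolution κ fun z => F (linForm r s z) := by
  refine ⟨hF.comp (linForm r s).contDiff, fun z => ?_⟩
  simp only [planeOp, hess_comp_functional (contDiff_two_of_contDiff_infty hF)]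
  simp only [linForm_apply (z := (1, 0)), linForm_apply (z := (0, 1))]
  linear_combination deriv (deriv F) (linForm r s z) * h

theorem isPlaneSolution_neg_sq_iff {α : ℝ} (hα : α ≠ 0) {h : ℝ × ℝ → ℝ} :
    IsPlaneSolution (-α ^ 2) h ↔ ∃ F G : ℝ → ℝ, ContDiff ℝ ∞ F ∧ ContDiff ℝ ∞ G ∧
      h = (fun z => F (linForm α (-1) z)) + fun z => G (linForm α 1 z) := by
  constructor
  · rintro ⟨hh, hop⟩
    have hh₂ := contDiff_two_of_contDiff_infty hh
    refine ⟨fun s => h ((s / (2 * α)) • (1, -α)), fun s => h ((s / (2 * α)) • (1, α)) - h 0,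
      by fun_prop, by fun_prop, funext fun z => ?_⟩
    have hmixed (z : ℝ × ℝ) : hess h z (1, -α) (1, α) = 0 := by
      have hz := hop z
      have hcomm := hess_comm hh₂ z (1, 0) (0, 1)
      have hneg : ((1, -α) : ℝ × ℝ) = (1, 0) - α • (0, 1) := by simp
      have hpos : ((1, α) : ℝ × ℝ) = (1, 0) + α • (0, 1) := by simp
      rw [hneg, hpos]
      simp only [planeOp, map_add, map_sub, map_smul, sub_apply, smul_apply, smul_eq_mul] at hz ⊢
      linear_combination hz + α * hcomm
    have hz : z = (linForm α (-1) z / (2 * α)) • (1, -α)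
        + (linForm α 1 z / (2 * α)) • ((1, α) : ℝ × ℝ) := by
      ext <;> simp [linForm_apply] <;> field_simp <;> ring
    nth_rw 1 [hz]
    rw [apply_add_of_hess_eq_zero hh₂ fun z => by
      simp only [map_smul, smul_apply, hmixed, smul_zero], add_sub_assoc]
    rfl
  · rintro ⟨F, G, hF, hG, rfl⟩
    exact (isPlaneSolution_comp_linForm (by ring) hF).add
      (isPlaneSolution_comp_linForm (by ring) hG)

theorem contDiff_fst_mul_comp_linForm (r s : ℝ) {R : ℝ → ℝ} (hR : ContDiff ℝ ∞ R) :
    ContDiff ℝ ∞ fun z : ℝ × ℝ => z.1 * R (linForm r s z) :=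
  contDiff_fst.mul (hR.comp (linForm r s).contDiff)

theorem fderiv_fst_mul_comp_linForm (r s : ℝ) {R : ℝ → ℝ} (hR : Differentiable ℝ R)
    (z v : ℝ × ℝ) : fderiv ℝ (fun z : ℝ × ℝ => z.1 * R (linForm r s z)) z v
      = z.1 * (deriv R (linForm r s z) * linForm r s v) + v.1 * R (linForm r s z) := by
  have hcomp : Differentiable ℝ fun z => R (linForm r s z) := hR.comp (linForm r s).differentiable
  rw [fderiv_fun_mul differentiableAt_fst (hcomp z)]
  simp [fderiv_comp_functional hR, fderiv_fst, mul_comm]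

theorem isPlaneSolution_fst_mul_comp_linForm (s : ℝ) {R : ℝ → ℝ} (hR : ContDiff ℝ ∞ R) :
    IsPlaneSolution 0 fun z => z.1 * R (linForm 0 s z) := by
  have hsmooth := contDiff_fst_mul_comp_linForm 0 s hR
  have hR₁ : Differentiable ℝ R := hR.differentiable (by simp)
  have hx : linForm 0 s (1, 0) = 0 := by simp [linForm_apply]
  refine ⟨hsmooth, fun z => ?_⟩
  rw [planeOp, ← fderiv_fderiv_apply (contDiff_two_of_contDiff_infty hsmooth)]
  simp only [fderiv_fst_mul_comp_linForm 0 s hR₁, hx, mul_zero, zero_add, one_mul, zero_mul,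
    add_zero, fderiv_comp_functional hR₁]

theorem isPlaneSolution_zero_iff {s : ℝ} (hs : s ≠ 0) {h : ℝ × ℝ → ℝ} :
    IsPlaneSolution 0 h ↔ ∃ R S : ℝ → ℝ, ContDiff ℝ ∞ R ∧ ContDiff ℝ ∞ S ∧
      h = (fun z => z.1 * R (linForm 0 s z)) + fun z => S (linForm 0 s z) := by
  constructor
  · rintro ⟨hh, hop⟩
    have hh₂ := contDiff_two_of_contDiff_infty hh
    have hxx (z : ℝ × ℝ) : hess h z (1, 0) (1, 0) = 0 := by simpa [planeOp] using hop z
    refine ⟨fun t => fderiv ℝ h (0, t / s) (1, 0), fun t => h (0, t / s),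
      ((hh.fderiv_right le_rfl).comp (by fun_prop)).clm_apply contDiff_const, by fun_prop,
      funext fun z => ?_⟩
    have hz : ((0, z.2) : ℝ × ℝ) + z.1 • (1, 0) = z := by ext <;> simp
    have hline := apply_add_smul_of_hess_eq_zero hh₂ hxx (0, z.2) z.1
    rw [hz] at hline
    simp [hline, linForm_apply, hs, add_comm]
  · rintro ⟨R, S, hR, hS, rfl⟩
    exact (isPlaneSolution_fst_mul_comp_linForm s hR).add
      (isPlaneSolution_comp_linForm (by ring) hS)

theorem isHarmonic_iff {H : ℂ → ℝ} : IsHarmonic H ↔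
    ContDiff ℝ ∞ H ∧ ∀ z, hess H z 1 1 + hess H z Complex.I Complex.I = 0 := by
  have hL (z : ℂ) : Laplacian.laplacian H z = hess H z 1 1 + hess H z Complex.I Complex.I := by
    rw [InnerProductSpace.laplacian_eq_iteratedFDeriv_complexPlane]
    simp [iteratedFDeriv_two_apply]
  constructor
  · intro h
    refine ⟨contDiff_iff_contDiffAt.2 fun z => (HarmonicAt.analyticAt (h z trivial)).contDiffAt,
      fun z => ?_⟩
    rw [← hL]
    exact (h z trivial).2.eq_of_nhds
  · rintro ⟨hH, hlap⟩ z -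
    exact ⟨(contDiff_two_of_contDiff_infty hH).contDiffAt,
      Filter.Eventually.of_forall fun y => (hL y).trans (hlap y)⟩

/-- The map `(x, ζ) ↦ x + i s ζ`. -/
def toComplex (s : ℝ) : ℝ × ℝ →L[ℝ] ℂ :=
  (ContinuousLinearMap.fst ℝ ℝ ℝ).smulRight 1
    + (ContinuousLinearMap.snd ℝ ℝ ℝ).smulRight (s • Complex.I)

theorem toComplex_apply (s : ℝ) (z : ℝ × ℝ) : toComplex s z = ⟨z.1, s * z.2⟩ := by
  apply Complex.ext <;> simp [toComplex, mul_comm]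

/-- The map `x + i σ ↦ (x, β σ)`. -/
def ofComplex (β : ℝ) : ℂ →L[ℝ] ℝ × ℝ := Complex.reCLM.prod (β • Complex.imCLM)

theorem toComplex_ofComplex {β : ℝ} (hβ : β ≠ 0) (z : ℂ) :
    toComplex β⁻¹ (ofComplex β z) = z := by
  apply Complex.ext <;> simp [toComplex_apply, ofComplex, hβ]

theorem isPlaneSolution_sq_iff {β : ℝ} (hβ : β ≠ 0) {h : ℝ × ℝ → ℝ} :
    IsPlaneSolution (β ^ 2) h ↔ ∃ H, IsHarmonic H ∧ h = fun z => H (toComplex β⁻¹ z) := by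
  constructor
  · rintro ⟨hh, hop⟩
    refine ⟨fun z => h (ofComplex β z), isHarmonic_iff.2 ⟨hh.comp (ofComplex β).contDiff,
      fun z => ?_⟩, funext fun z => ?_⟩
    · have h₁ : ofComplex β 1 = (1, 0) := by simp [ofComplex]
      have hI : ofComplex β Complex.I = β • (0, 1) := by simp [ofComplex]
      have hz := hop (ofComplex β z)
      simp only [planeOp] at hz
      simp only [hess_comp_clm (contDiff_two_of_contDiff_infty hh), h₁, hI, map_smul, smul_apply,
        smul_eq_mul]
      linear_combination hz
    · simp [ofComplex, toComplex_apply, hβ]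
  · rintro ⟨H, hH, rfl⟩
    obtain ⟨hH, hlap⟩ := isHarmonic_iff.1 hH
    refine ⟨hH.comp (toComplex β⁻¹).contDiff, fun z => ?_⟩
    have hx : toComplex β⁻¹ (1, 0) = 1 := by simp [toComplex]
    have hζ : toComplex β⁻¹ (0, 1) = β⁻¹ • Complex.I := by simp [toComplex]
    simp only [planeOp, hess_comp_clm (contDiff_two_of_contDiff_infty hH), hx, hζ, map_smul,
      smul_apply, smul_eq_mul]
    field_simp
    exact hlap _

end PlaneSolution

section Cases

variable {p : Params}

section Wave

variable (r s : ℝ) {F : ℝ → ℝ} (hF : ContDiff ℝ ∞ F)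

theorem contDiff_comp_linForm (hF : ContDiff ℝ ∞ F) :
    ContDiff ℝ ∞ fun z => F (linForm r s z) :=
  hF.comp (linForm r s).contDiff

include hF

theorem fderiv_comp_linForm (z v : ℝ × ℝ) : fderiv ℝ (fun z => F (linForm r s z)) z v
    = deriv F (linForm r s z) * linForm r s v :=
  fderiv_comp_functional (hF.differentiable (by simp)) _ z v

theorem lieBracket_X₁_planeVert_comp_linForm (p : Params) :
    lieBracket ℝ X₁ (planeVert p fun z => F (linForm r s z))
      = ((p.d - p.m * p.c) * s) • planeVert p fun z => deriv F (linForm r s z) := by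
  rw [lieBracket_X₁_planeVert p (contDiff_comp_linForm r s hF), smul_planeVert, smul_planeVert]
  congr 1
  ext z
  simp only [fderiv_comp_linForm r s hF, linForm_apply r s (0, 1), Pi.smul_apply, smul_eq_mul]
  ring

theorem lieBracket_X₂_planeVert_comp_linForm (p : Params) :
    lieBracket ℝ X₂ (planeVert p fun z => F (linForm r s z))
      = r • planeVert p fun z => deriv F (linForm r s z) := by
  rw [lieBracket_X₂_planeVert p (contDiff_comp_linForm r s hF), smul_planeVert]
  congr 1
  ext z
  simp [fderiv_comp_linForm r s hF, linForm_apply r s (1, 0), mul_comm]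

theorem lieBracket_X₃_planeVert_comp_linForm (p : Params) :
    lieBracket ℝ X₃ (planeVert p fun z => F (linForm r s z))
      = (p.m * s) • planeVert p fun z => deriv F (linForm r s z) := by
  rw [lieBracket_X₃_planeVert p (contDiff_comp_linForm r s hF), smul_planeVert, smul_planeVert]
  congr 1
  ext z
  simp only [fderiv_comp_linForm r s hF, linForm_apply r s (0, 1), Pi.smul_apply, smul_eq_mul]
  ring

end Wave

section Hyperbolic

theorem PA_eq_planeVert (p : Params) (F : ℝ → ℝ) :
    PA p F = planeVert p fun z => F (linForm (√(p.m * (p.d ^ 2 - p.m))) (-1) z) := by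
  refine congrArg vert (funext fun q => congrArg F ?_)
  simp only [linForm_apply, planeCoords_apply]
  ring

theorem QA_eq_planeVert (p : Params) (G : ℝ → ℝ) :
    QA p G = planeVert p fun z => G (linForm (√(p.m * (p.d ^ 2 - p.m))) 1 z) := by
  refine congrArg vert (funext fun q => congrArg G ?_)
  simp only [linForm_apply, planeCoords_apply]
  ring

theorem lieBracket_PA (p : Params) {F : ℝ → ℝ} (hF : ContDiff ℝ ∞ F) :
    lieBracket ℝ X₁ (PA p F) = (p.m * p.c - p.d) • PA p (deriv F) ∧
    lieBracket ℝ X₂ (PA p F) = √(p.m * (p.d ^ 2 - p.m)) • PA p (deriv F) ∧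
    lieBracket ℝ X₃ (PA p F) = (-p.m) • PA p (deriv F) ∧
    ∀ i : Fin 6, 3 ≤ i → lieBracket ℝ (X p i) (PA p F) = 0 := by
  simp only [PA_eq_planeVert, lieBracket_X₁_planeVert_comp_linForm _ _ hF,
    lieBracket_X₂_planeVert_comp_linForm _ _ hF, lieBracket_X₃_planeVert_comp_linForm _ _ hF,
    mul_neg, mul_one, neg_sub, true_and]
  exact lieBracket_X_planeVert_eq_zero p (contDiff_comp_linForm _ _ hF)

theorem lieBracket_QA (p : Params) {G : ℝ → ℝ} (hG : ContDiff ℝ ∞ G) :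
    lieBracket ℝ X₁ (QA p G) = (p.d - p.m * p.c) • QA p (deriv G) ∧
    lieBracket ℝ X₂ (QA p G) = √(p.m * (p.d ^ 2 - p.m)) • QA p (deriv G) ∧
    lieBracket ℝ X₃ (QA p G) = p.m • QA p (deriv G) ∧
    ∀ i : Fin 6, 3 ≤ i → lieBracket ℝ (X p i) (QA p G) = 0 := by
  simp only [QA_eq_planeVert, lieBracket_X₁_planeVert_comp_linForm _ _ hG,
    lieBracket_X₂_planeVert_comp_linForm _ _ hG, lieBracket_X₃_planeVert_comp_linForm _ _ hG,
    mul_one, true_and]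
  exact lieBracket_X_planeVert_eq_zero p (contDiff_comp_linForm _ _ hG)

theorem lieBracket_PA_QA (p : Params) {F G : ℝ → ℝ} (hF : ContDiff ℝ ∞ F)
    (hG : ContDiff ℝ ∞ G) :
    lieBracket ℝ (PA p F) (PA p G) = 0 ∧ lieBracket ℝ (PA p F) (QA p G) = 0 ∧
      lieBracket ℝ (QA p F) (QA p G) = 0 := by
  simp only [PA_eq_planeVert, QA_eq_planeVert, contDiff_comp_linForm, hF, hG,
    lieBracket_planeVert_planeVert, and_self]

theorem mem_symmetryAlgebra_iff_of_lt (ha : p.a ≠ 0) (hε : p.ε₀ ≠ 0) (hm : 0 < p.m)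
    (hd : p.d ≠ 0) (hw : p.w ≠ 0) (h : p.m < p.d ^ 2) (V : Jet0 → Jet0) :
    V ∈ symmetryAlgebra p ↔ ∃ (k : Fin 6 → ℝ) (F G : ℝ → ℝ), ContDiff ℝ ∞ F ∧ ContDiff ℝ ∞ G ∧
      V = (∑ i, k i • X p i) + PA p F + QA p G := by
  have hpos : 0 < p.m * (p.d ^ 2 - p.m) := mul_pos hm (sub_pos.2 h)
  have hκ : p.m * (p.m - p.d ^ 2) = -√(p.m * (p.d ^ 2 - p.m)) ^ 2 := by
    rw [Real.sq_sqrt hpos.le]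
    ring
  simp only [mem_symmetryAlgebra_iff_planeVert ha hε hm.ne' hd hw, hκ,
    isPlaneSolution_neg_sq_iff (Real.sqrt_pos.2 hpos).ne', add_assoc, PA_eq_planeVert,
    QA_eq_planeVert, planeVert_add]
  constructor
  · rintro ⟨k, _, ⟨F, G, hF, hG, rfl⟩, rfl⟩
    exact ⟨k, F, G, hF, hG, rfl⟩
  · rintro ⟨k, F, G, hF, hG, rfl⟩
    exact ⟨k, _, ⟨F, G, hF, hG, rfl⟩, rfl⟩

theorem comp_linForm_add_eq_zero_iff {α : ℝ} (hα : α ≠ 0) (F G : ℝ → ℝ) :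
    (fun z => F (linForm α (-1) z)) + (fun z => G (linForm α 1 z)) = 0 ↔
      ∃ r : ℝ, (∀ s, F s = r) ∧ ∀ s, G s = -r := by
  constructor
  · intro hzero
    have hsum (s t : ℝ) : F s + G t = 0 := by
      have hs : linForm α (-1) ((s + t) / (2 * α), (t - s) / 2) = s := by
        rw [linForm_apply]
        field_simp
        ring
      have ht : linForm α 1 ((s + t) / (2 * α), (t - s) / 2) = t := by
        rw [linForm_apply]
        field_simp
        ring
      simpa [hs, ht] using congrFun hzero ((s + t) / (2 * α), (t - s) / 2)
    exact ⟨F 0, fun s => by linarith [hsum s 0, hsum 0 0], fun s => by linarith [hsum 0 s]⟩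
  · rintro ⟨r, hF, hG⟩
    ext z
    simp [hF, hG]

theorem sum_X_add_PA_add_QA_eq_zero_iff (hm : 0 < p.m) (h : p.m < p.d ^ 2) (k : Fin 6 → ℝ)
    (F G : ℝ → ℝ) : (∑ i, k i • X p i) + PA p F + QA p G = 0 ↔
      k = 0 ∧ ∃ r : ℝ, (∀ s, F s = r) ∧ ∀ s, G s = -r := by
  rw [add_assoc, PA_eq_planeVert, QA_eq_planeVert, planeVert_add,
    sum_X_add_planeVert_eq_zero_iff hm.ne', comp_linForm_add_eq_zero_iff]
  exact (Real.sqrt_pos.2 (mul_pos hm (sub_pos.2 h))).ne'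

theorem lieBracket_X₂_X₆_of_lt (hm : 0 < p.m) (h : p.m < p.d ^ 2) : lieBracket ℝ X₂ (X₆ p) =
    (1 / (p.w * √(p.m * (p.d ^ 2 - p.m)))) • (PA p (fun s => s) + QA p (fun s => s)) := by
  have hα : √(p.m * (p.d ^ 2 - p.m)) ≠ 0 := (Real.sqrt_pos.2 (mul_pos hm (sub_pos.2 h))).ne'
  rw [lieBracket_X₂_X₆_eq_planeVert, PA_eq_planeVert, QA_eq_planeVert, planeVert_add,
    smul_planeVert]
  congr 1
  ext z
  simp only [linForm_apply, Pi.smul_apply, Pi.add_apply, smul_eq_mul]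
  field_simp
  ring

end Hyperbolic

section Elliptic

theorem PB_eq_planeVert (p : Params) (H : ℂ → ℝ) :
    PB p H = planeVert p fun z => H (toComplex (√(p.m * (p.m - p.d ^ 2)))⁻¹ z) := by
  simp only [PB, planeVert, toComplex_apply, planeCoords_apply, div_eq_inv_mul]

theorem derivX_eq_fderiv {H : ℂ → ℝ} (hH : Differentiable ℝ H) (z : ℂ) :
    derivX H z = fderiv ℝ H z 1 := by
  have hline : HasDerivAt (fun s : ℝ => (⟨s, z.im⟩ : ℂ)) 1 z.re := by
    simpa only [Complex.mk_eq_add_mul_I, Complex.ofRealCLM_apply, Complex.ofReal_one] using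
      (Complex.ofRealCLM.hasDerivAt (x := z.re)).add_const (z.im * Complex.I)
  exact ((hH z).hasFDerivAt.comp_hasDerivAt z.re hline).deriv

theorem derivσ_eq_fderiv {H : ℂ → ℝ} (hH : Differentiable ℝ H) (z : ℂ) :
    derivσ H z = fderiv ℝ H z Complex.I := by
  have hline : HasDerivAt (fun s : ℝ => (⟨z.re, s⟩ : ℂ)) Complex.I z.im := by
    simpa only [Complex.mk_eq_add_mul_I, Complex.ofRealCLM_apply, Complex.ofReal_one, one_mul] using
      ((Complex.ofRealCLM.hasDerivAt (x := z.im)).mul_const Complex.I).const_add (z.re : ℂ)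
  exact ((hH z).hasFDerivAt.comp_hasDerivAt z.im hline).deriv

theorem fderiv_comp_toComplex {H : ℂ → ℝ} (hH : Differentiable ℝ H) (s : ℝ) (z v : ℝ × ℝ) :
    fderiv ℝ (fun z => H (toComplex s z)) z v
      = v.1 * derivX H (toComplex s z) + s * v.2 * derivσ H (toComplex s z) := by
  have hv : toComplex s v = v.1 • 1 + (s * v.2) • Complex.I := by
    apply Complex.ext <;> simp [toComplex_apply]
  rw [fderiv_comp_clm hH, ContinuousLinearMap.comp_apply, hv, map_add, map_smul, map_smul,
    derivX_eq_fderiv hH, derivσ_eq_fderiv hH, smul_eq_mul, smul_eq_mul]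

theorem sqrt_div_eq_inv_sqrt_mul {x : ℝ} (hx : 0 ≤ x) (y : ℝ) :
    √(x / y) = (√(x * y))⁻¹ * x := by
  rw [Real.sqrt_div hx, Real.sqrt_mul hx, mul_inv, mul_right_comm, ← div_eq_inv_mul,
    Real.div_sqrt, div_eq_mul_inv]

theorem lieBracket_PB (hm : 0 ≤ p.m) {H : ℂ → ℝ} (hH : IsHarmonic H) :
    lieBracket ℝ X₁ (PB p H) =
      ((p.d - p.m * p.c) / √(p.m * (p.m - p.d ^ 2))) • PB p (derivσ H) ∧
    lieBracket ℝ X₂ (PB p H) = PB p (derivX H) ∧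
    lieBracket ℝ X₃ (PB p H) = √(p.m / (p.m - p.d ^ 2)) • PB p (derivσ H) ∧
    ∀ i : Fin 6, 3 ≤ i → lieBracket ℝ (X p i) (PB p H) = 0 := by
  have hsmooth := (isHarmonic_iff.1 hH).1
  have hcomp : ContDiff ℝ ∞ fun z => H (toComplex (√(p.m * (p.m - p.d ^ 2)))⁻¹ z) :=
    hsmooth.comp (toComplex _).contDiff
  simp only [PB_eq_planeVert, lieBracket_X₁_planeVert p hcomp, lieBracket_X₂_planeVert p hcomp,
    lieBracket_X₃_planeVert p hcomp, fderiv_comp_toComplex (hsmooth.differentiable (by simp)),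
    zero_mul, one_mul, mul_zero, mul_one, zero_add, add_zero, true_and]
  refine ⟨?_, ?_, lieBracket_X_planeVert_eq_zero p hcomp⟩
  · simp only [smul_planeVert, div_eq_mul_inv, mul_smul]
    rfl
  · simp only [smul_planeVert, sqrt_div_eq_inv_sqrt_mul hm, mul_comm _ p.m, mul_smul]
    rfl

theorem lieBracket_PB_PB (p : Params) {H K : ℂ → ℝ} (hH : IsHarmonic H) (hK : IsHarmonic K) :
    lieBracket ℝ (PB p H) (PB p K) = 0 := by
  rw [PB_eq_planeVert, PB_eq_planeVert]
  exact lieBracket_planeVert_planeVert p ((isHarmonic_iff.1 hH).1.comp (toComplex _).contDiff)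
    ((isHarmonic_iff.1 hK).1.comp (toComplex _).contDiff)

theorem mem_symmetryAlgebra_iff_of_gt (ha : p.a ≠ 0) (hε : p.ε₀ ≠ 0) (hm : 0 < p.m)
    (hd : p.d ≠ 0) (hw : p.w ≠ 0) (h : p.d ^ 2 < p.m) (V : Jet0 → Jet0) :
    V ∈ symmetryAlgebra p ↔ ∃ (k : Fin 6 → ℝ) (H : ℂ → ℝ), IsHarmonic H ∧
      V = (∑ i, k i • X p i) + PB p H := by
  have hpos : 0 < p.m * (p.m - p.d ^ 2) := mul_pos hm (sub_pos.2 h)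
  have hκ : p.m * (p.m - p.d ^ 2) = √(p.m * (p.m - p.d ^ 2)) ^ 2 := (Real.sq_sqrt hpos.le).symm
  rw [mem_symmetryAlgebra_iff_planeVert ha hε hm.ne' hd hw, hκ]
  simp only [isPlaneSolution_sq_iff (Real.sqrt_pos.2 hpos).ne', PB_eq_planeVert]
  constructor
  · rintro ⟨k, _, ⟨H, hH, rfl⟩, rfl⟩
    exact ⟨k, H, hH, rfl⟩
  · rintro ⟨k, H, hH, rfl⟩
    exact ⟨k, _, ⟨H, hH, rfl⟩, rfl⟩

theorem sum_X_add_PB_eq_zero_iff (hm : 0 < p.m) (h : p.d ^ 2 < p.m) (k : Fin 6 → ℝ)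
    (H : ℂ → ℝ) : (∑ i, k i • X p i) + PB p H = 0 ↔ k = 0 ∧ H = 0 := by
  have hβ : √(p.m * (p.m - p.d ^ 2)) ≠ 0 := (Real.sqrt_pos.2 (mul_pos hm (sub_pos.2 h))).ne'
  have hsurj : Function.Surjective (toComplex (√(p.m * (p.m - p.d ^ 2)))⁻¹) := fun z =>
    ⟨ofComplex _ z, toComplex_ofComplex hβ z⟩
  rw [PB_eq_planeVert, sum_X_add_planeVert_eq_zero_iff hm.ne']
  exact and_congr_right fun _ => hsurj.injective_comp_right.eq_iff' rfl

theorem lieBracket_X₂_X₆_of_gt (p : Params) :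
    lieBracket ℝ X₂ (X₆ p) = PB p (fun z => 2 * z.re / p.w) :=
  lieBracket_X₂_X₆ p

end Elliptic

section Parabolic

theorem linForm_planeCoords_of_eq (hd : p.d ≠ 0) (h : p.m = p.d ^ 2) (x : Fin 3 → ℝ) :
    linForm 0 p.d⁻¹ (planeCoords p x) = p.d * x 1 - (p.c * p.d - 1) * x 2 := by
  rw [linForm_apply, planeCoords_apply, h]
  field_simp
  ring

theorem PC_eq_planeVert (hd : p.d ≠ 0) (h : p.m = p.d ^ 2) (R : ℝ → ℝ) :
    PC p R = planeVert p fun z => z.1 * R (linForm 0 p.d⁻¹ z) := by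
  simp only [PC, planeVert, linForm_planeCoords_of_eq hd h]
  rfl

theorem QC_eq_planeVert (hd : p.d ≠ 0) (h : p.m = p.d ^ 2) (S : ℝ → ℝ) :
    QC p S = planeVert p fun z => S (linForm 0 p.d⁻¹ z) := by
  simp only [QC, planeVert, linForm_planeCoords_of_eq hd h]

theorem transport_speed_of_eq (hd : p.d ≠ 0) (h : p.m = p.d ^ 2) :
    (p.d - p.m * p.c) * p.d⁻¹ = 1 - p.c * p.d := by
  rw [h]
  field_simp

theorem mul_inv_of_eq (hd : p.d ≠ 0) (h : p.m = p.d ^ 2) : p.m * p.d⁻¹ = p.d := by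
  rw [h]
  field_simp

theorem lieBracket_PC (hd : p.d ≠ 0) (h : p.m = p.d ^ 2) {R : ℝ → ℝ} (hR : ContDiff ℝ ∞ R) :
    lieBracket ℝ X₁ (PC p R) = (1 - p.c * p.d) • PC p (deriv R) ∧
    lieBracket ℝ X₂ (PC p R) = QC p R ∧
    lieBracket ℝ X₃ (PC p R) = p.d • PC p (deriv R) ∧
    ∀ i : Fin 6, 3 ≤ i → lieBracket ℝ (X p i) (PC p R) = 0 := by
  have hsmooth := contDiff_fst_mul_comp_linForm 0 p.d⁻¹ hR
  have hζ : (fun z : ℝ × ℝ => z.1 * (deriv R (linForm 0 p.d⁻¹ z) * p.d⁻¹))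
      = p.d⁻¹ • fun z : ℝ × ℝ => z.1 * deriv R (linForm 0 p.d⁻¹ z) := by
    ext z
    simp only [Pi.smul_apply, smul_eq_mul]
    ring
  simp only [PC_eq_planeVert hd h, QC_eq_planeVert hd h, lieBracket_X₁_planeVert p hsmooth,
    lieBracket_X₂_planeVert p hsmooth, lieBracket_X₃_planeVert p hsmooth,
    fderiv_fst_mul_comp_linForm 0 p.d⁻¹ (hR.differentiable (by simp)),
    linForm_apply 0 p.d⁻¹ (0, 1), linForm_apply 0 p.d⁻¹ (1, 0), zero_mul, mul_zero, mul_one,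
    one_mul, zero_add, add_zero, hζ, ← smul_planeVert, smul_smul, transport_speed_of_eq hd h,
    mul_inv_of_eq hd h, true_and]
  exact lieBracket_X_planeVert_eq_zero p hsmooth

theorem lieBracket_QC (hd : p.d ≠ 0) (h : p.m = p.d ^ 2) {S : ℝ → ℝ} (hS : ContDiff ℝ ∞ S) :
    lieBracket ℝ X₁ (QC p S) = (1 - p.c * p.d) • QC p (deriv S) ∧
    lieBracket ℝ X₂ (QC p S) = 0 ∧
    lieBracket ℝ X₃ (QC p S) = p.d • QC p (deriv S) ∧
    ∀ i : Fin 6, 3 ≤ i → lieBracket ℝ (X p i) (QC p S) = 0 := by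
  simp only [QC_eq_planeVert hd h, lieBracket_X₁_planeVert_comp_linForm _ _ hS,
    lieBracket_X₂_planeVert_comp_linForm _ _ hS, lieBracket_X₃_planeVert_comp_linForm _ _ hS,
    transport_speed_of_eq hd h, mul_inv_of_eq hd h, zero_smul, true_and]
  exact lieBracket_X_planeVert_eq_zero p (contDiff_comp_linForm _ _ hS)

theorem lieBracket_PC_QC (hd : p.d ≠ 0) (h : p.m = p.d ^ 2) {R S : ℝ → ℝ}
    (hR : ContDiff ℝ ∞ R) (hS : ContDiff ℝ ∞ S) :
    lieBracket ℝ (PC p R) (PC p S) = 0 ∧ lieBracket ℝ (PC p R) (QC p S) = 0 ∧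
      lieBracket ℝ (QC p R) (QC p S) = 0 := by
  simp only [PC_eq_planeVert hd h, QC_eq_planeVert hd h, contDiff_comp_linForm,
    contDiff_fst_mul_comp_linForm, hR, hS, lieBracket_planeVert_planeVert, and_self]

theorem mem_symmetryAlgebra_iff_of_eq (ha : p.a ≠ 0) (hε : p.ε₀ ≠ 0) (hd : p.d ≠ 0)
    (hw : p.w ≠ 0) (h : p.m = p.d ^ 2) (V : Jet0 → Jet0) :
    V ∈ symmetryAlgebra p ↔ ∃ (k : Fin 6 → ℝ) (R S : ℝ → ℝ), ContDiff ℝ ∞ R ∧ ContDiff ℝ ∞ S ∧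
      V = (∑ i, k i • X p i) + PC p R + QC p S := by
  have hm : p.m ≠ 0 := h ▸ pow_ne_zero 2 hd
  have hκ : p.m * (p.m - p.d ^ 2) = 0 := by rw [h, sub_self, mul_zero]
  simp only [mem_symmetryAlgebra_iff_planeVert ha hε hm hd hw, hκ,
    isPlaneSolution_zero_iff (inv_ne_zero hd), add_assoc, PC_eq_planeVert hd h,
    QC_eq_planeVert hd h, planeVert_add]
  constructor
  · rintro ⟨k, _, ⟨R, S, hR, hS, rfl⟩, rfl⟩
    exact ⟨k, R, S, hR, hS, rfl⟩
  · rintro ⟨k, R, S, hR, hS, rfl⟩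
    exact ⟨k, _, ⟨R, S, hR, hS, rfl⟩, rfl⟩

theorem fst_mul_comp_linForm_add_eq_zero_iff {s : ℝ} (hs : s ≠ 0) (R S : ℝ → ℝ) :
    (fun z : ℝ × ℝ => z.1 * R (linForm 0 s z)) + (fun z => S (linForm 0 s z)) = 0 ↔
      R = 0 ∧ S = 0 := by
  constructor
  · intro hzero
    have hsum (x t : ℝ) : x * R t + S t = 0 := by
      simpa [linForm_apply, mul_div_cancel₀ t hs] using congrFun hzero (x, t / s)
    have hS (t : ℝ) : S t = 0 := by simpa using hsum 0 t
    exact ⟨funext fun t => by simpa [hS] using hsum 1 t, funext hS⟩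
  · rintro ⟨rfl, rfl⟩
    ext z
    simp

theorem sum_X_add_PC_add_QC_eq_zero_iff (hd : p.d ≠ 0) (h : p.m = p.d ^ 2) (k : Fin 6 → ℝ)
    (R S : ℝ → ℝ) : (∑ i, k i • X p i) + PC p R + QC p S = 0 ↔ k = 0 ∧ R = 0 ∧ S = 0 := by
  have hm : p.m ≠ 0 := h ▸ pow_ne_zero 2 hd
  rw [add_assoc, PC_eq_planeVert hd h, QC_eq_planeVert hd h, planeVert_add,
    sum_X_add_planeVert_eq_zero_iff hm, fst_mul_comp_linForm_add_eq_zero_iff (inv_ne_zero hd)]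

theorem lieBracket_X₂_X₆_of_eq (p : Params) :
    lieBracket ℝ X₂ (X₆ p) = PC p (fun _ => 2 / p.w) := by
  refine (lieBracket_X₂_X₆ p).trans ?_
  simp only [PC, mul_div_assoc, mul_div_left_comm]

end Parabolic

end Cases

end

end BRZR

open VectorField in
theorem mainTheorem1 (p : BRZR.Params)
    (ha : p.a ≠ 0) (hb : p.b ≠ 0) (hc : p.c ≠ 0)
    (hε : 0 < p.ε₀) (hd : 0 < p.d) (hm : 0 < p.m) (hw : 0 < p.w) :
    -- the symmetries form an infinite-dimensional Lie algebra
    (∀ V ∈ BRZR.symmetryAlgebra p, ∀ W ∈ BRZR.symmetryAlgebra p,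
      lieBracket ℝ V W ∈ BRZR.symmetryAlgebra p) ∧
    ¬ FiniteDimensional ℝ (BRZR.symmetryAlgebra p) ∧
    -- commutators of `X₁, …, X₆`, except for `[X₂, X₆]`
    lieBracket ℝ BRZR.X₁ (BRZR.X₅ p) = BRZR.X₄ p ∧
    lieBracket ℝ BRZR.X₁ (BRZR.X₆ p) = (2 : ℝ) • BRZR.X₅ p ∧
    (∀ i j : Fin 6, i < j → (i, j) ≠ (0, 4) → (i, j) ≠ (0, 5) → (i, j) ≠ (1, 5) →
      lieBracket ℝ (BRZR.X p i) (BRZR.X p j) = 0) ∧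
    -- the case `m < d²`
    (p.m < p.d ^ 2 →
      (∀ V, V ∈ BRZR.symmetryAlgebra p ↔
        ∃ (k : Fin 6 → ℝ) (F G : ℝ → ℝ), ContDiff ℝ ∞ F ∧ ContDiff ℝ ∞ G ∧
          V = (∑ i, k i • BRZR.X p i) + BRZR.PA p F + BRZR.QA p G) ∧
      (∀ (k : Fin 6 → ℝ) (F G : ℝ → ℝ), ContDiff ℝ ∞ F → ContDiff ℝ ∞ G →
        ((∑ i, k i • BRZR.X p i) + BRZR.PA p F + BRZR.QA p G = 0 ↔
          k = 0 ∧ ∃ r : ℝ, (∀ s, F s = r) ∧ ∀ s, G s = -r)) ∧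
      lieBracket ℝ BRZR.X₂ (BRZR.X₆ p) =
        (1 / (p.w * √(p.m * (p.d ^ 2 - p.m)))) • (BRZR.PA p (fun s => s) + BRZR.QA p (fun s => s)) ∧
      (∀ F : ℝ → ℝ, ContDiff ℝ ∞ F →
        lieBracket ℝ BRZR.X₁ (BRZR.PA p F) = (p.m * p.c - p.d) • BRZR.PA p (deriv F) ∧
        lieBracket ℝ BRZR.X₂ (BRZR.PA p F) =
          √(p.m * (p.d ^ 2 - p.m)) • BRZR.PA p (deriv F) ∧
        lieBracket ℝ BRZR.X₃ (BRZR.PA p F) = (-p.m) • BRZR.PA p (deriv F) ∧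
        ∀ i : Fin 6, 3 ≤ i → lieBracket ℝ (BRZR.X p i) (BRZR.PA p F) = 0) ∧
      (∀ G : ℝ → ℝ, ContDiff ℝ ∞ G →
        lieBracket ℝ BRZR.X₁ (BRZR.QA p G) = (p.d - p.m * p.c) • BRZR.QA p (deriv G) ∧
        lieBracket ℝ BRZR.X₂ (BRZR.QA p G) =
          √(p.m * (p.d ^ 2 - p.m)) • BRZR.QA p (deriv G) ∧
        lieBracket ℝ BRZR.X₃ (BRZR.QA p G) = p.m • BRZR.QA p (deriv G) ∧
        ∀ i : Fin 6, 3 ≤ i → lieBracket ℝ (BRZR.X p i) (BRZR.QA p G) = 0) ∧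
      (∀ F G : ℝ → ℝ, ContDiff ℝ ∞ F → ContDiff ℝ ∞ G →
        lieBracket ℝ (BRZR.PA p F) (BRZR.PA p G) = 0 ∧
        lieBracket ℝ (BRZR.PA p F) (BRZR.QA p G) = 0 ∧
        lieBracket ℝ (BRZR.QA p F) (BRZR.QA p G) = 0)) ∧
    -- the case `m > d²`
    (p.d ^ 2 < p.m →
      (∀ V, V ∈ BRZR.symmetryAlgebra p ↔
        ∃ (k : Fin 6 → ℝ) (H : ℂ → ℝ), BRZR.IsHarmonic H ∧
          V = (∑ i, k i • BRZR.X p i) + BRZR.PB p H) ∧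
      (∀ (k : Fin 6 → ℝ) (H : ℂ → ℝ), BRZR.IsHarmonic H →
        ((∑ i, k i • BRZR.X p i) + BRZR.PB p H = 0 ↔ k = 0 ∧ H = 0)) ∧
      lieBracket ℝ BRZR.X₂ (BRZR.X₆ p) = BRZR.PB p (fun z => 2 * z.re / p.w) ∧
      (∀ H : ℂ → ℝ, BRZR.IsHarmonic H →
        lieBracket ℝ BRZR.X₁ (BRZR.PB p H) =
          ((p.d - p.m * p.c) / √(p.m * (p.m - p.d ^ 2))) • BRZR.PB p (BRZR.derivσ H) ∧
        lieBracket ℝ BRZR.X₂ (BRZR.PB p H) = BRZR.PB p (BRZR.derivX H) ∧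
        lieBracket ℝ BRZR.X₃ (BRZR.PB p H) =
          √(p.m / (p.m - p.d ^ 2)) • BRZR.PB p (BRZR.derivσ H) ∧
        ∀ i : Fin 6, 3 ≤ i → lieBracket ℝ (BRZR.X p i) (BRZR.PB p H) = 0) ∧
      (∀ H K : ℂ → ℝ, BRZR.IsHarmonic H → BRZR.IsHarmonic K →
        lieBracket ℝ (BRZR.PB p H) (BRZR.PB p K) = 0)) ∧
    -- the case `m = d²`
    (p.m = p.d ^ 2 →
      (∀ V, V ∈ BRZR.symmetryAlgebra p ↔
        ∃ (k : Fin 6 → ℝ) (R S : ℝ → ℝ), ContDiff ℝ ∞ R ∧ ContDiff ℝ ∞ S ∧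
          V = (∑ i, k i • BRZR.X p i) + BRZR.PC p R + BRZR.QC p S) ∧
      (∀ (k : Fin 6 → ℝ) (R S : ℝ → ℝ), ContDiff ℝ ∞ R → ContDiff ℝ ∞ S →
        ((∑ i, k i • BRZR.X p i) + BRZR.PC p R + BRZR.QC p S = 0 ↔ k = 0 ∧ R = 0 ∧ S = 0)) ∧
      lieBracket ℝ BRZR.X₂ (BRZR.X₆ p) = BRZR.PC p (fun _ => 2 / p.w) ∧
      (∀ R : ℝ → ℝ, ContDiff ℝ ∞ R →
        lieBracket ℝ BRZR.X₁ (BRZR.PC p R) = (1 - p.c * p.d) • BRZR.PC p (deriv R) ∧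
        lieBracket ℝ BRZR.X₂ (BRZR.PC p R) = BRZR.QC p R ∧
        lieBracket ℝ BRZR.X₃ (BRZR.PC p R) = p.d • BRZR.PC p (deriv R) ∧
        ∀ i : Fin 6, 3 ≤ i → lieBracket ℝ (BRZR.X p i) (BRZR.PC p R) = 0) ∧
      (∀ S : ℝ → ℝ, ContDiff ℝ ∞ S →
        lieBracket ℝ BRZR.X₁ (BRZR.QC p S) = (1 - p.c * p.d) • BRZR.QC p (deriv S) ∧
        lieBracket ℝ BRZR.X₂ (BRZR.QC p S) = 0 ∧
        lieBracket ℝ BRZR.X₃ (BRZR.QC p S) = p.d • BRZR.QC p (deriv S) ∧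
        ∀ i : Fin 6, 3 ≤ i → lieBracket ℝ (BRZR.X p i) (BRZR.QC p S) = 0) ∧
      (∀ R S : ℝ → ℝ, ContDiff ℝ ∞ R → ContDiff ℝ ∞ S →
        lieBracket ℝ (BRZR.PC p R) (BRZR.PC p S) = 0 ∧
        lieBracket ℝ (BRZR.PC p R) (BRZR.QC p S) = 0 ∧
        lieBracket ℝ (BRZR.QC p R) (BRZR.QC p S) = 0)) := by
  refine ⟨fun V hV W hW =>
      BRZR.lieBracket_mem_symmetryAlgebra ha hε.ne' hm.ne' hd.ne' hw.ne' hV hW,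
    BRZR.not_finiteDimensional_symmetryAlgebra ha hε.ne' hm.ne' hd.ne' hw.ne',
    BRZR.lieBracket_X₁_X₅ p, BRZR.lieBracket_X₁_X₆ p, BRZR.lieBracket_X_eq_zero p,
    fun hlt => ?_, fun hgt => ?_, fun heq => ?_⟩
  · exact ⟨BRZR.mem_symmetryAlgebra_iff_of_lt ha hε.ne' hm hd.ne' hw.ne' hlt,
      fun k F G _ _ => BRZR.sum_X_add_PA_add_QA_eq_zero_iff hm hlt k F G,
      BRZR.lieBracket_X₂_X₆_of_lt hm hlt, fun F => BRZR.lieBracket_PA p,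
      fun G => BRZR.lieBracket_QA p, fun F G => BRZR.lieBracket_PA_QA p⟩
  · exact ⟨BRZR.mem_symmetryAlgebra_iff_of_gt ha hε.ne' hm hd.ne' hw.ne' hgt,
      fun k H _ => BRZR.sum_X_add_PB_eq_zero_iff hm hgt k H,
      BRZR.lieBracket_X₂_X₆_of_gt p, fun H => BRZR.lieBracket_PB hm.le,
      fun H K => BRZR.lieBracket_PB_PB p⟩
  · exact ⟨BRZR.mem_symmetryAlgebra_iff_of_eq ha hε.ne' hd.ne' hw.ne' heq,
      fun k R S _ _ => BRZR.sum_X_add_PC_add_QC_eq_zero_iff hd.ne' heq k R S,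
      BRZR.lieBracket_X₂_X₆_of_eq p, fun R => BRZR.lieBracket_PC hd.ne' heq,
      fun S => BRZR.lieBracket_QC hd.ne' heq, fun R S => BRZR.lieBracket_PC_QC hd.ne' heq⟩
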